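/- **Setting.** Let $I=(0,1)$, let $U\subset\mathbb R^d$ be convex with non-empty interior, let $f\in C^2(U,\mathbb R^d)$, and let $(\eta,q)$ be an entropy/entropy-flux pair: $\eta\in C^2(U)$ strictly convex, $q\in C^1(U)$, $Dq=D\eta\,Df$. Let $\mathfrak D\subset U$ be compact and convex, and let $C_{\bar f}\ge0$, $0<C_{\underline\eta}\le C_{\overline\eta}$ be constants such that, for all $z\in\mathfrak D$ and $v\in\mathbb R^d$, $$|v^TD^2f(z)v|\le C_{\bar f}|v|^2,\qquad C_{\underline\eta}|v|^2\le v^TD^2\eta(z)v\le C_{\overline\eta}|v|^2 .$$ Let $u\in L_\infty(I\times(0,\infty),U)$ be an entropy solution of $\partial_tu+\partial_xf(u)=0$ with periodic boundary conditions and initial data $u_0\in L_\infty(I,U)$, that is, $$\int_0^\infty\!\!\int_0^1 u\cdot\partial_t\phi+f(u)\cdot\partial_x\phi\,dx\,dt+\int_0^1u_0\cdot\phi(\cdot,0)\,dx=0\quad\forall\phi\in C_c^\infty(S^1\times[0,\infty),\mathbb R^d),$$ $$\int_0^\infty\!\!\int_0^1 \eta(u)\partial_t\phi+q(u)\partial_x\phi\,dx\,dt+\int_0^1\eta(u_0)\phi(\cdot,0)\,dx\ge0\quad\forall\phi\in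 C_c^\infty(S^1\times[0,\infty),[0,\infty)),$$ where $S^1$ is $[0,1]$ with matching end points, and assume that $u$ takes values in $\mathfrak D$ almost everywhere. **Lemma (error bound for the reconstruction).** The class $u$ has a representative for which $t\mapsto u(\cdot,t)$ is weak-$*$ continuous from $(0,\infty)$ to $L_\infty(I)$. For every such representative, still denoted $u$, and for every $T\in(0,\infty]$ the following holds (times $t\in[0,T]$ mean $t\in[0,\infty)$ if $T=\infty$). (a) Let $\widehat u$ be a function on $[0,1]\times[0,T]$ that is Lipschitz continuous on $[0,1]\times[0,S]$ for every finite $S\le T$, satisfies $\widehat u(0,t)=\widehat u(1,t)$, takes values in $\mathfrak D$, and solves $\partial_t\widehat u+\partial_xf(\widehat u)=R$ almost everywhere in $I\times(0,T)$. Then, with $\widehat u_0=\widehat u(\cdot,0)$, for every finite $s\in(0,T]$, $$C_{\underline\eta}\|u(\cdot,s)-\widehat u(\cdot,s)\|_{L_2(I)}^2\le C_{\overline\eta}\|u_0-\widehat u_0\|_{L_2(I)}^2+\bigl(C_{\bar f}C_{\overline\eta}\|\widehat u\|_{W^{1,\infty}}+C_{\overline\eta}^2\bigr)\int_0^s\|u(\cdot,\sigma)-\widehat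 u(\cdot,\sigma)\|_{L_2(I)}^2\,d\sigma+\|R\|_{L_2(I\times(0,s))}^2,\tag{$*$}$$ where $\|\widehat u\|_{W^{1,\infty}}=\sup_{0<t<s}\bigl(\|\widehat u(\cdot,t)\|_{L_\infty(I)}+\|\partial_x\widehat u(\cdot,t)\|_{L_\infty(I)}\bigr)$. (b) In particular $(*)$ holds for the reconstruction of a discontinuous Galerkin solution. Let $0=x_0<\dots<x_N=1$, $I_n=[x_n,x_{n+1}]$, and let $\mathbb V_k$ be the $\mathbb R^d$-valued piecewise polynomials of degree $\le k$ on this mesh ($\mathbb V_{-1}=\{0\}$); $g(x_n^\pm)$ are one-sided traces, with $g(x_0^-):=g(x_N^-)$ and $g(x_N^+):=g(x_0^+)$, and $[\![g]\!]_n=g(x_n^-)-g(x_n^+)$. Let the numerical flux be $F(a,b)=f(w(a,b))$, where $w:U\times U\to U$ satisfies, for some $L>0$, $|w(a,b)-a|\le L|a-b|$ and $|w(a,b)-b|\le L|a-b|$. Let $p\ge0$ and let $u_h\in C^1([0,T],\mathbb V_p)$ have values in $U$ and satisfy, for all $t\in[0,T]$ and $\phi\in\mathbb V_p$, $$\sum_{n=0}^{N-1}\int_{I_n}\bigl(\partial_tu_h\cdot\phi+\partial_xf(u_h)\cdot\phi\bigr)dx+\sum_{n=0}^{N-1}\bigl(F(u_h(x_n^-),u_h(x_n^+))\cdot[\![\phi]\!]_n-[\![f(u_h)\cdot\phi]\!]_n\bigr)=0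 .$$ At each time let $\widehat u\in\mathbb V_{p+1}$ be given by $\int_I\widehat u\cdot\phi\,dx=\int_Iu_h\cdot\phi\,dx$ for all $\phi\in\mathbb V_{p-1}$ and $\widehat u(x_n^\pm)=w(u_h(x_n^-),u_h(x_n^+))$ at all nodes, and let $\widehat f\in\mathbb V_{p+1}$ be given by $$\sum_n\int_{I_n}\partial_x\widehat f\cdot\phi\,dx=\sum_n\int_{I_n}\partial_xf(u_h)\cdot\phi\,dx+\sum_n\bigl(f(w(u_h(x_n^-),u_h(x_n^+)))\cdot[\![\phi]\!]_n-[\![f(u_h)\cdot\phi]\!]_n\bigr)\quad\forall\phi\in\mathbb V_p$$ and $\widehat f(x_n^+)=f(w(u_h(x_n^-),u_h(x_n^+)))$ for $0\le n<N$. Put $R=\partial_xf(\widehat u)-\partial_x\widehat f+\partial_t\widehat u-\partial_tu_h$. If $\widehat u$ takes values in $\mathfrak D$ and is Lipschitz continuous in $(x,t)$ on $[0,1]\times[0,S]$ for every finite $S\le T$, then $(*)$ holds for every finite $s\in(0,T]$. -/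

import Mathlib

open MeasureTheory Set

namespace ConsLaw

noncomputable section

/-- `ℝ^d` with the Euclidean norm. -/
abbrev Vec (d : ℕ) : Type := EuclideanSpace ℝ (Fin d)

/-! ### The conservation law, its entropy, and entropy solutions -/

/-- Flux `f ∈ C²(U, ℝ^d)` and entropy / entropy-flux pair `(η, q)` on the convex state space `U`:
`η ∈ C²(U)` is strictly convex, `q ∈ C¹(U)` and `Dq = Dη Df`. The state space need not be open;
it has interior points, so that derivatives within `U` are unique. -/
structure IsEntropySystem {d : ℕ} (U : Set (Vec d)) (f : Vec d → Vec d) (η q : Vec d → ℝ) :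
    Prop where
  convex_states : Convex ℝ U
  interior_nonempty : (interior U).Nonempty
  flux_smooth : ContDiffOn ℝ 2 f U
  entropy_smooth : ContDiffOn ℝ 2 η U
  entropy_strictConvex : StrictConvexOn ℝ U η
  entropyFlux_smooth : ContDiffOn ℝ 1 q U
  compatible : ∀ z ∈ U,
    fderivWithin ℝ q U z = (fderivWithin ℝ η U z).comp (fderivWithin ℝ f U z)

/-- The constants bound the second derivatives of `f` and `η` on `D`:
`|vᵀ D²f(z) v| ≤ Cf |v|²` and `Clo |v|² ≤ vᵀ D²η(z) v ≤ Chi |v|²`, for `z ∈ D`, `v ∈ ℝ^d`. -/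
structure HessianBounds {d : ℕ} (U D : Set (Vec d)) (f : Vec d → Vec d) (η : Vec d → ℝ)
    (Cf Clo Chi : ℝ) : Prop where
  flux_le : ∀ z ∈ D, ∀ v : Vec d,
    ‖fderivWithin ℝ (fderivWithin ℝ f U) U z v v‖ ≤ Cf * ‖v‖ ^ 2
  le_entropy : ∀ z ∈ D, ∀ v : Vec d,
    Clo * ‖v‖ ^ 2 ≤ fderivWithin ℝ (fderivWithin ℝ η U) U z v v
  entropy_le : ∀ z ∈ D, ∀ v : Vec d,
    fderivWithin ℝ (fderivWithin ℝ η U) U z v v ≤ Chi * ‖v‖ ^ 2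

/-- Test functions in `C_c^∞(S¹ × [0, ∞), F)`: (restrictions to `t ≥ 0` of) smooth functions of
`(x, t)`, 1-periodic in `x`, vanishing for large `t`. They need not vanish at `t = 0`. -/
structure IsTestFunction {F : Type*} [NormedAddCommGroup F] [NormedSpace ℝ F]
    (φ : ℝ → ℝ → F) : Prop where
  smooth : ContDiff ℝ ((⊤ : ℕ∞) : WithTop ℕ∞) (Function.uncurry φ)
  periodic : ∀ x t, φ (x + 1) t = φ x t
  support_bounded : ∃ T : ℝ, ∀ x t, T ≤ t → φ x t = 0

/-- `u ∈ L_∞((0,1) × (0,∞), U)` is an entropy solution of `∂ₜu + ∂ₓf(u) = 0` with periodic boundary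
conditions and initial data `u₀ ∈ L_∞((0,1), U)`, for the entropy / entropy-flux pair `(η, q)`.
Arguments are ordered as `u x t`. -/
structure IsEntropySolution {d : ℕ} (U : Set (Vec d)) (f : Vec d → Vec d) (η q : Vec d → ℝ)
    (u₀ : ℝ → Vec d) (u : ℝ → ℝ → Vec d) : Prop where
  init_measurable : AEStronglyMeasurable u₀ (volume.restrict (Ioo 0 1))
  init_bounded : ∃ M : ℝ, ∀ᵐ x ∂(volume.restrict (Ioo (0 : ℝ) 1)), ‖u₀ x‖ ≤ M
  init_mem : ∀ᵐ x ∂(volume.restrict (Ioo (0 : ℝ) 1)), u₀ x ∈ U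
  measurable : AEStronglyMeasurable (Function.uncurry u)
    (volume.restrict (Ioo (0 : ℝ) 1 ×ˢ Ioi (0 : ℝ)))
  bounded : ∃ M : ℝ, ∀ᵐ z ∂(volume.restrict (Ioo (0 : ℝ) 1 ×ˢ Ioi (0 : ℝ))), ‖u z.1 z.2‖ ≤ M
  mem : ∀ᵐ z ∂(volume.restrict (Ioo (0 : ℝ) 1 ×ˢ Ioi (0 : ℝ))), u z.1 z.2 ∈ U
  weak : ∀ φ : ℝ → ℝ → Vec d, IsTestFunction φ →
    (∫ t in Ioi (0 : ℝ), ∫ x in Ioo (0 : ℝ) 1,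
        (inner ℝ (u x t) (deriv (fun τ => φ x τ) t)
          + inner ℝ (f (u x t)) (deriv (fun y => φ y t) x)))
      + ∫ x in Ioo (0 : ℝ) 1, inner ℝ (u₀ x) (φ x 0) = 0
  entropy : ∀ φ : ℝ → ℝ → ℝ, IsTestFunction φ → (∀ x t, 0 ≤ t → 0 ≤ φ x t) →
    0 ≤ (∫ t in Ioi (0 : ℝ), ∫ x in Ioo (0 : ℝ) 1,
        (η (u x t) * deriv (fun τ => φ x τ) t + q (u x t) * deriv (fun y => φ y t) x))
      + ∫ x in Ioo (0 : ℝ) 1, η (u₀ x) * φ x 0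

/-- `v` is a representative of the class `u ∈ L_∞((0,1) × (0,∞))` for which `t ↦ v(·, t)` is
weak-* continuous from `(0, ∞)` to `L_∞(0,1)`; it gives a meaning to `u(·, s)` for every `s > 0`. -/
structure IsTimeContinuousRep {d : ℕ} (u v : ℝ → ℝ → Vec d) : Prop where
  ae_eq : ∀ᵐ z ∂(volume.restrict (Ioo (0 : ℝ) 1 ×ˢ Ioi (0 : ℝ))), v z.1 z.2 = u z.1 z.2
  measurable : ∀ t : ℝ, 0 < t →
    AEStronglyMeasurable (fun x => v x t) (volume.restrict (Ioo 0 1))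
  bounded : ∃ M : ℝ, ∀ t : ℝ, 0 < t →
    ∀ᵐ x ∂(volume.restrict (Ioo (0 : ℝ) 1)), ‖v x t‖ ≤ M
  weakStar_continuous : ∀ ψ : ℝ → Vec d, IntegrableOn ψ (Ioo 0 1) →
    ContinuousOn (fun t : ℝ => ∫ x in Ioo (0 : ℝ) 1, inner ℝ (v x t) (ψ x)) (Ioi 0)

/-! ### Lipschitz functions and the error bound -/

/-- The time interval `[0, T]` for `T < ∞`, and `[0, ∞)` for `T = ∞`. -/
def timeInterval (T : EReal) : Set ℝ := {t | 0 ≤ t ∧ (t : EReal) ≤ T}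

/-- `g` is Lipschitz in `(x, t)` on `[0,1] × [0,S]` for every `S` in the time interval; for finite
`T` this says that `g` is Lipschitz on `[0,1] × [0,T]`. -/
def IsLipschitz {d : ℕ} (T : EReal) (g : ℝ → ℝ → Vec d) : Prop :=
  ∀ S ∈ timeInterval T, ∃ K : NNReal,
    LipschitzOnWith K (Function.uncurry g) (Icc (0 : ℝ) 1 ×ˢ Icc (0 : ℝ) S)

/-- `‖g‖_{W^{1,∞}}` up to time `s`: the supremum over `t ∈ (0, s)` of
`‖g(·,t)‖_{L_∞(0,1)} + ‖∂ₓg(·,t)‖_{L_∞(0,1)}` (finite for the Lipschitz functions at hand, whose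
weak and almost-everywhere derivatives agree). -/
def normW1Inf {d : ℕ} (g : ℝ → ℝ → Vec d) (s : ℝ) : ℝ :=
  (⨆ t ∈ Ioo (0 : ℝ) s,
    (eLpNorm (fun x => g x t) ⊤ (volume.restrict (Ioo (0 : ℝ) 1))
      + eLpNorm (fun x => deriv (fun y => g y t) x) ⊤ (volume.restrict (Ioo (0 : ℝ) 1)))).toReal

/-- `∂ₜg + ∂ₓf(g) = R` almost everywhere in `(0,1) × (0,T)`. -/
def SolvesPerturbed {d : ℕ} (f : Vec d → Vec d) (T : EReal) (g R : ℝ → ℝ → Vec d) : Prop :=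
  ∀ᵐ z ∂(volume.restrict (Ioo (0 : ℝ) 1 ×ˢ {t : ℝ | 0 < t ∧ (t : EReal) < T})),
    deriv (fun τ => g z.1 τ) z.2 + deriv (fun y => f (g y z.2)) z.1 = R z.1 z.2

/-- The error bound at time `s` for the difference between `v` (initial data `v₀`) and `g`
(residual `R`). -/
def ErrorBound {d : ℕ} (Cf Clo Chi : ℝ) (v₀ : ℝ → Vec d) (v g R : ℝ → ℝ → Vec d) (s : ℝ) : Prop :=
  Clo * ∫ x in Ioo (0 : ℝ) 1, ‖v x s - g x s‖ ^ 2
    ≤ Chi * (∫ x in Ioo (0 : ℝ) 1, ‖v₀ x - g x 0‖ ^ 2)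
      + (Cf * Chi * normW1Inf g s + Chi ^ 2)
          * (∫ σ in Ioo (0 : ℝ) s, ∫ x in Ioo (0 : ℝ) 1, ‖v x σ - g x σ‖ ^ 2)
      + ∫ z in Ioo (0 : ℝ) 1 ×ˢ Ioo (0 : ℝ) s, ‖R z.1 z.2‖ ^ 2

/-! ### The semi-discrete discontinuous Galerkin scheme and its reconstruction -/

/-- A mesh `0 = x₀ < x₁ < ⋯ < x_N = 1`. -/
structure Mesh (N : ℕ) where
  node : Fin (N + 1) → ℝ
  strictMono : StrictMono node
  first : node 0 = 0
  last : node (Fin.last N) = 1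

namespace Mesh

variable {N : ℕ}

/-- Left end point of the `n`-th cell. -/
def left (m : Mesh N) (n : Fin N) : ℝ := m.node n.castSucc

/-- Right end point of the `n`-th cell. -/
def right (m : Mesh N) (n : Fin N) : ℝ := m.node n.succ

end Mesh

/-- An `ℝ^d`-valued piecewise polynomial: one polynomial for each cell and component. -/
abbrev PwPoly (N d : ℕ) : Type := Fin N → Fin d → Polynomial ℝ

namespace PwPoly

variable {N d : ℕ}

/-- All degrees are `< k`, i.e. `g` belongs to `𝕍_{k-1}` (and `g = 0` if `k = 0`). -/
def DegLT (k : ℕ) (g : PwPoly N d) : Prop := ∀ n i, (g n i).degree < (k : WithBot ℕ)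

/-- Value at `x` of the polynomial belonging to the `n`-th cell. -/
def val (g : PwPoly N d) (n : Fin N) (x : ℝ) : Vec d :=
  WithLp.toLp 2 (fun i => (g n i).eval x)

/-- `g(x_n⁺)`: the trace at the left end point of cell `n` from inside that cell. -/
def tracePlus (m : Mesh N) (g : PwPoly N d) (n : Fin N) : Vec d := g.val n (m.left n)

/-- `g(x_n⁻)`: the trace at the left end point of cell `n` from the preceding cell, where the cell
preceding the first one is the last one (periodicity). -/
def traceMinus (m : Mesh N) (g : PwPoly N d) (n : Fin N) : Vec d :=
  g.val ((finRotate N).symm n) (m.right ((finRotate N).symm n))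

end PwPoly

/-- The numerical flux `F` is `f ∘ w` with `w : U × U → U` satisfying
`|w(a,b) - a| ≤ L |a - b|` and `|w(a,b) - b| ≤ L |a - b|`. -/
structure IsNumericalFlux {d : ℕ} (U : Set (Vec d)) (f : Vec d → Vec d)
    (F w : Vec d → Vec d → Vec d) (L : ℝ) : Prop where
  L_pos : 0 < L
  maps : ∀ a ∈ U, ∀ b ∈ U, w a b ∈ U
  flux_eq : ∀ a ∈ U, ∀ b ∈ U, F a b = f (w a b)
  close_left : ∀ a ∈ U, ∀ b ∈ U, ‖w a b - a‖ ≤ L * ‖a - b‖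
  close_right : ∀ a ∈ U, ∀ b ∈ U, ‖w a b - b‖ ≤ L * ‖a - b‖

/-- `∑ₙ ∫_{Iₙ} ∂ₓf(g)·φ dx + ∑ₙ (F(g(xₙ⁻), g(xₙ⁺))·⟦φ⟧ₙ - ⟦f(g)·φ⟧ₙ)`, with
`⟦ψ⟧ₙ = ψ(xₙ⁻) - ψ(xₙ⁺)`. -/
def dgFluxForm {N d : ℕ} (m : Mesh N) (f : Vec d → Vec d) (F : Vec d → Vec d → Vec d)
    (g φ : PwPoly N d) : ℝ :=
  (∑ n, ∫ x in Ioo (m.left n) (m.right n),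
      inner ℝ (deriv (fun y => f (g.val n y)) x) (φ.val n x))
    + ∑ n, (inner ℝ (F (g.traceMinus m n) (g.tracePlus m n)) (φ.traceMinus m n - φ.tracePlus m n)
        - (inner ℝ (f (g.traceMinus m n)) (φ.traceMinus m n)
          - inner ℝ (f (g.tracePlus m n)) (φ.tracePlus m n)))

/-- `∂ₜg` in the `n`-th cell at `(x, t)`, for a time dependent piecewise polynomial. -/
def timeDeriv {N d : ℕ} (T : EReal) (g : ℝ → PwPoly N d) (n : Fin N) (x t : ℝ) : Vec d :=
  derivWithin (fun τ => (g τ).val n x) (timeInterval T) t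

/-- `uh ∈ C¹([0,T], 𝕍_p)`, with values in `U`, solves the semi-discrete scheme. -/
structure IsDGSolution {N d : ℕ} (m : Mesh N) (p : ℕ) (U : Set (Vec d)) (f : Vec d → Vec d)
    (F : Vec d → Vec d → Vec d) (T : EReal) (uh : ℝ → PwPoly N d) : Prop where
  degree : ∀ t ∈ timeInterval T, (uh t).DegLT (p + 1)
  smooth : ∀ n i k, ContDiffOn ℝ 1 (fun t => (uh t n i).coeff k) (timeInterval T)
  mem : ∀ t ∈ timeInterval T, ∀ n, ∀ x ∈ Icc (m.left n) (m.right n), (uh t).val n x ∈ U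
  scheme : ∀ t ∈ timeInterval T, ∀ φ : PwPoly N d, φ.DegLT (p + 1) →
    (∑ n, ∫ x in Ioo (m.left n) (m.right n), inner ℝ (timeDeriv T uh n x t) (φ.val n x))
      + dgFluxForm m f F (uh t) φ = 0

/-- `r ∈ 𝕍_{p+1}` is the reconstruction of `g ∈ 𝕍_p`: it has the same moments against `𝕍_{p-1}`,
and its traces at the nodes are given by `w`. -/
structure IsReconstruction {N d : ℕ} (m : Mesh N) (p : ℕ) (w : Vec d → Vec d → Vec d)
    (g r : PwPoly N d) : Prop where
  degree : r.DegLT (p + 2)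
  moments : ∀ φ : PwPoly N d, φ.DegLT p →
    (∑ n, ∫ x in Ioo (m.left n) (m.right n), inner ℝ (r.val n x) (φ.val n x))
      = ∑ n, ∫ x in Ioo (m.left n) (m.right n), inner ℝ (g.val n x) (φ.val n x)
  trace_plus : ∀ n, r.tracePlus m n = w (g.traceMinus m n) (g.tracePlus m n)
  trace_minus : ∀ n, r.traceMinus m n = w (g.traceMinus m n) (g.tracePlus m n)

/-- `r ∈ 𝕍_{p+1}` is the reconstruction of `f(g)` for `g ∈ 𝕍_p`. -/
structure IsFluxReconstruction {N d : ℕ} (m : Mesh N) (p : ℕ) (f : Vec d → Vec d)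
    (w : Vec d → Vec d → Vec d) (g r : PwPoly N d) : Prop where
  degree : r.DegLT (p + 2)
  moments : ∀ φ : PwPoly N d, φ.DegLT (p + 1) →
    (∑ n, ∫ x in Ioo (m.left n) (m.right n), inner ℝ (deriv (r.val n) x) (φ.val n x))
      = dgFluxForm m f (fun a b => f (w a b)) g φ
  trace_plus : ∀ n, r.tracePlus m n = f (w (g.traceMinus m n) (g.tracePlus m n))

/-- The function `r` is, at each time, the reconstruction of the scheme's solution `uh`; and
`R = ∂ₓf(r) - ∂ₓfh + ∂ₜr - ∂ₜuh` in the open cells, where `fh` is the reconstruction of `f(uh)`. -/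
structure IsReconstructionWithResidual {N d : ℕ} (m : Mesh N) (p : ℕ) (f : Vec d → Vec d)
    (w : Vec d → Vec d → Vec d) (T : EReal) (uh : ℝ → PwPoly N d) (r R : ℝ → ℝ → Vec d) :
    Prop where
  reconstruction : ∀ t ∈ timeInterval T, ∃ rp : PwPoly N d,
    IsReconstruction m p w (uh t) rp ∧
      ∀ n, ∀ x ∈ Icc (m.left n) (m.right n), r x t = rp.val n x
  residual : ∀ t : ℝ, 0 < t → (t : EReal) < T → ∃ fh : PwPoly N d,
    IsFluxReconstruction m p f w (uh t) fh ∧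
      ∀ n, ∀ x ∈ Ioo (m.left n) (m.right n),
        R x t = deriv (fun y => f (r y t)) x - deriv (fh.val n) x
          + deriv (fun τ => r x τ) t - timeDeriv T uh n x t

end

end ConsLaw

/-! The bound is a relative entropy estimate. Write `g` for the Lipschitz function `û`, `r = ∂ₜg +
Df(g)∂ₓg` for its residual, and `η(u|g)`, `f(u|g)` for the first-order Taylor remainders of `η` and
`f` at `g`. Test the entropy inequality with a time cutoff `χ`, subtract the weak equation tested
with `χ Dη(g)`, and add the exact derivatives `∂ₜ(χ(Dη(g)g - η(g)))` and `∂ₓ(χ(Dη(g)f(g) - q(g)))`.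
Compatibility of `η` and `q` makes `Df` symmetric with respect to `D²η`
(`IsEntropySystem.hessian_flux_symm`), and everything collapses to `χ' η(u|g) - χ (D²η(g)(r, u-g) +
D²η(g)(∂ₓg, f(u|g)))`, whose integral plus the initial relative entropy is nonnegative
(`relative_entropy_inequality`).

By Taylor's formula `η(u|g)` lies between `Clo/2 |u-g|²` and `Chi/2 |u-g|²`, and `|f(u|g)| ≤ Cf/2
|u-g|²`. With Young's inequality for the residual term and a cutoff falling linearly from 1 to 0 on
`(s-ε, s)`, the error averaged over that interval is bounded by the right-hand side of the claim,
uniformly in `ε` (`averaged_error_le`). Letting `ε → 0` and using weak lower semicontinuity of the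
`L²` norm along a weak-* continuous representative gives the bound at time `s` itself
(`IsTimeContinuousRep.integral_norm_sub_sq_le`).

Some ingredients are not given directly. The test functions above are only Lipschitz; mollification
makes them admissible (`tendsto_weakForm_mollify`). The initial data must lie in `D`: mass balance
on small boxes exhibits averages of `u₀` as limits of averages of `u`, which lie in `D` by convexity
(`initial_mem`). A weak-* continuous representative exists because the primitive of `u` in `x`
agrees almost everywhere with a Lipschitz function `W` of `(x,t)`, the flux being bounded; then
`∂ₓW(·,t)` is the representative (`exists_isTimeContinuousRep`).

For the discontinuous Galerkin scheme, `∂ₜu_h + ∂ₓf̂` is a piecewise polynomial of degree at most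
`p` orthogonal to all of these, hence zero. So `û` solves the perturbed equation with the stated
`R`, and the second claim is a case of the first. -/

namespace ConsLaw

/-! ### Mollification of Lipschitz functions of space and time. -/

noncomputable section LipschitzTestFunctions

set_option linter.unusedSectionVars false

open Filter Topology
open scoped Convolution

/-- The space-time strip `(0,1) × (0,∞)` with Lebesgue measure. -/
abbrev strip : Measure (ℝ × ℝ) := volume.restrict (Ioo (0 : ℝ) 1 ×ˢ Ioi (0 : ℝ))

section Partial

variable {F : Type*} [NormedAddCommGroup F] [NormedSpace ℝ F]

/-- The partial derivative in `x` of a function of `(x, t)`. -/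
def partialX (Φ : ℝ × ℝ → F) (z : ℝ × ℝ) : F := deriv (fun y => Φ (y, z.2)) z.1

/-- The partial derivative in `t` of a function of `(x, t)`. -/
def partialT (Φ : ℝ × ℝ → F) (z : ℝ × ℝ) : F := deriv (fun τ => Φ (z.1, τ)) z.2

/-- Partial derivatives are treated as line derivatives, for which measurability and Lipschitz
bounds hold at every point, differentiable or not. -/
lemma partialX_eq_lineDeriv (Φ : ℝ × ℝ → F) (z : ℝ × ℝ) :
    partialX Φ z = lineDeriv ℝ Φ z (1, 0) := by
  simp only [partialX, lineDeriv]
  have := deriv_comp_const_add (fun y => Φ (y, z.2)) z.1 0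
  simp only [add_zero] at this
  rw [← this]
  congr 1
  ext t
  congr 1
  ext <;> simp

lemma partialT_eq_lineDeriv (Φ : ℝ × ℝ → F) (z : ℝ × ℝ) :
    partialT Φ z = lineDeriv ℝ Φ z (0, 1) := by
  simp only [partialT, lineDeriv]
  have := deriv_comp_const_add (fun τ => Φ (z.1, τ)) z.2 0
  simp only [add_zero] at this
  rw [← this]
  congr 1
  ext t
  congr 1
  ext <;> simp

lemma norm_partialX_le {K : NNReal} {Φ : ℝ × ℝ → F} (h : LipschitzWith K Φ) (z : ℝ × ℝ) :
    ‖partialX Φ z‖ ≤ K := by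
  rw [partialX_eq_lineDeriv]
  simpa using norm_lineDeriv_le_of_lipschitz ℝ h (x₀ := z) (v := ((1, 0) : ℝ × ℝ))

lemma norm_partialT_le {K : NNReal} {Φ : ℝ × ℝ → F} (h : LipschitzWith K Φ) (z : ℝ × ℝ) :
    ‖partialT Φ z‖ ≤ K := by
  rw [partialT_eq_lineDeriv]
  simpa using norm_lineDeriv_le_of_lipschitz ℝ h (x₀ := z) (v := ((0, 1) : ℝ × ℝ))

lemma stronglyMeasurable_partialX [FiniteDimensional ℝ F] {Φ : ℝ × ℝ → F} (h : Continuous Φ) :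
    StronglyMeasurable (partialX Φ) := by
  have : partialX Φ = fun z => lineDeriv ℝ Φ z (1, 0) := funext (partialX_eq_lineDeriv Φ)
  rw [this]
  have := FiniteDimensional.complete ℝ F
  exact stronglyMeasurable_lineDeriv h

lemma stronglyMeasurable_partialT [FiniteDimensional ℝ F] {Φ : ℝ × ℝ → F} (h : Continuous Φ) :
    StronglyMeasurable (partialT Φ) := by
  have : partialT Φ = fun z => lineDeriv ℝ Φ z (0, 1) := funext (partialT_eq_lineDeriv Φ)
  rw [this]
  have := FiniteDimensional.complete ℝ F
  exact stronglyMeasurable_lineDeriv h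

lemma hasDerivAt_partialX {Φ : ℝ × ℝ → F} {z : ℝ × ℝ} (h : DifferentiableAt ℝ Φ z) :
    HasDerivAt (fun y => Φ (y, z.2)) (partialX Φ z) z.1 := by
  have h1 : HasDerivAt (fun y : ℝ => (y, z.2)) ((1 : ℝ), (0 : ℝ)) z.1 :=
    (hasDerivAt_id z.1).prodMk (hasDerivAt_const _ _)
  exact (HasFDerivAt.comp_hasDerivAt (x := z.1) (f := fun y : ℝ => (y, z.2))
    (l := Φ) h.hasFDerivAt h1).differentiableAt.hasDerivAt

lemma hasDerivAt_partialT {Φ : ℝ × ℝ → F} {z : ℝ × ℝ} (h : DifferentiableAt ℝ Φ z) :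
    HasDerivAt (fun τ => Φ (z.1, τ)) (partialT Φ z) z.2 := by
  have h1 : HasDerivAt (fun τ : ℝ => (z.1, τ)) ((0 : ℝ), (1 : ℝ)) z.2 :=
    (hasDerivAt_const _ _).prodMk (hasDerivAt_id z.2)
  exact (HasFDerivAt.comp_hasDerivAt (x := z.2) (f := fun τ : ℝ => (z.1, τ))
    (l := Φ) h.hasFDerivAt h1).differentiableAt.hasDerivAt

end Partial

section Mollify

variable {F : Type*} [NormedAddCommGroup F] [NormedSpace ℝ F]

/-- Convolution with a normalized bump function of `(x, t)`. -/
def mollify (ρ : ContDiffBump (0 : ℝ × ℝ)) (Φ : ℝ × ℝ → F) (z : ℝ × ℝ) : F :=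
  ∫ w, ρ.normed volume w • Φ (z - w)

lemma mollify_eq_convolution (ρ : ContDiffBump (0 : ℝ × ℝ)) (Φ : ℝ × ℝ → F) :
    mollify ρ Φ = (ρ.normed volume ⋆[ContinuousLinearMap.lsmul ℝ ℝ, volume] Φ) := by
  ext z
  simp [mollify, convolution]

variable [FiniteDimensional ℝ F]

lemma integrable_bump_smul_continuous (ρ : ContDiffBump (0 : ℝ × ℝ)) {G : ℝ × ℝ → F}
    (hG : Continuous G) : Integrable (fun w => ρ.normed volume w • G w) :=
  (ρ.continuous_normed.smul hG).integrable_of_hasCompactSupport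
    ρ.hasCompactSupport_normed.smul_right

lemma contDiff_mollify (ρ : ContDiffBump (0 : ℝ × ℝ)) {Φ : ℝ × ℝ → F} (hΦ : Continuous Φ) :
    ContDiff ℝ ((⊤ : ℕ∞) : WithTop ℕ∞) (mollify ρ Φ) := by
  rw [mollify_eq_convolution]
  exact ρ.hasCompactSupport_normed.contDiff_convolution_left _ ρ.contDiff_normed
    hΦ.locallyIntegrable

/-- The radius is at most 1, so mollification extends the support in time by at most 1. The common
bound over the whole sequence is what dominated convergence needs. -/
lemma mollify_eq_zero (ρ : ContDiffBump (0 : ℝ × ℝ)) {Φ : ℝ × ℝ → F} {T : ℝ}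
    (hρ : ρ.rOut ≤ 1) (hT : ∀ z : ℝ × ℝ, T ≤ z.2 → Φ z = 0) (z : ℝ × ℝ) (hz : T + 1 ≤ z.2) :
    mollify ρ Φ z = 0 := by
  rw [mollify]
  refine integral_eq_zero_of_ae (ae_of_all _ fun w => ?_)
  by_cases hw : w ∈ Metric.ball (0 : ℝ × ℝ) ρ.rOut
  · have : |w.2| ≤ 1 := by
      have h1 : ‖w‖ < ρ.rOut := by simpa using hw
      exact (norm_snd_le w).trans (h1.le.trans hρ)
    have h2 := (abs_le.1 this).2
    simp [hT (z - w) (by simp only [Prod.snd_sub]; linarith)]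
  · have : ρ.normed volume w = 0 := by
      rw [← Function.notMem_support, ρ.support_normed_eq]
      exact hw
    simp [this]

lemma mollify_periodic (ρ : ContDiffBump (0 : ℝ × ℝ)) {Φ : ℝ × ℝ → F}
    (hper : ∀ x t, Φ (x + 1, t) = Φ (x, t)) (x t : ℝ) :
    mollify ρ Φ (x + 1, t) = mollify ρ Φ (x, t) := by
  simp only [mollify]
  congr 1
  ext w
  have h1 : (x + 1, t) - w = (x - w.1 + 1, t - w.2) := by
    ext <;> simp [sub_add_eq_add_sub]
  have h2 : (x, t) - w = (x - w.1, t - w.2) := rfl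
  rw [h1, h2, hper]

lemma lipschitzWith_mollify (ρ : ContDiffBump (0 : ℝ × ℝ)) {Φ : ℝ × ℝ → F} {K : NNReal}
    (hΦ : LipschitzWith K Φ) : LipschitzWith K (mollify ρ Φ) := by
  refine LipschitzWith.of_dist_le_mul fun z z' => ?_
  have hint : ∀ z : ℝ × ℝ, Integrable (fun w => ρ.normed volume w • Φ (z - w)) := fun z =>
    integrable_bump_smul_continuous ρ (hΦ.continuous.comp (continuous_const.sub continuous_id))
  rw [dist_eq_norm, mollify, mollify, ← integral_sub (hint z) (hint z')]
  calc _ ≤ ∫ w, ρ.normed volume w * (K * dist z z') := by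
        refine norm_integral_le_of_norm_le (ρ.integrable_normed.mul_const _)
          (ae_of_all _ fun w => ?_)
        rw [← smul_sub, norm_smul, Real.norm_of_nonneg (ρ.nonneg_normed w), ← dist_eq_norm]
        refine mul_le_mul_of_nonneg_left ?_ (ρ.nonneg_normed w)
        simpa using hΦ.dist_le_mul (z - w) (z' - w)
    _ = K * dist z z' := by rw [integral_mul_const, ρ.integral_normed, one_mul]

/-- Differentiation under the integral: the difference quotients are dominated by `K ‖e‖` times the
kernel, and by Rademacher's theorem they converge at almost every shifted point. -/
lemma lineDeriv_mollify (ρ : ContDiffBump (0 : ℝ × ℝ)) {Φ : ℝ × ℝ → F} {K : NNReal}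
    (hΦ : LipschitzWith K Φ) (e z : ℝ × ℝ) :
    lineDeriv ℝ (mollify ρ Φ) z e = mollify ρ (fun w => lineDeriv ℝ Φ w e) z := by
  have hae : ∀ᵐ w : ℝ × ℝ, LineDifferentiableAt ℝ Φ (z - w) e := by
    have h0 : ∀ᵐ p : ℝ × ℝ, LineDifferentiableAt ℝ Φ p e := by
      filter_upwards [hΦ.ae_differentiableAt] with p hp
      exact (hp.hasFDerivAt.hasLineDerivAt e).lineDifferentiableAt
    exact (Measure.measurePreserving_sub_left (volume : Measure (ℝ × ℝ)) z).quasiMeasurePreserving.ae h0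
  have hcont : ∀ h : ℝ, Continuous (fun w : ℝ × ℝ => Φ (z + h • e - w)) := fun h =>
    hΦ.continuous.comp (continuous_const.sub continuous_id)
  have key := hasDerivAt_integral_of_dominated_loc_of_lip (𝕜 := ℝ)
    (μ := (volume : Measure (ℝ × ℝ)))
    (F := fun (h : ℝ) w => ρ.normed volume w • Φ (z + h • e - w)) (x₀ := 0)
    (F' := fun w => ρ.normed volume w • lineDeriv ℝ Φ (z - w) e)
    (bound := fun w => ρ.normed volume w * (K * ‖e‖)) (s := univ) univ_mem
    (Eventually.of_forall fun h =>
      (integrable_bump_smul_continuous ρ (hcont h)).aestronglyMeasurable)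
    (integrable_bump_smul_continuous ρ (hcont 0)) ?_ ?_ ?_ ?_
  · exact key.2.deriv
  · refine ρ.continuous_normed.aestronglyMeasurable.smul ?_
    have := FiniteDimensional.complete ℝ F
    exact ((stronglyMeasurable_lineDeriv hΦ.continuous).comp_measurable
      (measurable_const.sub measurable_id)).aestronglyMeasurable
  · refine ae_of_all _ fun w => LipschitzOnWith.of_dist_le_mul fun h _ h' _ => ?_
    rw [dist_eq_norm, ← smul_sub, norm_smul, Real.norm_of_nonneg (ρ.nonneg_normed w),
      ← dist_eq_norm, Real.coe_nnabs,
      abs_of_nonneg (mul_nonneg (ρ.nonneg_normed w) (by positivity)), mul_assoc]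
    refine mul_le_mul_of_nonneg_left ?_ (ρ.nonneg_normed w)
    refine (hΦ.dist_le_mul _ _).trans (le_of_eq ?_)
    rw [dist_sub_right, dist_add_left, dist_eq_norm, ← sub_smul, norm_smul, dist_eq_norm]
    ring
  · exact ρ.integrable_normed.mul_const _
  · filter_upwards [hae] with w hw
    have h1 := hw.hasLineDerivAt
    rw [HasLineDerivAt] at h1
    have h2 := h1.const_smul (ρ.normed volume w)
    refine h2.congr_of_eventuallyEq (Eventually.of_forall fun h => ?_)
    simp only [Pi.smul_apply]
    congr 2
    abel

/-- Bump functions with supports shrinking to a point. -/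
def bumpSeq (n : ℕ) : ContDiffBump (0 : ℝ × ℝ) where
  rIn := 1 / (2 * ((n : ℝ) + 1))
  rOut := 1 / ((n : ℝ) + 1)
  rIn_pos := by positivity
  rIn_lt_rOut := by
    apply one_div_lt_one_div_of_lt <;> nlinarith [(Nat.cast_nonneg n : (0 : ℝ) ≤ n)]

lemma bumpSeq_rOut_le (n : ℕ) : (bumpSeq n).rOut ≤ 1 := by
  change 1 / ((n : ℝ) + 1) ≤ 1
  rw [div_le_one (by positivity)]
  linarith [(Nat.cast_nonneg n : (0 : ℝ) ≤ n)]

lemma tendsto_bumpSeq_rOut : Tendsto (fun n => (bumpSeq n).rOut) atTop (𝓝 0) :=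
  tendsto_one_div_add_atTop_nhds_zero_nat

lemma tendsto_mollify {Φ : ℝ × ℝ → F} (hΦ : Continuous Φ) (z : ℝ × ℝ) :
    Tendsto (fun n => mollify (bumpSeq n) Φ z) atTop (𝓝 (Φ z)) := by
  have := FiniteDimensional.complete ℝ F
  simp_rw [mollify_eq_convolution]
  exact ContDiffBump.convolution_tendsto_right_of_continuous tendsto_bumpSeq_rOut hΦ z

/-- Convergence at Lebesgue points. Derivatives of Lipschitz functions are merely bounded and
measurable, so convergence at every point is not available. -/
lemma ae_tendsto_mollify {G : ℝ × ℝ → F} (hG : LocallyIntegrable G) :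
    ∀ᵐ z, Tendsto (fun n => mollify (bumpSeq n) G z) atTop (𝓝 (G z)) := by
  have := FiniteDimensional.complete ℝ F
  simp_rw [mollify_eq_convolution]
  -- The constant 2 is the fixed ratio of outer to inner radius in `bumpSeq`; a bounded ratio is
  -- needed at Lebesgue points.
  refine ContDiffBump.ae_convolution_tendsto_right_of_locallyIntegrable (K := 2)
    tendsto_bumpSeq_rOut (Eventually.of_forall fun n => le_of_eq ?_) hG
  change 1 / ((n : ℝ) + 1) = 2 * (1 / (2 * ((n : ℝ) + 1)))
  field_simp

lemma ae_tendsto_lineDeriv_mollify {Φ : ℝ × ℝ → F} {K : NNReal} (hΦ : LipschitzWith K Φ)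
    (e : ℝ × ℝ) : ∀ᵐ z, Tendsto (fun n => lineDeriv ℝ (mollify (bumpSeq n) Φ) z e) atTop
      (𝓝 (lineDeriv ℝ Φ z e)) := by
  have := FiniteDimensional.complete ℝ F
  simp_rw [lineDeriv_mollify _ hΦ]
  refine ae_tendsto_mollify ?_
  refine MemLp.locallyIntegrable (p := ⊤) (memLp_top_of_bound
    (stronglyMeasurable_lineDeriv hΦ.continuous).aestronglyMeasurable (K * ‖e‖)
    (ae_of_all _ fun z => norm_lineDeriv_le_of_lipschitz ℝ hΦ)) le_top

lemma isTestFunction_mollify (ρ : ContDiffBump (0 : ℝ × ℝ)) {Φ : ℝ × ℝ → F} {T : ℝ}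
    (hρ : ρ.rOut ≤ 1) (hΦ : Continuous Φ) (hper : ∀ x t, Φ (x + 1, t) = Φ (x, t))
    (hT : ∀ z : ℝ × ℝ, T ≤ z.2 → Φ z = 0) :
    IsTestFunction (fun x t => mollify ρ Φ (x, t)) where
  smooth := contDiff_mollify ρ hΦ
  periodic x t := mollify_periodic ρ hper x t
  support_bounded := ⟨T + 1, fun x t ht => mollify_eq_zero ρ hρ hT (x, t) ht⟩

end Mollify
end LipschitzTestFunctions
end ConsLaw

/-! ### Passing to the limit in weak formulations. -/

namespace ConsLaw

noncomputable section WeakForm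

set_option linter.unusedSectionVars false

open Filter Topology

lemma strip_eq_prod : strip = (volume.restrict (Ioo (0 : ℝ) 1)).prod
    (volume.restrict (Ioi (0 : ℝ))) := by
  rw [strip, Measure.prod_restrict, Measure.volume_eq_prod]

lemma integrable_cutoff (C T : ℝ) :
    Integrable (indicator {z : ℝ × ℝ | z.2 < T} (fun _ => C)) strip := by
  have hm : MeasurableSet {z : ℝ × ℝ | z.2 < T} := measurableSet_lt measurable_snd measurable_const
  rw [integrable_indicator_iff hm]
  refine integrableOn_const ?_
  rw [Measure.restrict_apply hm]
  have hsub : {z : ℝ × ℝ | z.2 < T} ∩ Ioo (0 : ℝ) 1 ×ˢ Ioi (0 : ℝ) ⊆ Icc 0 1 ×ˢ Icc 0 T := by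
    rintro z ⟨h1, h2, h3⟩
    exact ⟨⟨h2.1.le, h2.2.le⟩, ⟨le_of_lt h3, le_of_lt h1⟩⟩
  exact ((measure_mono hsub).trans_lt (isCompact_Icc.prod isCompact_Icc).measure_lt_top).ne

lemma integrable_strip {E : Type*} [NormedAddCommGroup E] {G : ℝ × ℝ → E} {C T : ℝ}
    (hm : AEStronglyMeasurable G strip) (hC : ∀ᵐ z ∂strip, ‖G z‖ ≤ C)
    (hT : ∀ᵐ z ∂strip, T ≤ z.2 → G z = 0) : Integrable G strip := by
  refine (integrable_cutoff C T).mono' hm ?_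
  filter_upwards [hC, hT] with z h1 h2
  by_cases h : z.2 < T
  · rw [indicator_of_mem (show z ∈ {z : ℝ × ℝ | z.2 < T} from h)]
    exact h1
  · rw [h2 (not_lt.1 h), norm_zero, indicator_of_notMem (show z ∉ {z : ℝ × ℝ | z.2 < T} from h)]

section

variable {F : Type*} [NormedAddCommGroup F] [NormedSpace ℝ F]

/-- The inequality is strict because at time `T` itself the slope from below need not vanish. This
costs the `T + 1` in the integrability statements. -/
lemma partialT_eq_zero {Φ : ℝ × ℝ → F} {T : ℝ} (hT : ∀ z : ℝ × ℝ, T ≤ z.2 → Φ z = 0)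
    {z : ℝ × ℝ} (hz : T < z.2) : partialT Φ z = 0 := by
  have : (fun τ => Φ (z.1, τ)) =ᶠ[𝓝 z.2] fun _ => 0 := by
    filter_upwards [lt_mem_nhds hz] with τ hτ
    exact hT (z.1, τ) hτ.le
  rw [partialT, this.deriv_eq, deriv_const]

lemma partialX_eq_zero {Φ : ℝ × ℝ → F} {T : ℝ} (hT : ∀ z : ℝ × ℝ, T ≤ z.2 → Φ z = 0)
    {z : ℝ × ℝ} (hz : T ≤ z.2) : partialX Φ z = 0 := by
  have : (fun y => Φ (y, z.2)) = fun _ => 0 := by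
    ext y
    exact hT (y, z.2) hz
  rw [partialX, this, deriv_const]

end

variable {F : Type*} [NormedAddCommGroup F] [InnerProductSpace ℝ F] [FiniteDimensional ℝ F]

/-- The integrand `a · ∂ₜΦ + b · ∂ₓΦ`. -/
def weakIntegrand (a b : ℝ × ℝ → F) (Φ : ℝ × ℝ → F) (z : ℝ × ℝ) : ℝ :=
  inner ℝ (a z) (partialT Φ z) + inner ℝ (b z) (partialX Φ z)

/-- The weak form of `∂ₜa + ∂ₓb = 0` with initial data `c`, evaluated at the test function `Φ`. -/
def weakForm (a b : ℝ × ℝ → F) (c : ℝ → F) (Φ : ℝ × ℝ → F) : ℝ :=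
  (∫ z, weakIntegrand a b Φ z ∂strip) + ∫ x in Ioo (0 : ℝ) 1, inner ℝ (c x) (Φ (x, 0))

lemma aestronglyMeasurable_weakIntegrand {a b : ℝ × ℝ → F} (ha : AEStronglyMeasurable a strip)
    (hb : AEStronglyMeasurable b strip) {Φ : ℝ × ℝ → F} (hΦ : Continuous Φ) :
    AEStronglyMeasurable (weakIntegrand a b Φ) strip :=
  (ha.inner (stronglyMeasurable_partialT hΦ).aestronglyMeasurable).add
    (hb.inner (stronglyMeasurable_partialX hΦ).aestronglyMeasurable)

lemma norm_weakIntegrand_le {a b : ℝ × ℝ → F} {M : ℝ} {K : NNReal} {Φ : ℝ × ℝ → F}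
    (hΦ : LipschitzWith K Φ) {z : ℝ × ℝ} (ha : ‖a z‖ ≤ M) (hb : ‖b z‖ ≤ M) :
    ‖weakIntegrand a b Φ z‖ ≤ M * K + M * K := by
  refine (norm_add_le _ _).trans (add_le_add ?_ ?_)
  · exact (norm_inner_le_norm _ _).trans (mul_le_mul ha (norm_partialT_le hΦ z) (norm_nonneg _)
      ((norm_nonneg _).trans ha))
  · exact (norm_inner_le_norm _ _).trans (mul_le_mul hb (norm_partialX_le hΦ z) (norm_nonneg _)
      ((norm_nonneg _).trans hb))

lemma weakIntegrand_eq_zero {a b : ℝ × ℝ → F} {Φ : ℝ × ℝ → F} {T : ℝ}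
    (hT : ∀ z : ℝ × ℝ, T ≤ z.2 → Φ z = 0) {z : ℝ × ℝ} (hz : T + 1 ≤ z.2) :
    weakIntegrand a b Φ z = 0 := by
  rw [weakIntegrand, partialT_eq_zero hT (by linarith), partialX_eq_zero hT (by linarith),
    inner_zero_right, inner_zero_right, add_zero]

lemma integrable_weakIntegrand {a b : ℝ × ℝ → F} (ha : AEStronglyMeasurable a strip)
    (hb : AEStronglyMeasurable b strip) {M : ℝ} (haM : ∀ᵐ z ∂strip, ‖a z‖ ≤ M)
    (hbM : ∀ᵐ z ∂strip, ‖b z‖ ≤ M) {Φ : ℝ × ℝ → F} {K : NNReal} (hΦ : LipschitzWith K Φ) {T : ℝ}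
    (hT : ∀ z : ℝ × ℝ, T ≤ z.2 → Φ z = 0) : Integrable (weakIntegrand a b Φ) strip := by
  refine integrable_strip (C := M * K + M * K) (T := T + 1)
    (aestronglyMeasurable_weakIntegrand ha hb hΦ.continuous) ?_ ?_
  · filter_upwards [haM, hbM] with z h1 h2
    exact norm_weakIntegrand_le hΦ h1 h2
  · exact ae_of_all _ fun z hz => weakIntegrand_eq_zero hT hz

lemma integrable_inner_initial {c : ℝ → F} (hc : AEStronglyMeasurable c (volume.restrict (Ioo 0 1)))
    {M : ℝ} (hcM : ∀ᵐ x ∂(volume.restrict (Ioo (0 : ℝ) 1)), ‖c x‖ ≤ M) {φ : ℝ → F}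
    (hφ : Continuous φ) : IntegrableOn (fun x => inner ℝ (c x) (φ x)) (Ioo 0 1) := by
  obtain ⟨B, hB⟩ := isCompact_Icc.exists_bound_of_continuousOn
    (hφ.continuousOn (s := Icc (0 : ℝ) 1))
  refine Integrable.of_bound (hc.inner hφ.aestronglyMeasurable) (M * B) ?_
  filter_upwards [hcM, ae_restrict_mem measurableSet_Ioo] with x h1 h2
  exact (norm_inner_le_norm _ _).trans (mul_le_mul h1 (hB x ⟨h2.1.le, h2.2.le⟩) (norm_nonneg _)
      ((norm_nonneg _).trans h1))

/-- Mollification keeps the Lipschitz constant and enlarges the time support by at most 1, while the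
derivatives converge almost everywhere. Dominated convergence then carries identities and
inequalities from smooth to Lipschitz test functions. -/
lemma tendsto_weakForm_mollify {a b : ℝ × ℝ → F} {c : ℝ → F} (ha : AEStronglyMeasurable a strip)
    (hb : AEStronglyMeasurable b strip) (hc : AEStronglyMeasurable c (volume.restrict (Ioo 0 1)))
    {M : ℝ} (haM : ∀ᵐ z ∂strip, ‖a z‖ ≤ M) (hbM : ∀ᵐ z ∂strip, ‖b z‖ ≤ M)
    (hcM : ∀ᵐ x ∂(volume.restrict (Ioo (0 : ℝ) 1)), ‖c x‖ ≤ M) {Φ : ℝ × ℝ → F} {K : NNReal}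
    (hΦ : LipschitzWith K Φ) {T : ℝ} (hT : ∀ z : ℝ × ℝ, T ≤ z.2 → Φ z = 0) :
    Tendsto (fun n => weakForm a b c (mollify (bumpSeq n) Φ)) atTop (𝓝 (weakForm a b c Φ)) := by
  have hL : ∀ n, LipschitzWith K (mollify (bumpSeq n) Φ) := fun n => lipschitzWith_mollify _ hΦ
  refine Tendsto.add ?_ ?_
  · refine tendsto_integral_of_dominated_convergence
      (indicator {z : ℝ × ℝ | z.2 < T + 1 + 1} (fun _ => M * K + M * K))
      (fun n => aestronglyMeasurable_weakIntegrand ha hb (hL n).continuous)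
      (integrable_cutoff _ _) (fun n => ?_) ?_
    · filter_upwards [haM, hbM] with z h1 h2
      by_cases h : z.2 < T + 1 + 1
      · rw [indicator_of_mem (show z ∈ {z : ℝ × ℝ | z.2 < T + 1 + 1} from h)]
        exact norm_weakIntegrand_le (hL n) h1 h2
      · rw [weakIntegrand_eq_zero (mollify_eq_zero _ (bumpSeq_rOut_le n) hT) (not_lt.1 h),
          norm_zero, indicator_of_notMem (show z ∉ {z : ℝ × ℝ | z.2 < T + 1 + 1} from h)]
    · filter_upwards [ae_restrict_of_ae (ae_tendsto_lineDeriv_mollify hΦ (0, 1)),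
        ae_restrict_of_ae (ae_tendsto_lineDeriv_mollify hΦ (1, 0))] with z h1 h2
      simp only [weakIntegrand, partialT_eq_lineDeriv, partialX_eq_lineDeriv]
      exact (tendsto_const_nhds.inner h1).add (tendsto_const_nhds.inner h2)
  · obtain ⟨B, hB⟩ := isCompact_Icc.exists_bound_of_continuousOn
      ((hΦ.continuous.comp (continuous_id.prodMk continuous_const)).continuousOn
        (s := Icc (0 : ℝ) 1) (f := fun x => Φ (x, 0)))
    -- Averaging over a ball of radius at most 1 changes a `K`-Lipschitz function by at most `K`,
    -- which dominates the initial traces.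
    have hclose : ∀ n z, ‖mollify (bumpSeq n) Φ z‖ ≤ ‖Φ z‖ + K := by
      intro n z
      have : dist (mollify (bumpSeq n) Φ z) (Φ z) ≤ K := by
        rw [mollify_eq_convolution]
        have := FiniteDimensional.complete ℝ F
        refine (bumpSeq n).dist_normed_convolution_le hΦ.continuous.aestronglyMeasurable
          fun y hy => ?_
        refine (hΦ.dist_le_mul _ _).trans ?_
        have h1 : dist y z < (bumpSeq n).rOut := hy
        have := h1.le.trans (bumpSeq_rOut_le n)
        exact mul_le_of_le_one_right K.2 this
      rw [dist_eq_norm] at this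
      have h2 := norm_sub_norm_le (mollify (bumpSeq n) Φ z) (Φ z)
      linarith
    refine tendsto_integral_of_dominated_convergence (fun _ => M * (B + K))
      (fun n => hc.inner ((hL n).continuous.comp
        (continuous_id.prodMk continuous_const)).aestronglyMeasurable)
      (integrable_const _) (fun n => ?_) ?_
    · filter_upwards [hcM, ae_restrict_mem measurableSet_Ioo] with x h1 h2
      have h3 := hB x ⟨h2.1.le, h2.2.le⟩
      exact (norm_inner_le_norm _ _).trans (mul_le_mul h1
        ((hclose n _).trans (by simpa using h3)) (norm_nonneg _) ((norm_nonneg _).trans h1))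
    · exact ae_of_all _ fun x => tendsto_const_nhds.inner (tendsto_mollify hΦ.continuous _)

/-- Fubini: entropy solutions are defined with iterated integrals, whereas almost-everywhere
arguments use the product measure. -/
lemma weakForm_eq_iterated {a b : ℝ × ℝ → F} {c : ℝ → F} {Φ : ℝ × ℝ → F}
    (h : Integrable (weakIntegrand a b Φ) strip) :
    weakForm a b c Φ = (∫ t in Ioi (0 : ℝ), ∫ x in Ioo (0 : ℝ) 1,
        (inner ℝ (a (x, t)) (deriv (fun τ => Φ (x, τ)) t)
          + inner ℝ (b (x, t)) (deriv (fun y => Φ (y, t)) x)))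
      + ∫ x in Ioo (0 : ℝ) 1, inner ℝ (c x) (Φ (x, 0)) := by
  rw [weakForm]
  congr 1
  rw [strip_eq_prod] at h ⊢
  rw [integral_prod_symm _ h]
  rfl

end WeakForm

/-! ### Lipschitz test functions for entropy solutions with values in a compact set. -/

noncomputable section Bounded

open Filter Topology

variable {d : ℕ} {U D : Set (Vec d)} {f : Vec d → Vec d} {η q : Vec d → ℝ} {u₀ : ℝ → Vec d}
  {u : ℝ → ℝ → Vec d}

/-- A function that is continuous on a compact set, composed with one taking values there. -/
lemma aestronglyMeasurable_comp_of_continuousOn {α G : Type*} [MeasurableSpace α] {μ : Measure α}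
    [NormedAddCommGroup G] {D : Set (Vec d)} (hD : IsClosed D) {h : Vec d → G}
    (hh : ContinuousOn h D) {v : α → Vec d} (hv : AEStronglyMeasurable v μ)
    (hvD : ∀ᵐ z ∂μ, v z ∈ D) : AEStronglyMeasurable (fun z => h (v z)) μ := by
  have hae : ∀ᵐ y ∂(Measure.map v μ), y ∈ D :=
    (ae_map_iff hv.aemeasurable hD.measurableSet).2 hvD
  have h1 : AEStronglyMeasurable h (Measure.map v μ) := by
    have := hh.aestronglyMeasurable (μ := Measure.map v μ) hD.measurableSet
    rwa [Measure.restrict_eq_self_of_ae_mem hae] at this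
  exact h1.comp_aemeasurable hv.aemeasurable

lemma ae_norm_comp_le {α G : Type*} [MeasurableSpace α] {μ : Measure α}
    [NormedAddCommGroup G] {D : Set (Vec d)} (hD : IsCompact D) {h : Vec d → G}
    (hh : ContinuousOn h D) {v : α → Vec d} (hvD : ∀ᵐ z ∂μ, v z ∈ D) :
    ∃ M, ∀ᵐ z ∂μ, ‖h (v z)‖ ≤ M := by
  obtain ⟨M, hM⟩ := hD.exists_bound_of_continuousOn hh
  exact ⟨M, hvD.mono fun z hz => hM _ hz⟩

/-- The weak formulation of the conservation law holds for Lipschitz test functions. -/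
lemma IsEntropySolution.weakForm_eq_zero (hu : IsEntropySolution U f η q u₀ u) (hD : IsCompact D)
    (huD : ∀ᵐ z ∂strip, u z.1 z.2 ∈ D) (hf : ContinuousOn f D) {Φ : ℝ × ℝ → Vec d} {K : NNReal}
    (hΦ : LipschitzWith K Φ) (hper : ∀ x t, Φ (x + 1, t) = Φ (x, t)) {T : ℝ}
    (hT : ∀ z : ℝ × ℝ, T ≤ z.2 → Φ z = 0) :
    weakForm (fun z => u z.1 z.2) (fun z => f (u z.1 z.2)) u₀ Φ = 0 := by
  obtain ⟨M₁, hM₁⟩ := hu.bounded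
  obtain ⟨M₂, hM₂⟩ := ae_norm_comp_le hD hf huD
  obtain ⟨M₃, hM₃⟩ := hu.init_bounded
  have ha : AEStronglyMeasurable (fun z : ℝ × ℝ => u z.1 z.2) strip := hu.measurable
  have hb := aestronglyMeasurable_comp_of_continuousOn hD.isClosed hf ha huD
  have haM : ∀ᵐ z ∂strip, ‖u z.1 z.2‖ ≤ max M₁ (max M₂ M₃) :=
    hM₁.mono fun z h => h.trans (le_max_left _ _)
  have hbM : ∀ᵐ z ∂strip, ‖f (u z.1 z.2)‖ ≤ max M₁ (max M₂ M₃) :=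
    hM₂.mono fun z h => h.trans ((le_max_left _ _).trans (le_max_right _ _))
  have hcM : ∀ᵐ x ∂(volume.restrict (Ioo (0 : ℝ) 1)), ‖u₀ x‖ ≤ max M₁ (max M₂ M₃) :=
    hM₃.mono fun z h => h.trans ((le_max_right _ _).trans (le_max_right _ _))
  refine tendsto_nhds_unique (tendsto_weakForm_mollify ha hb hu.init_measurable haM hbM hcM hΦ hT)
    (tendsto_const_nhds.congr fun n => ?_)
  rw [weakForm_eq_iterated (integrable_weakIntegrand ha hb haM hbM (lipschitzWith_mollify _ hΦ)
    (mollify_eq_zero _ (bumpSeq_rOut_le n) hT))]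
  exact (hu.weak _ (isTestFunction_mollify _ (bumpSeq_rOut_le n) hΦ.continuous hper hT)).symm

/-- The entropy inequality holds for nonnegative Lipschitz test functions. -/
lemma IsEntropySolution.weakForm_entropy_nonneg (hu : IsEntropySolution U f η q u₀ u)
    (hD : IsCompact D) (huD : ∀ᵐ z ∂strip, u z.1 z.2 ∈ D)
    (hu₀D : ∀ᵐ x ∂(volume.restrict (Ioo (0 : ℝ) 1)), u₀ x ∈ D)
    (hη : ContinuousOn η D) (hq : ContinuousOn q D) {Φ : ℝ × ℝ → ℝ} {K : NNReal}
    (hΦ : LipschitzWith K Φ) (hper : ∀ x t, Φ (x + 1, t) = Φ (x, t)) (hpos : ∀ z, 0 ≤ Φ z) {T : ℝ}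
    (hT : ∀ z : ℝ × ℝ, T ≤ z.2 → Φ z = 0) :
    0 ≤ weakForm (fun z => η (u z.1 z.2)) (fun z => q (u z.1 z.2)) (fun x => η (u₀ x)) Φ := by
  obtain ⟨M₁, hM₁⟩ := ae_norm_comp_le hD hη huD
  obtain ⟨M₂, hM₂⟩ := ae_norm_comp_le hD hq huD
  obtain ⟨M₃, hM₃⟩ := ae_norm_comp_le hD hη hu₀D
  have hm : AEStronglyMeasurable (fun z : ℝ × ℝ => u z.1 z.2) strip := hu.measurable
  have ha := aestronglyMeasurable_comp_of_continuousOn hD.isClosed hη hm huD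
  have hb := aestronglyMeasurable_comp_of_continuousOn hD.isClosed hq hm huD
  have hc := aestronglyMeasurable_comp_of_continuousOn hD.isClosed hη hu.init_measurable hu₀D
  have haM : ∀ᵐ z ∂strip, ‖η (u z.1 z.2)‖ ≤ max M₁ (max M₂ M₃) :=
    hM₁.mono fun z h => h.trans (le_max_left _ _)
  have hbM : ∀ᵐ z ∂strip, ‖q (u z.1 z.2)‖ ≤ max M₁ (max M₂ M₃) :=
    hM₂.mono fun z h => h.trans ((le_max_left _ _).trans (le_max_right _ _))
  have hcM : ∀ᵐ x ∂(volume.restrict (Ioo (0 : ℝ) 1)), ‖η (u₀ x)‖ ≤ max M₁ (max M₂ M₃) :=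
    hM₃.mono fun z h => h.trans ((le_max_right _ _).trans (le_max_right _ _))
  refine ge_of_tendsto' (tendsto_weakForm_mollify ha hb hc haM hbM hcM hΦ hT) fun n => ?_
  rw [weakForm_eq_iterated (integrable_weakIntegrand ha hb haM hbM (lipschitzWith_mollify _ hΦ)
    (mollify_eq_zero _ (bumpSeq_rOut_le n) hT))]
  have := hu.entropy _ (isTestFunction_mollify _ (bumpSeq_rOut_le n) hΦ.continuous hper hT)
    fun x t _ => integral_nonneg fun w => mul_nonneg ((bumpSeq n).nonneg_normed w) (hpos _)
  simpa only [RCLike.inner_apply, conj_trivial, mul_comm] using this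

end Bounded
end ConsLaw

/-! ### Integrals of exact derivatives of Lipschitz functions. -/

namespace ConsLaw

noncomputable section FundamentalTheorem

open Filter Topology

lemma integral_deriv_of_lipschitz {K : NNReal} {h : ℝ → ℝ} (hh : LipschitzWith K h) (a b : ℝ) :
    ∫ x in a..b, deriv h x = h b - h a :=
  (hh.lipschitzOnWith (s := uIcc a b)).absolutelyContinuousOnInterval.integral_deriv_eq_sub

lemma lipschitzWith_slice_left {F : Type*} [PseudoMetricSpace F] {K : NNReal} {H : ℝ × ℝ → F}
    (hH : LipschitzWith K H) (x : ℝ) : LipschitzWith K (fun t => H (x, t)) :=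
  LipschitzWith.of_dist_le_mul fun t t' => by
    simpa [Prod.dist_eq] using hH.dist_le_mul (x, t) (x, t')

lemma lipschitzWith_slice_right {F : Type*} [PseudoMetricSpace F] {K : NNReal} {H : ℝ × ℝ → F}
    (hH : LipschitzWith K H) (t : ℝ) : LipschitzWith K (fun x => H (x, t)) :=
  LipschitzWith.of_dist_le_mul fun x x' => by
    simpa [Prod.dist_eq] using hH.dist_le_mul (x, t) (x', t)

lemma integrable_partialT {K : NNReal} {H : ℝ × ℝ → ℝ} (hH : LipschitzWith K H) {T : ℝ}
    (hT : ∀ z : ℝ × ℝ, T ≤ z.2 → H z = 0) : Integrable (partialT H) strip :=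
  integrable_strip (T := T + 1) (stronglyMeasurable_partialT hH.continuous).aestronglyMeasurable
    (ae_of_all _ (norm_partialT_le hH))
    (ae_of_all _ fun _ hz => partialT_eq_zero hT (by linarith))

lemma integrable_partialX {K : NNReal} {H : ℝ × ℝ → ℝ} (hH : LipschitzWith K H) {T : ℝ}
    (hT : ∀ z : ℝ × ℝ, T ≤ z.2 → H z = 0) : Integrable (partialX H) strip :=
  integrable_strip (T := T) (stronglyMeasurable_partialX hH.continuous).aestronglyMeasurable
    (ae_of_all _ (norm_partialX_le hH)) (ae_of_all _ fun _ hz => partialX_eq_zero hT hz)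

lemma integral_partialT {K : NNReal} {H : ℝ × ℝ → ℝ} (hH : LipschitzWith K H) {T : ℝ}
    (hT : ∀ z : ℝ × ℝ, T ≤ z.2 → H z = 0) :
    (∫ z, partialT H z ∂strip) + ∫ x in Ioo (0 : ℝ) 1, H (x, 0) = 0 := by
  have hi := integrable_partialT hH hT
  rw [strip_eq_prod] at hi ⊢
  rw [integral_prod _ hi]
  have : ∀ x : ℝ, ∫ t in Ioi (0 : ℝ), partialT H (x, t) = - H (x, 0) := by
    intro x
    -- The end point `max T 0 + 1` is nonnegative and strictly beyond `T`, so the tail vanishes and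
    -- the fundamental theorem applies on a bounded interval.
    have h1 : ∫ t in Ioi (0 : ℝ), partialT H (x, t)
        = ∫ t in Ioc (0 : ℝ) (max T 0 + 1), partialT H (x, t) := by
      refine setIntegral_eq_of_subset_of_forall_sdiff_eq_zero measurableSet_Ioi
        (fun t ht => ht.1) fun t ht => ?_
      refine partialT_eq_zero hT ?_
      have : max T 0 + 1 < t := by
        by_contra hcon
        exact ht.2 ⟨ht.1, not_lt.1 hcon⟩
      exact (le_max_left T 0).trans_lt (by linarith)
    rw [h1, ← intervalIntegral.integral_of_le (by positivity)]
    have h2 := integral_deriv_of_lipschitz (lipschitzWith_slice_left hH x) 0 (max T 0 + 1)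
    rw [hT (x, max T 0 + 1) ((le_max_left T 0).trans (by simp)), zero_sub] at h2
    exact h2
  simp_rw [this]
  rw [integral_neg, neg_add_cancel]

lemma integral_partialX {K : NNReal} {H : ℝ × ℝ → ℝ} (hH : LipschitzWith K H) {T : ℝ}
    (hT : ∀ z : ℝ × ℝ, T ≤ z.2 → H z = 0) (hper : ∀ x t, H (x + 1, t) = H (x, t)) :
    ∫ z, partialX H z ∂strip = 0 := by
  have hi := integrable_partialX hH hT
  rw [strip_eq_prod] at hi ⊢
  rw [integral_prod_symm _ hi]
  refine integral_eq_zero_of_ae (ae_of_all _ fun t => ?_)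
  have h2 := integral_deriv_of_lipschitz (lipschitzWith_slice_right hH t) 0 1
  have h3 := hper 0 t
  rw [zero_add] at h3
  rw [h3, sub_self, intervalIntegral.integral_of_le zero_le_one,
    integral_Ioc_eq_integral_Ioo] at h2
  exact h2

end FundamentalTheorem

/-! ### Second derivatives and Taylor bounds on the state space. -/

noncomputable section Calculus

open Filter Topology

variable {d : ℕ} {U D : Set (Vec d)} {f : Vec d → Vec d} {η q : Vec d → ℝ}

lemma IsEntropySystem.uniqueDiffOn (h : IsEntropySystem U f η q) : UniqueDiffOn ℝ U :=
  uniqueDiffOn_convex h.convex_states h.interior_nonempty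

/-- At boundary points of `U`, symmetry of second derivatives within `U` is inherited from the
interior, which is dense in `U`. -/
lemma IsEntropySystem.mem_closure_interior (h : IsEntropySystem U f η q) {z : Vec d} (hz : z ∈ U) :
    z ∈ closure (interior U) := by
  rw [h.convex_states.closure_interior_eq_closure_of_nonempty_interior h.interior_nonempty]
  exact subset_closure hz

/-- Second derivatives within the state space are symmetric. -/
lemma IsEntropySystem.symm_second (h : IsEntropySystem U f η q) {G : Type*}
    [NormedAddCommGroup G] [NormedSpace ℝ G] {φ : Vec d → G} (hφ : ContDiffOn ℝ 2 φ U) {z : Vec d}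
    (hz : z ∈ U) (v w : Vec d) :
    fderivWithin ℝ (fderivWithin ℝ φ U) U z v w = fderivWithin ℝ (fderivWithin ℝ φ U) U z w v :=
  (hφ z hz).isSymmSndFDerivWithinAt (by simp) h.uniqueDiffOn (h.mem_closure_interior hz) hz v w

lemma hasFDerivWithinAt_of_contDiffOn {G : Type*}
    [NormedAddCommGroup G] [NormedSpace ℝ G] {φ : Vec d → G} (hφ : ContDiffOn ℝ 1 φ U)
    {z : Vec d} (hz : z ∈ U) : HasFDerivWithinAt φ (fderivWithin ℝ φ U z) U z :=
  (hφ.differentiableOn one_ne_zero z hz).hasFDerivWithinAt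

lemma IsEntropySystem.contDiffOn_fderiv (h : IsEntropySystem U f η q) {G : Type*}
    [NormedAddCommGroup G] [NormedSpace ℝ G] {φ : Vec d → G} (hφ : ContDiffOn ℝ 2 φ U) :
    ContDiffOn ℝ 1 (fderivWithin ℝ φ U) U :=
  hφ.fderivWithin h.uniqueDiffOn (by norm_num)

/-- Compatibility gains an order of regularity: `Dq = Dη Df` is a product of `C¹` maps. Without it
`D²q` and its symmetry would be unavailable. -/
lemma IsEntropySystem.contDiffOn_entropyFlux (h : IsEntropySystem U f η q) :
    ContDiffOn ℝ 2 q U := by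
  have h1 : ContDiffOn ℝ 1 (fderivWithin ℝ q U) U :=
    ((h.contDiffOn_fderiv h.entropy_smooth).clm_comp
      (h.contDiffOn_fderiv h.flux_smooth)).congr h.compatible
  exact (contDiffOn_succ_iff_fderivWithin (n := 1) h.uniqueDiffOn).2
    ⟨h.entropyFlux_smooth.differentiableOn one_ne_zero, by simp, h1⟩

/-- The flux Jacobian is symmetric with respect to the Hessian of the entropy. -/
lemma IsEntropySystem.hessian_flux_symm (h : IsEntropySystem U f η q) {z : Vec d} (hz : z ∈ U)
    (v w : Vec d) :
    fderivWithin ℝ (fderivWithin ℝ η U) U z v (fderivWithin ℝ f U z w)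
      = fderivWithin ℝ (fderivWithin ℝ η U) U z (fderivWithin ℝ f U z v) w := by
  -- The product rule applied to `Dq = Dη Df`. The left side and the `D²f` term are symmetric in `a,
  -- b`, so the remaining term is symmetric as well.
  have hq2 : ∀ a b : Vec d, fderivWithin ℝ (fderivWithin ℝ q U) U z a b
      = fderivWithin ℝ (fderivWithin ℝ η U) U z a (fderivWithin ℝ f U z b)
        + fderivWithin ℝ η U z (fderivWithin ℝ (fderivWithin ℝ f U) U z a b) := by
    intro a b
    have h1 := (hasFDerivWithinAt_of_contDiffOn (h.contDiffOn_fderiv h.entropy_smooth) hz).clm_comp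
      (hasFDerivWithinAt_of_contDiffOn (h.contDiffOn_fderiv h.flux_smooth) hz)
    have h2 := (h1.congr h.compatible (h.compatible z hz)).fderivWithin (h.uniqueDiffOn z hz)
    rw [h2]
    simp [add_comm]
  have h3 := h.symm_second h.contDiffOn_entropyFlux hz v w
  rw [hq2, hq2, h.symm_second h.flux_smooth hz v w, add_left_inj,
    h.symm_second h.entropy_smooth hz w] at h3
  exact h3

/-- Comparison with the parabola of second derivative `C`: the difference of first derivatives is
monotone, and then so is the difference of the functions. One-sided derivatives at 0 and 1 suffice,
so segments may end on the boundary of `U`. -/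
lemma taylor_le_of_second_deriv_le {g g₁ g₂ : ℝ → ℝ} {C : ℝ}
    (h₁ : ∀ θ ∈ Icc (0 : ℝ) 1, HasDerivWithinAt g (g₁ θ) (Icc 0 1) θ)
    (h₂ : ∀ θ ∈ Icc (0 : ℝ) 1, HasDerivWithinAt g₁ (g₂ θ) (Icc 0 1) θ)
    (hC : ∀ θ ∈ Icc (0 : ℝ) 1, g₂ θ ≤ C) : g 1 - g 0 - g₁ 0 ≤ C / 2 := by
  have mono : ∀ {k k' : ℝ → ℝ}, (∀ θ ∈ Icc (0 : ℝ) 1, HasDerivWithinAt k (k' θ) (Icc 0 1) θ) →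
      (∀ θ ∈ Icc (0 : ℝ) 1, 0 ≤ k' θ) → ∀ θ ∈ Icc (0 : ℝ) 1, k 0 ≤ k θ := by
    intro k k' hk hk' θ hθ
    refine monotoneOn_of_hasDerivWithinAt_nonneg (convex_Icc 0 1)
      (fun θ hθ => (hk θ hθ).continuousWithinAt)
      (fun θ hθ => (hk θ (interior_subset hθ)).mono interior_subset)
      (fun θ hθ => hk' θ (interior_subset hθ)) (left_mem_Icc.2 zero_le_one) hθ hθ.1
  have hg₁ : ∀ θ ∈ Icc (0 : ℝ) 1, g₁ θ ≤ g₁ 0 + C * θ := by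
    intro θ hθ
    have := mono (k := fun θ => C * θ - g₁ θ) (k' := fun θ => C * 1 - g₂ θ)
      (fun θ hθ => ((hasDerivWithinAt_id θ _).const_mul C).sub (h₂ θ hθ))
      (fun θ hθ => by linarith [hC θ hθ]) θ hθ
    simp only [mul_zero] at this
    linarith
  have := mono (k := fun θ => g₁ 0 * θ + C / 2 * θ ^ 2 - g θ)
    (k' := fun θ => g₁ 0 * 1 + C / 2 * (2 * θ) - g₁ θ)
    (fun θ hθ => (((hasDerivWithinAt_id θ _).const_mul (g₁ 0)).add
      (by simpa using ((hasDerivWithinAt_id θ (Icc (0 : ℝ) 1)).pow 2).const_mul (C / 2))).sub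
        (h₁ θ hθ))
    (fun θ hθ => by linarith [hg₁ θ hθ]) 1 (right_mem_Icc.2 zero_le_one)
  simp only [mul_zero, mul_one] at this
  norm_num at this
  linarith

lemma hasDerivWithinAt_segment {G : Type*} [NormedAddCommGroup G] [NormedSpace ℝ G]
    {h : Vec d → G} {h' : Vec d → Vec d →L[ℝ] G} (hh : ∀ z ∈ U, HasFDerivWithinAt h (h' z) U z)
    {z₀ w : Vec d} (hseg : ∀ θ ∈ Icc (0 : ℝ) 1, z₀ + θ • w ∈ U) (θ : ℝ) (hθ : θ ∈ Icc (0 : ℝ) 1) :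
    HasDerivWithinAt (fun θ : ℝ => h (z₀ + θ • w)) (h' (z₀ + θ • w) w) (Icc 0 1) θ := by
  have h1 : HasDerivWithinAt (fun θ : ℝ => z₀ + θ • w) w (Icc 0 1) θ := by
    simpa using ((hasDerivWithinAt_id θ (Icc (0 : ℝ) 1)).smul_const w).const_add z₀
  exact (hh _ (hseg θ hθ)).comp_hasDerivWithinAt θ h1 hseg

lemma add_smul_sub_mem_of_convex (hD : Convex ℝ D) {z₀ z : Vec d} (hz₀ : z₀ ∈ D) (hz : z ∈ D)
    (θ : ℝ) (hθ : θ ∈ Icc (0 : ℝ) 1) : z₀ + θ • (z - z₀) ∈ D :=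
  hD.add_smul_sub_mem hz₀ hz hθ

variable {Cf Clo Chi : ℝ}

/-- The one-dimensional estimate is applied to `-η` along the segment from `z₀` to `z`, which stays
in `D` by convexity. -/
lemma le_relative_entropy (h : IsEntropySystem U f η q) (hb : HessianBounds U D f η Cf Clo Chi)
    (hDU : D ⊆ U) (hD : Convex ℝ D) {z₀ z : Vec d} (hz₀ : z₀ ∈ D) (hz : z ∈ D) :
    Clo / 2 * ‖z - z₀‖ ^ 2 ≤ η z - η z₀ - fderivWithin ℝ η U z₀ (z - z₀) := by
  have hseg := add_smul_sub_mem_of_convex hD hz₀ hz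
  have h1 := hasDerivWithinAt_segment (fun z hz => hasFDerivWithinAt_of_contDiffOn (h.entropy_smooth.of_le one_le_two)
    hz) fun θ hθ => hDU (hseg θ hθ)
  have h2 := hasDerivWithinAt_segment (fun z hz => hasFDerivWithinAt_of_contDiffOn
    (h.contDiffOn_fderiv h.entropy_smooth) hz) fun θ hθ => hDU (hseg θ hθ)
  have := taylor_le_of_second_deriv_le (fun θ hθ => (h1 θ hθ).neg)
    (fun θ hθ => ((h2 θ hθ).clm_apply (hasDerivWithinAt_const _ _ (z - z₀))).neg)
    (C := -(Clo * ‖z - z₀‖ ^ 2)) fun θ hθ => by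
      have := hb.le_entropy _ (hseg θ hθ) (z - z₀)
      simp only [map_zero, add_zero, neg_le_neg_iff]
      exact this
  simp only [Pi.neg_apply, one_smul, zero_smul, add_zero, add_sub_cancel] at this
  linarith

lemma relative_entropy_le (h : IsEntropySystem U f η q) (hb : HessianBounds U D f η Cf Clo Chi)
    (hDU : D ⊆ U) (hD : Convex ℝ D) {z₀ z : Vec d} (hz₀ : z₀ ∈ D) (hz : z ∈ D) :
    η z - η z₀ - fderivWithin ℝ η U z₀ (z - z₀) ≤ Chi / 2 * ‖z - z₀‖ ^ 2 := by
  have hseg := add_smul_sub_mem_of_convex hD hz₀ hz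
  have h1 := hasDerivWithinAt_segment (fun z hz => hasFDerivWithinAt_of_contDiffOn (h.entropy_smooth.of_le one_le_two)
    hz) fun θ hθ => hDU (hseg θ hθ)
  have h2 := hasDerivWithinAt_segment (fun z hz => hasFDerivWithinAt_of_contDiffOn
    (h.contDiffOn_fderiv h.entropy_smooth) hz) fun θ hθ => hDU (hseg θ hθ)
  have := taylor_le_of_second_deriv_le (fun θ hθ => (h1 θ hθ))
    (fun θ hθ => ((h2 θ hθ).clm_apply (hasDerivWithinAt_const _ _ (z - z₀))))
    (C := (Chi * ‖z - z₀‖ ^ 2)) fun θ hθ => by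
      have := hb.entropy_le _ (hseg θ hθ) (z - z₀)
      simp only [map_zero, add_zero]
      exact this
  simp only [one_smul, zero_smul, add_zero, add_sub_cancel] at this
  linarith

/-- The scalar estimate is applied to `⟨y, f⟩` along the segment, with `y` the remainder itself.
This gives `‖y‖² ≤ ‖y‖ Cf/2 ‖z - z₀‖²`, with the same constant as in the scalar case, and uses only
the diagonal values `D²f(v,v)`. -/
lemma norm_relative_flux_le (h : IsEntropySystem U f η q)
    (hb : HessianBounds U D f η Cf Clo Chi) (hDU : D ⊆ U) (hD : Convex ℝ D) {z₀ z : Vec d}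
    (hz₀ : z₀ ∈ D) (hz : z ∈ D) :
    ‖f z - f z₀ - fderivWithin ℝ f U z₀ (z - z₀)‖ ≤ Cf / 2 * ‖z - z₀‖ ^ 2 := by
  have hseg := add_smul_sub_mem_of_convex hD hz₀ hz
  set y := f z - f z₀ - fderivWithin ℝ f U z₀ (z - z₀) with hy
  have h1 := hasDerivWithinAt_segment (fun z hz => hasFDerivWithinAt_of_contDiffOn (h.flux_smooth.of_le one_le_two)
    hz) fun θ hθ => hDU (hseg θ hθ)
  have h2 := hasDerivWithinAt_segment (fun z hz => hasFDerivWithinAt_of_contDiffOn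
    (h.contDiffOn_fderiv h.flux_smooth) hz) fun θ hθ => hDU (hseg θ hθ)
  have := taylor_le_of_second_deriv_le
    (fun θ hθ => (hasDerivWithinAt_const _ _ y).inner ℝ (h1 θ hθ))
    -- The product rule leaves a summand `⟨0, f⟩` in the first derivative; it is differentiated as
    -- the zero function.
    (fun θ hθ => ((hasDerivWithinAt_const _ _ y).inner ℝ
      ((h2 θ hθ).clm_apply (hasDerivWithinAt_const _ _ (z - z₀)))).add
        (hasDerivWithinAt_const _ _ (0 : ℝ)) |>.congr (fun θ _ => by simp) (by simp))
    (C := ‖y‖ * (Cf * ‖z - z₀‖ ^ 2)) fun θ hθ => by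
      have h3 := hb.flux_le _ (hseg θ hθ) (z - z₀)
      have h4 := real_inner_le_norm y
        (fderivWithin ℝ (fderivWithin ℝ f U) U (z₀ + θ • (z - z₀)) (z - z₀) (z - z₀))
      simpa using h4.trans (mul_le_mul_of_nonneg_left h3 (norm_nonneg _))
  simp only [one_smul, zero_smul, add_zero, add_sub_cancel, inner_zero_left] at this
  rw [← inner_sub_right, ← inner_sub_right, ← hy, real_inner_self_eq_norm_sq] at this
  rcases (norm_nonneg y).eq_or_lt with h0 | h0
  · have := hb.flux_le _ hz (z - z₀)
    rw [← h0]
    have := (norm_nonneg _).trans this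
    linarith
  · nlinarith

/-- Polarization: for `‖a‖ = ‖b‖`, `4 B(a,b) = B(a+b,a+b) - B(a-b,a-b) ≤ Chi (‖a+b‖² + ‖a-b‖²) = 4
Chi ‖b‖²`, the second term being dropped by positivity. The general case follows by rescaling both
vectors to equal norms, so the bound on the quadratic form passes to the bilinear form with no loss.
-/
lemma abs_hessian_le (h : IsEntropySystem U f η q) (hb : HessianBounds U D f η Cf Clo Chi)
    (hDU : D ⊆ U) (hClo : 0 ≤ Clo) {z : Vec d} (hz : z ∈ D) (v w : Vec d) :
    |fderivWithin ℝ (fderivWithin ℝ η U) U z v w| ≤ Chi * (‖v‖ * ‖w‖) := by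
  set B := fderivWithin ℝ (fderivWithin ℝ η U) U z with hB
  have upper : ∀ a b : Vec d, ‖a‖ = ‖b‖ → B a b ≤ Chi * ‖b‖ ^ 2 := by
    intro a b hab
    have h1 := hb.entropy_le z hz (a + b)
    have h2 := (mul_nonneg hClo (sq_nonneg _)).trans (hb.le_entropy z hz (a - b))
    have h4 := hb.entropy_le z hz (a - b)
    have hs := h.symm_second h.entropy_smooth (hDU hz) a b
    rw [← hB] at h1 h2 hs h4
    simp only [map_add, map_sub, _root_.add_apply,
      _root_.sub_apply] at h1 h2 h4
    have h3 := parallelogram_law_with_norm ℝ a b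
    rw [hab] at h3
    have h5 : Chi * ‖a + b‖ ^ 2 + Chi * ‖a - b‖ ^ 2 = 4 * (Chi * ‖b‖ ^ 2) := by
      rw [← mul_add, h3]; ring
    linarith
  have upper' : ∀ a b : Vec d, B a b ≤ Chi * (‖a‖ * ‖b‖) := by
    intro a b
    rcases (norm_nonneg a).eq_or_lt with ha | ha
    · rw [norm_eq_zero.1 ha.symm]; simp
    rcases (norm_nonneg b).eq_or_lt with hb' | hb'
    · rw [norm_eq_zero.1 hb'.symm]; simp
    have := upper (‖b‖ • a) (‖a‖ • b) (by simp [norm_smul, mul_comm])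
    simp only [map_smul, _root_.smul_apply, smul_eq_mul, norm_smul, norm_norm] at this
    have hab : 0 < ‖a‖ * ‖b‖ := mul_pos ha hb'
    refine le_of_mul_le_mul_left ?_ hab
    linarith
  refine abs_le.2 ⟨?_, upper' v w⟩
  have := upper' (-v) w
  simp only [map_neg, _root_.neg_apply, norm_neg] at this
  linarith

end Calculus
end ConsLaw

/-! ### The relative entropy inequality. -/

namespace ConsLaw

noncomputable section RelativeEntropy

open Filter Topology

variable {d : ℕ} {U D : Set (Vec d)} {f : Vec d → Vec d} {η q : Vec d → ℝ}

/-- The vector representing a linear form. -/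
def gradMap : (Vec d →L[ℝ] ℝ) →L[ℝ] Vec d :=
  ∑ i, (ContinuousLinearMap.apply ℝ ℝ (EuclideanSpace.single i (1 : ℝ))).smulRight
    (EuclideanSpace.single i (1 : ℝ))

lemma inner_gradMap (v : Vec d) (L : Vec d →L[ℝ] ℝ) : inner ℝ v (gradMap L) = L v := by
  have hv : v = ∑ i, v i • (EuclideanSpace.single i (1 : ℝ) : Vec d) := by
    ext j
    simp [Finset.sum_apply, Pi.single_apply]
  conv_rhs => rw [hv]
  simp [gradMap, inner_sum, inner_smul_right,
    EuclideanSpace.inner_single_right, mul_comm]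

/-- A continuously differentiable function is Lipschitz on compact convex sets. -/
lemma exists_lipschitzOnWith_of_contDiffOn {G : Type*} [NormedAddCommGroup G] [NormedSpace ℝ G]
    {φ : Vec d → G} (hU : UniqueDiffOn ℝ U) (hφ : ContDiffOn ℝ 1 φ U) (hDU : D ⊆ U)
    (hD : IsCompact D) (hDc : Convex ℝ D) : ∃ K, LipschitzOnWith K φ D := by
  obtain ⟨C, hC⟩ := hD.exists_bound_of_continuousOn
    ((hφ.continuousOn_fderivWithin hU le_rfl).mono hDU)
  refine ⟨C.toNNReal, hDc.lipschitzOnWith_of_nnnorm_hasFDerivWithin_le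
    (fun z hz => (hasFDerivWithinAt_of_contDiffOn hφ (hDU hz)).mono hDU) fun z hz => ?_⟩
  rw [← NNReal.coe_le_coe, coe_nnnorm]
  exact (hC z hz).trans (Real.le_coe_toNNReal C)

lemma lipschitzWith_smul_of_bounded {α G : Type*} [PseudoMetricSpace α] [NormedAddCommGroup G]
    [NormedSpace ℝ G] {a : α → ℝ} {b : α → G} {Ka Kb A B : NNReal} (ha : LipschitzWith Ka a)
    (hb : LipschitzWith Kb b) (hA : ∀ x, ‖a x‖ ≤ A) (hB : ∀ x, ‖b x‖ ≤ B) :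
    LipschitzWith (A * Kb + Ka * B) (fun x => a x • b x) := by
  refine LipschitzWith.of_dist_le_mul fun x y => ?_
  have h1 : a x • b x - a y • b y = a x • (b x - b y) + (a x - a y) • b y := by
    rw [smul_sub, sub_smul]; abel
  rw [dist_eq_norm, h1]
  refine (norm_add_le _ _).trans ?_
  rw [norm_smul, norm_smul, ← dist_eq_norm, ← dist_eq_norm]
  push_cast
  rw [add_mul]
  refine add_le_add ?_ ?_
  · rw [mul_assoc]
    exact mul_le_mul (hA x) (hb.dist_le_mul x y) dist_nonneg A.2
  · rw [mul_right_comm]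
    exact mul_le_mul (ha.dist_le_mul x y) (hB y) (norm_nonneg _) (by positivity)

/-- The function `χ(t) φ(g(x,t))` built from a cutoff `χ` and a smooth function `φ` of a state
`g`. -/
def cutoffComp {G : Type*} [SMul ℝ G] (χ : ℝ → ℝ) (φ : Vec d → G) (g : ℝ × ℝ → Vec d)
    (z : ℝ × ℝ) : G := χ z.2 • φ (g z)

/-- What makes `χ(t) φ(g)` admissible as a test function: `φ` is Lipschitz and bounded on the
compact convex set containing the values of `g`. -/
lemma exists_lipschitzWith_cutoffComp {G : Type*} [NormedAddCommGroup G] [NormedSpace ℝ G]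
    {φ : Vec d → G} {χ : ℝ → ℝ} {g : ℝ × ℝ → Vec d} {K K' : NNReal} (hU : UniqueDiffOn ℝ U)
    (hφ : ContDiffOn ℝ 1 φ U) (hDU : D ⊆ U) (hD : IsCompact D) (hDc : Convex ℝ D)
    (hχ : LipschitzWith K' χ) (hχ1 : ∀ t, ‖χ t‖ ≤ 1) (hg : LipschitzWith K g)
    (hgD : ∀ z, g z ∈ D) : ∃ K, LipschitzWith K (cutoffComp χ φ g) := by
  obtain ⟨L, hL⟩ := exists_lipschitzOnWith_of_contDiffOn hU hφ hDU hD hDc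
  obtain ⟨B, hB⟩ := hD.exists_bound_of_continuousOn (hφ.continuousOn.mono hDU)
  have hb : LipschitzWith (L * K) (fun z => φ (g z)) := by
    rw [← lipschitzOnWith_univ] at hg ⊢
    exact hL.comp hg fun z _ => hgD z
  exact ⟨_, lipschitzWith_smul_of_bounded (A := 1) (B := B.toNNReal)
    (hχ.comp LipschitzWith.prod_snd) hb (fun z => by simpa using hχ1 z.2)
    (fun z => (hB _ (hgD z)).trans (Real.le_coe_toNNReal B))⟩

section

variable {G : Type*} [NormedAddCommGroup G] [NormedSpace ℝ G] {φ : Vec d → G}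
  {φ' : Vec d →L[ℝ] G} {χ : ℝ → ℝ} {g : ℝ × ℝ → Vec d} {z : ℝ × ℝ}

/-- The chain rule works with a derivative within `U`, even at boundary states, because `g` never
leaves `U`. -/
lemma partialT_cutoffComp (hφ : HasFDerivWithinAt φ φ' U (g z)) (hgU : ∀ z, g z ∈ U)
    (hg : DifferentiableAt ℝ g z) (hχ : DifferentiableAt ℝ χ z.2) :
    partialT (cutoffComp χ φ g) z = deriv χ z.2 • φ (g z) + χ z.2 • φ' (partialT g z) := by
  have h1 : HasDerivAt (fun τ => φ (g (z.1, τ))) (φ' (partialT g z)) z.2 :=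
    HasFDerivWithinAt.comp_hasDerivAt (t := U) (f := fun τ => g (z.1, τ)) z.2 hφ
      (hasDerivAt_partialT hg) (Eventually.of_forall fun τ => hgU _)
  rw [add_comm]
  exact (hχ.hasDerivAt.smul h1).deriv

lemma partialX_cutoffComp (hφ : HasFDerivWithinAt φ φ' U (g z)) (hgU : ∀ z, g z ∈ U)
    (hg : DifferentiableAt ℝ g z) :
    partialX (cutoffComp χ φ g) z = χ z.2 • φ' (partialX g z) := by
  have h1 : HasDerivAt (fun y => φ (g (y, z.2))) (φ' (partialX g z)) z.1 :=
    HasFDerivWithinAt.comp_hasDerivAt (t := U) (f := fun y => g (y, z.2)) z.1 hφ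
      (hasDerivAt_partialX hg) (Eventually.of_forall fun τ => hgU _)
  exact (h1.const_smul (χ z.2)).deriv

end

/-- The relative entropy `η(z) - η(z₀) - Dη(z₀)(z - z₀)`. -/
def relEntropy (U : Set (Vec d)) (η : Vec d → ℝ) (z z₀ : Vec d) : ℝ :=
  η z - η z₀ - fderivWithin ℝ η U z₀ (z - z₀)

/-- The relative flux `f(z) - f(z₀) - Df(z₀)(z - z₀)`. -/
def relFlux (U : Set (Vec d)) (f : Vec d → Vec d) (z z₀ : Vec d) : Vec d :=
  f z - f z₀ - fderivWithin ℝ f U z₀ (z - z₀)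

/-- The residual `∂ₜg + Df(g) ∂ₓg`. -/
def residual (U : Set (Vec d)) (f : Vec d → Vec d) (g : ℝ × ℝ → Vec d) (z : ℝ × ℝ) : Vec d :=
  partialT g z + fderivWithin ℝ f U (g z) (partialX g z)

/-- The production term in the balance of relative entropy. -/
def relProduction (U : Set (Vec d)) (f : Vec d → Vec d) (η : Vec d → ℝ) (g : ℝ × ℝ → Vec d)
    (u : ℝ → ℝ → Vec d) (z : ℝ × ℝ) : ℝ :=
  fderivWithin ℝ (fderivWithin ℝ η U) U (g z) (residual U f g z) (u z.1 z.2 - g z)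
    + fderivWithin ℝ (fderivWithin ℝ η U) U (g z) (partialX g z) (relFlux U f (u z.1 z.2) (g z))

lemma ae_strip_differentiable {g : ℝ × ℝ → Vec d} {K : NNReal} (hg : LipschitzWith K g) :
    ∀ᵐ z ∂strip, DifferentiableAt ℝ g z :=
  ae_restrict_of_ae hg.ae_differentiableAt

lemma ae_strip_of_ae_time {P : ℝ → Prop} (h : ∀ᵐ t, P t) : ∀ᵐ z ∂strip, P z.2 := by
  refine ae_restrict_of_ae ?_
  rw [Measure.volume_eq_prod]
  exact Measure.quasiMeasurePreserving_snd.ae h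

/-- The pointwise identity behind the balance of relative entropy. -/
lemma relative_entropy_integrand (hsys : IsEntropySystem U f η q) {g : ℝ × ℝ → Vec d}
    (hgU : ∀ z, g z ∈ U) {u : ℝ → ℝ → Vec d} {χ : ℝ → ℝ} {z : ℝ × ℝ}
    (hgz : DifferentiableAt ℝ g z) (hχz : DifferentiableAt ℝ χ z.2) :
    weakIntegrand (fun z => η (u z.1 z.2)) (fun z => q (u z.1 z.2)) (fun z => χ z.2) z
      - weakIntegrand (fun z => u z.1 z.2) (fun z => f (u z.1 z.2))
          (cutoffComp χ (fun v => gradMap (fderivWithin ℝ η U v)) g) z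
      + partialT (cutoffComp χ (fun v => fderivWithin ℝ η U v v - η v) g) z
      + partialX (cutoffComp χ (fun v => fderivWithin ℝ η U v (f v) - q v) g) z
    = deriv χ z.2 * relEntropy U η (u z.1 z.2) (g z) - χ z.2 * relProduction U f η g u z := by
  have hDη := hasFDerivWithinAt_of_contDiffOn (hsys.contDiffOn_fderiv hsys.entropy_smooth) (hgU z)
  have hη := hasFDerivWithinAt_of_contDiffOn (hsys.entropy_smooth.of_le one_le_two) (hgU z)
  have hf := hasFDerivWithinAt_of_contDiffOn (hsys.flux_smooth.of_le one_le_two) (hgU z)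
  have hq := hasFDerivWithinAt_of_contDiffOn hsys.entropyFlux_smooth (hgU z)
  have hgrad := (gradMap (d := d)).hasFDerivAt.comp_hasFDerivWithinAt (g z) hDη
  have hH := (hDη.clm_apply (hasFDerivWithinAt_id (g z) U)).sub hη
  have hQ := (hDη.clm_apply hf).sub hq
  have e1 : partialT (fun z : ℝ × ℝ => χ z.2) z = deriv χ z.2 := rfl
  have e2 : partialX (fun z : ℝ × ℝ => χ z.2) z = 0 := deriv_const z.1 (χ z.2)
  have e3 := partialT_cutoffComp hgrad hgU hgz hχz
  have e4 := partialX_cutoffComp (χ := χ) hgrad hgU hgz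
  have e5 := partialT_cutoffComp hH hgU hgz hχz
  have e6 := partialX_cutoffComp (χ := χ) hQ hgU hgz
  -- Replacing `∂ₜg` by the residual produces `-D²η(Df ∂ₓg, u - g)`. Symmetry rewrites it as
  -- `-D²η(∂ₓg, Df(u - g))`, precisely the linear part subtracted in the relative flux.
  have hsymm := hsys.hessian_flux_symm (hgU z) (partialX g z) (u z.1 z.2 - g z)
  have hcomp := hsys.compatible (g z) (hgU z)
  simp only [weakIntegrand, e1, e2]
  change _ - (inner ℝ _ (partialT (cutoffComp χ ((gradMap (d := d)) ∘ fderivWithin ℝ η U) g) z)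
    + inner ℝ _ (partialX (cutoffComp χ ((gradMap (d := d)) ∘ fderivWithin ℝ η U) g) z))
    + partialT (cutoffComp χ ((fun v => fderivWithin ℝ η U v (id v)) - η) g) z
    + partialX (cutoffComp χ ((fun v => fderivWithin ℝ η U v (f v)) - q) g) z = _
  rw [e3, e4, e5, e6, relProduction, residual, relEntropy, relFlux, hcomp]
  simp only [inner_add_right, inner_smul_right, Function.comp_apply, inner_gradMap,
    ContinuousLinearMap.comp_apply, _root_.add_apply, _root_.sub_apply, map_add, map_sub,
    Pi.sub_apply, ContinuousLinearMap.flip_apply, ContinuousLinearMap.coe_id', id_eq,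
    smul_eq_mul, RCLike.inner_apply, conj_trivial] at hsymm ⊢
  rw [hsymm]
  ring

lemma integral_add_four {α : Type*} [MeasurableSpace α] {μ : Measure α} {a b c e : α → ℝ}
    (ha : Integrable a μ) (hb : Integrable b μ) (hc : Integrable c μ) (he : Integrable e μ) :
    Integrable (fun z => a z - b z + c z + e z) μ ∧
    ∫ z, (a z - b z + c z + e z) ∂μ = ∫ z, a z ∂μ - ∫ z, b z ∂μ + ∫ z, c z ∂μ + ∫ z, e z ∂μ := by
  refine ⟨((ha.sub hb).add hc).add he, ?_⟩
  rw [← integral_sub ha hb]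
  exact (integral_add ((ha.sub hb).add hc) he).trans
    (congrArg (· + ∫ z, e z ∂μ) (integral_add (ha.sub hb) hc))

/-- The relative entropy inequality, tested with a cutoff in time. -/
theorem relative_entropy_inequality (hsys : IsEntropySystem U f η q) {u₀ : ℝ → Vec d}
    {u : ℝ → ℝ → Vec d} (hu : IsEntropySolution U f η q u₀ u) (hDU : D ⊆ U) (hD : IsCompact D)
    (hDc : Convex ℝ D) (huD : ∀ᵐ z ∂strip, u z.1 z.2 ∈ D)
    (hu₀D : ∀ᵐ x ∂(volume.restrict (Ioo (0 : ℝ) 1)), u₀ x ∈ D) {g : ℝ × ℝ → Vec d} {K K' : NNReal}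
    (hg : LipschitzWith K g) (hgper : ∀ x t, g (x + 1, t) = g (x, t)) (hgD : ∀ z, g z ∈ D)
    {χ : ℝ → ℝ} (hχ : LipschitzWith K' χ) (hχ0 : ∀ t, 0 ≤ χ t) (hχ1 : ∀ t, χ t ≤ 1) {T : ℝ}
    (hχT : ∀ t, T ≤ t → χ t = 0) :
    Integrable (fun z => deriv χ z.2 * relEntropy U η (u z.1 z.2) (g z)
        - χ z.2 * relProduction U f η g u z) strip ∧
    0 ≤ (∫ z, (deriv χ z.2 * relEntropy U η (u z.1 z.2) (g z)
        - χ z.2 * relProduction U f η g u z) ∂strip)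
      + ∫ x in Ioo (0 : ℝ) 1, χ 0 * relEntropy U η (u₀ x) (g (x, 0)) := by
  have hgU : ∀ z, g z ∈ U := fun z => hDU (hgD z)
  have hχn : ∀ t, ‖χ t‖ ≤ 1 := fun t => by
    rw [Real.norm_of_nonneg (hχ0 t)]; exact hχ1 t
  have hUd := hsys.uniqueDiffOn
  have hDη := hsys.contDiffOn_fderiv hsys.entropy_smooth
  have hη1 := hsys.entropy_smooth.of_le (one_le_two (α := WithTop ℕ∞))
  have hf1 := hsys.flux_smooth.of_le (one_le_two (α := WithTop ℕ∞))
  have hgrad : ContDiffOn ℝ 1 (fun v => gradMap (fderivWithin ℝ η U v)) U :=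
    (gradMap (d := d)).contDiff.comp_contDiffOn hDη
  have hH : ContDiffOn ℝ 1 (fun v => fderivWithin ℝ η U v v - η v) U :=
    (hDη.clm_apply contDiffOn_id).sub hη1
  have hQ : ContDiffOn ℝ 1 (fun v => fderivWithin ℝ η U v (f v) - q v) U :=
    (hDη.clm_apply hf1).sub hsys.entropyFlux_smooth
  obtain ⟨K₁, hK₁⟩ := exists_lipschitzWith_cutoffComp hUd hgrad hDU hD hDc hχ hχn hg hgD
  obtain ⟨K₂, hK₂⟩ := exists_lipschitzWith_cutoffComp hUd hH hDU hD hDc hχ hχn hg hgD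
  obtain ⟨K₃, hK₃⟩ := exists_lipschitzWith_cutoffComp hUd hQ hDU hD hDc hχ hχn hg hgD
  have hζ : LipschitzWith K' (fun z : ℝ × ℝ => χ z.2) := by
    simpa [Function.comp_def] using hχ.comp LipschitzWith.prod_snd
  have hzero : ∀ {G : Type} [NormedAddCommGroup G] [NormedSpace ℝ G] (φ : Vec d → G) (z : ℝ × ℝ),
      T ≤ z.2 → cutoffComp χ φ g z = 0 := fun φ z hz => by
    rw [cutoffComp, hχT _ hz, zero_smul]
  have hper : ∀ {G : Type} [NormedAddCommGroup G] [NormedSpace ℝ G] (φ : Vec d → G) (x t : ℝ),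
      cutoffComp χ φ g (x + 1, t) = cutoffComp χ φ g (x, t) := fun φ x t => by
    simp only [cutoffComp, hgper]
  have hcη := hη1.continuousOn.mono hDU
  have hcq := hsys.entropyFlux_smooth.continuousOn.mono hDU
  have hcf := hf1.continuousOn.mono hDU
  -- The four contributions: the entropy inequality tested with `χ`, the equation tested with `χ
  -- Dη(g)`, and two exact derivatives whose integrals reduce to an initial term and to zero.
  have I₁ := hu.weakForm_entropy_nonneg hD huD hu₀D hcη hcq hζ (fun _ _ => rfl)
    (fun z => hχ0 z.2) (T := T) fun z hz => hχT _ hz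
  have I₂ := hu.weakForm_eq_zero hD huD hcf hK₁ (hper _) (hzero _)
  have I₃ := integral_partialT hK₂ (hzero _)
  have I₄ := integral_partialX hK₃ (hzero _) (hper _)
  have hm : AEStronglyMeasurable (fun z : ℝ × ℝ => u z.1 z.2) strip := hu.measurable
  obtain ⟨M₁, hM₁⟩ := ae_norm_comp_le hD hcη huD
  obtain ⟨M₂, hM₂⟩ := ae_norm_comp_le hD hcq huD
  obtain ⟨M₃, hM₃⟩ := ae_norm_comp_le hD continuousOn_id huD
  obtain ⟨M₄, hM₄⟩ := ae_norm_comp_le hD hcf huD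
  have J₁ := integrable_weakIntegrand
    (aestronglyMeasurable_comp_of_continuousOn hD.isClosed hcη hm huD)
    (aestronglyMeasurable_comp_of_continuousOn hD.isClosed hcq hm huD)
    (M := max M₁ M₂) (hM₁.mono fun z h => h.trans (le_max_left _ _))
    (hM₂.mono fun z h => h.trans (le_max_right _ _)) hζ (T := T) fun z hz => hχT _ hz
  have J₂ := integrable_weakIntegrand hm
    (aestronglyMeasurable_comp_of_continuousOn hD.isClosed hcf hm huD)
    (M := max M₃ M₄) (hM₃.mono fun z h => h.trans (le_max_left _ _))
    (hM₄.mono fun z h => h.trans (le_max_right _ _)) hK₁ (hzero _)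
  obtain ⟨hint, hsum⟩ := integral_add_four J₁ J₂ (integrable_partialT hK₂ (hzero _))
    (integrable_partialX hK₃ (hzero _))
  have hae := ((ae_strip_differentiable hg).and
    (ae_strip_of_ae_time hχ.ae_differentiableAt)).mono fun z h =>
      relative_entropy_integrand hsys hgU (u := u) h.1 h.2
  refine ⟨hint.congr hae, ?_⟩
  rw [← integral_congr_ae hae, hsum]
  obtain ⟨N₁, hN₁⟩ := ae_norm_comp_le hD hcη hu₀D
  have hg0 : Continuous fun x : ℝ => (x, (0 : ℝ)) := continuous_id.prodMk continuous_const
  have L₁ : IntegrableOn (fun x => inner ℝ (η (u₀ x)) (χ (x, (0 : ℝ)).2)) (Ioo 0 1) :=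
    integrable_inner_initial
      (aestronglyMeasurable_comp_of_continuousOn hD.isClosed hcη hu.init_measurable hu₀D)
      hN₁ (hζ.continuous.comp hg0)
  obtain ⟨N₂, hN₂⟩ := hu.init_bounded
  have L₂ : IntegrableOn (fun x => inner ℝ (u₀ x)
      (cutoffComp χ (fun v => gradMap (fderivWithin ℝ η U v)) g (x, 0))) (Ioo 0 1) :=
    integrable_inner_initial hu.init_measurable hN₂ (hK₁.continuous.comp hg0)
  have L₃ : IntegrableOn (fun x => cutoffComp χ (fun v => fderivWithin ℝ η U v v - η v) g (x, 0))
      (Ioo 0 1) := ((hK₂.continuous.comp hg0).integrableOn_Icc).mono_set Ioo_subset_Icc_self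
  -- The initial terms combine with the same signs as the coefficients of `χ'`, giving the relative
  -- entropy at time zero.
  have hinit : ∫ x in Ioo (0 : ℝ) 1, χ 0 * relEntropy U η (u₀ x) (g (x, 0))
      = (∫ x in Ioo (0 : ℝ) 1, inner ℝ (η (u₀ x)) (χ (x, (0 : ℝ)).2))
        - (∫ x in Ioo (0 : ℝ) 1, inner ℝ (u₀ x)
            (cutoffComp χ (fun v => gradMap (fderivWithin ℝ η U v)) g (x, 0)))
        + ∫ x in Ioo (0 : ℝ) 1, cutoffComp χ (fun v => fderivWithin ℝ η U v v - η v) g (x, 0) := by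
    rw [← integral_sub L₁ L₂]
    refine Eq.trans (integral_congr_ae (ae_of_all _ fun x => ?_)) (integral_add (L₁.sub L₂) L₃)
    simp only [cutoffComp, relEntropy, inner_smul_right, inner_gradMap, RCLike.inner_apply,
      conj_trivial, smul_eq_mul, map_sub]
    ring
  rw [hinit]
  simp only [weakForm] at I₁ I₂
  linarith

end RelativeEntropy
end ConsLaw

/-! ### The energy estimate averaged over a short time interval. -/

namespace ConsLaw

noncomputable section Energy

open Filter Topology

variable {d : ℕ} {U D : Set (Vec d)} {f : Vec d → Vec d} {η q : Vec d → ℝ}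

/-- The piecewise linear cutoff that is `1` up to `s - ε` and `0` from `s` on. -/
def ramp (s ε t : ℝ) : ℝ := max 0 (min 1 ((s - t) / ε))

lemma lipschitzWith_ramp (s : ℝ) {ε : ℝ} (hε : 0 < ε) :
    LipschitzWith (1 / ε).toNNReal (ramp s ε) := by
  refine LipschitzWith.const_max (LipschitzWith.const_min (LipschitzWith.of_dist_le_mul
    fun t t' => le_of_eq ?_) 1) 0
  rw [Real.dist_eq, Real.dist_eq, Real.coe_toNNReal _ (by positivity), ← sub_div, abs_div,
    abs_of_pos hε, sub_sub_sub_cancel_left, abs_sub_comm]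
  ring

lemma ramp_nonneg (s ε t : ℝ) : 0 ≤ ramp s ε t := le_max_left _ _

lemma ramp_le_one (s ε t : ℝ) : ramp s ε t ≤ 1 := max_le zero_le_one (min_le_left _ _)

lemma ramp_eq_zero {s ε t : ℝ} (hε : 0 < ε) (h : s ≤ t) : ramp s ε t = 0 :=
  max_eq_left ((min_le_right _ _).trans (div_nonpos_of_nonpos_of_nonneg (by linarith) hε.le))

lemma ramp_eq_one {s ε t : ℝ} (hε : 0 < ε) (h : t ≤ s - ε) : ramp s ε t = 1 := by
  rw [ramp, min_eq_left, max_eq_right zero_le_one]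
  rw [le_div_iff₀ hε]
  linarith

lemma ramp_eq_div {s ε t : ℝ} (hε : 0 < ε) (h : t ∈ Icc (s - ε) s) :
    ramp s ε t = (s - t) / ε := by
  rw [ramp, min_eq_right, max_eq_right]
  · exact div_nonneg (by linarith [h.2]) hε.le
  · rw [div_le_one hε]
    linarith [h.1]

lemma deriv_ramp_of_gt {s ε t : ℝ} (hε : 0 < ε) (h : s < t) : deriv (ramp s ε) t = 0 := by
  have : ramp s ε =ᶠ[𝓝 t] fun _ => 0 := by
    filter_upwards [lt_mem_nhds h] with τ hτ using ramp_eq_zero hε (le_of_lt hτ)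
  rw [this.deriv_eq, deriv_const]

lemma deriv_ramp_of_lt {s ε t : ℝ} (hε : 0 < ε) (h : t < s - ε) : deriv (ramp s ε) t = 0 := by
  have : ramp s ε =ᶠ[𝓝 t] fun _ => 1 := by
    filter_upwards [gt_mem_nhds h] with τ hτ using ramp_eq_one hε (le_of_lt hτ)
  rw [this.deriv_eq, deriv_const]

lemma deriv_ramp_of_mem {s ε t : ℝ} (hε : 0 < ε) (h : t ∈ Ioo (s - ε) s) :
    deriv (ramp s ε) t = -(1 / ε) := by
  have : ramp s ε =ᶠ[𝓝 t] fun τ => (s - τ) / ε := by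
    filter_upwards [Ioo_mem_nhds h.1 h.2] with τ hτ using ramp_eq_div hε ⟨hτ.1.le, hτ.2.le⟩
  rw [this.deriv_eq]
  simp [neg_div]

lemma ae_deriv_ramp {s ε : ℝ} (hε : 0 < ε) :
    ∀ᵐ t, deriv (ramp s ε) t = indicator (Ioo (s - ε) s) (fun _ => -(1 / ε)) t := by
  have h1 : ∀ᵐ t : ℝ, t ≠ s := by simp [ae_iff, measure_singleton]
  have h2 : ∀ᵐ t : ℝ, t ≠ s - ε := by simp [ae_iff, measure_singleton]
  filter_upwards [h1, h2] with t h1 h2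
  by_cases h : t ∈ Ioo (s - ε) s
  · rw [indicator_of_mem h, deriv_ramp_of_mem hε h]
  · rw [indicator_of_notMem h]
    rcases lt_or_gt_of_ne h2 with h3 | h3
    · exact deriv_ramp_of_lt hε h3
    · rcases lt_or_gt_of_ne h1 with h4 | h4
      · exact absurd ⟨h3, h4⟩ h
      · exact deriv_ramp_of_gt hε h4

lemma integral_strip_indicator {S : Set (ℝ × ℝ)} (hS : MeasurableSet S)
    (hsub : S ⊆ Ioo (0 : ℝ) 1 ×ˢ Ioi (0 : ℝ)) {E : Type*} [NormedAddCommGroup E] [NormedSpace ℝ E]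
    (F : ℝ × ℝ → E) : ∫ z, indicator S F z ∂strip = ∫ z in S, F z := by
  rw [integral_indicator hS, Measure.restrict_restrict hS, inter_eq_left.2 hsub]

lemma integrable_strip_indicator {S : Set (ℝ × ℝ)} (hS : MeasurableSet S)
    (hsub : S ⊆ Ioo (0 : ℝ) 1 ×ˢ Ioi (0 : ℝ)) {E : Type*} [NormedAddCommGroup E]
    {F : ℝ × ℝ → E} (hF : IntegrableOn F S) : Integrable (indicator S F) strip := by
  rw [integrable_indicator_iff hS, IntegrableOn, Measure.restrict_restrict hS,
    inter_eq_left.2 hsub]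
  exact hF

/-- The residual term is split by Young's inequality as `Chi |r||u-g| ≤ (Chi² |u-g|² + |r|²)/2`, the
source of the `Chi²` in the bound. The relative flux term gives `Chi N Cf/2 |u-g|²`. The common
factor 1/2 matches the one in the Taylor bounds for the entropy and cancels at the end. -/
lemma abs_relProduction_le (hsys : IsEntropySystem U f η q) {Cf Clo Chi N : ℝ}
    (hb : HessianBounds U D f η Cf Clo Chi) (hDU : D ⊆ U) (hDc : Convex ℝ D)
    (hClo : 0 ≤ Clo) (hChi : 0 ≤ Chi) {g : ℝ × ℝ → Vec d} {u : ℝ → ℝ → Vec d} {z : ℝ × ℝ}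
    (hgD : g z ∈ D) (huD : u z.1 z.2 ∈ D) (hN : ‖partialX g z‖ ≤ N) :
    |relProduction U f η g u z| ≤ 1 / 2 * ((Cf * Chi * N + Chi ^ 2) * ‖u z.1 z.2 - g z‖ ^ 2
      + ‖residual U f g z‖ ^ 2) := by
  have h1 := abs_hessian_le hsys hb hDU hClo hgD (residual U f g z) (u z.1 z.2 - g z)
  have h2 := abs_hessian_le hsys hb hDU hClo hgD (partialX g z) (relFlux U f (u z.1 z.2) (g z))
  have h3 : ‖relFlux U f (u z.1 z.2) (g z)‖ ≤ Cf / 2 * ‖u z.1 z.2 - g z‖ ^ 2 :=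
    norm_relative_flux_le hsys hb hDU hDc hgD huD
  have h4 : ‖partialX g z‖ * ‖relFlux U f (u z.1 z.2) (g z)‖
      ≤ N * (Cf / 2 * ‖u z.1 z.2 - g z‖ ^ 2) :=
    mul_le_mul hN h3 (norm_nonneg _) ((norm_nonneg _).trans hN)
  have h5 := mul_le_mul_of_nonneg_left h4 hChi
  have h6 := abs_add_le (fderivWithin ℝ (fderivWithin ℝ η U) U (g z) (residual U f g z)
    (u z.1 z.2 - g z)) (fderivWithin ℝ (fderivWithin ℝ η U) U (g z) (partialX g z)
      (relFlux U f (u z.1 z.2) (g z)))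
  have h7 : Chi * (‖residual U f g z‖ * ‖u z.1 z.2 - g z‖)
      ≤ 1 / 2 * (Chi ^ 2 * ‖u z.1 z.2 - g z‖ ^ 2 + ‖residual U f g z‖ ^ 2) := by
    nlinarith [sq_nonneg (‖residual U f g z‖ - Chi * ‖u z.1 z.2 - g z‖)]
  rw [relProduction]
  linarith

lemma stronglyMeasurable_residual (hsys : IsEntropySystem U f η q) (hDU : D ⊆ U)
    {g : ℝ × ℝ → Vec d} (hg : Continuous g) (hgD : ∀ z, g z ∈ D) :
    StronglyMeasurable (residual U f g) := by
  have hc : Continuous fun z => fderivWithin ℝ f U (g z) :=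
    ((hsys.contDiffOn_fderiv hsys.flux_smooth).continuousOn.mono hDU).comp_continuous hg hgD
  refine (stronglyMeasurable_partialT hg).add ?_
  exact isBoundedBilinearMap_apply.continuous.comp_stronglyMeasurable
    (hc.stronglyMeasurable.prodMk (stronglyMeasurable_partialX hg))

lemma exists_norm_residual_le (hsys : IsEntropySystem U f η q) (hDU : D ⊆ U) (hD : IsCompact D)
    {g : ℝ × ℝ → Vec d} {K : NNReal} (hg : LipschitzWith K g) (hgD : ∀ z, g z ∈ D) :
    ∃ M, ∀ z, ‖residual U f g z‖ ≤ M := by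
  obtain ⟨B, hB⟩ := hD.exists_bound_of_continuousOn
    ((hsys.contDiffOn_fderiv hsys.flux_smooth).continuousOn.mono hDU)
  refine ⟨K + B * K, fun z => (norm_add_le _ _).trans (add_le_add (norm_partialT_le hg z) ?_)⟩
  exact (ContinuousLinearMap.le_opNorm _ _).trans (mul_le_mul (hB _ (hgD z)) (norm_partialX_le hg z)
    (norm_nonneg _) ((norm_nonneg _).trans (hB _ (hgD z))))

lemma volume_box_lt_top (a b : ℝ) : volume (Ioo (0 : ℝ) 1 ×ˢ Ioo a b) < ⊤ := by
  rw [Measure.volume_eq_prod, Measure.prod_prod]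
  simp [Real.volume_Ioo]

lemma integrableOn_box_of_bound {E : Type*} [NormedAddCommGroup E] {F : ℝ × ℝ → E} {a b M : ℝ}
    (hF : AEStronglyMeasurable F (volume.restrict (Ioo (0 : ℝ) 1 ×ˢ Ioo a b)))
    (hM : ∀ᵐ z ∂(volume.restrict (Ioo (0 : ℝ) 1 ×ˢ Ioo a b)), ‖F z‖ ≤ M) :
    IntegrableOn F (Ioo (0 : ℝ) 1 ×ˢ Ioo a b) := by
  have : IsFiniteMeasure (volume.restrict (Ioo (0 : ℝ) 1 ×ˢ Ioo a b)) :=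
    ⟨by rw [Measure.restrict_apply_univ]; exact volume_box_lt_top a b⟩
  exact Integrable.of_bound hF M hM

/-- The error, averaged over a short time interval ending at `s`, is controlled by the initial
error, the accumulated error and the residual. -/
theorem averaged_error_le (hsys : IsEntropySystem U f η q) {Cf Clo Chi N : ℝ}
    (hb : HessianBounds U D f η Cf Clo Chi) (hDU : D ⊆ U) (hD : IsCompact D) (hDc : Convex ℝ D)
    (hClo : 0 ≤ Clo) (hChi : 0 ≤ Chi) {u₀ : ℝ → Vec d} {u : ℝ → ℝ → Vec d}
    (hu : IsEntropySolution U f η q u₀ u) (huD : ∀ᵐ z ∂strip, u z.1 z.2 ∈ D)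
    (hu₀D : ∀ᵐ x ∂(volume.restrict (Ioo (0 : ℝ) 1)), u₀ x ∈ D) {g : ℝ × ℝ → Vec d} {K : NNReal}
    (hg : LipschitzWith K g) (hgper : ∀ x t, g (x + 1, t) = g (x, t)) (hgD : ∀ z, g z ∈ D)
    {s ε : ℝ} (hε : 0 < ε) (hεs : ε ≤ s)
    (hN : ∀ᵐ z ∂(volume.restrict (Ioo (0 : ℝ) 1 ×ˢ Ioo 0 s)), ‖partialX g z‖ ≤ N) :
    Clo * (1 / ε * ∫ z in Ioo (0 : ℝ) 1 ×ˢ Ioo (s - ε) s, ‖u z.1 z.2 - g z‖ ^ 2)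
      ≤ Chi * (∫ x in Ioo (0 : ℝ) 1, ‖u₀ x - g (x, 0)‖ ^ 2)
        + ((Cf * Chi * N + Chi ^ 2) * (∫ z in Ioo (0 : ℝ) 1 ×ˢ Ioo 0 s, ‖u z.1 z.2 - g z‖ ^ 2)
        + ∫ z in Ioo (0 : ℝ) 1 ×ˢ Ioo 0 s, ‖residual U f g z‖ ^ 2) := by
  have hS : ∀ a, 0 ≤ a → Ioo (0 : ℝ) 1 ×ˢ Ioo a s ⊆ Ioo (0 : ℝ) 1 ×ˢ Ioi (0 : ℝ) := fun a ha =>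
    prod_mono le_rfl fun t ht => ha.trans_lt ht.1
  have hSm : ∀ a, MeasurableSet (Ioo (0 : ℝ) 1 ×ˢ Ioo a s) := fun a =>
    measurableSet_Ioo.prod measurableSet_Ioo
  have hmu : AEStronglyMeasurable (fun z : ℝ × ℝ => u z.1 z.2) strip := hu.measurable
  obtain ⟨MD, hMD⟩ := hD.exists_bound_of_continuousOn (f := fun v : Vec d => v) continuousOn_id
  obtain ⟨MR, hMR⟩ := exists_norm_residual_le hsys hDU hD hg hgD
  have hw : ∀ a, 0 ≤ a → IntegrableOn (fun z : ℝ × ℝ => ‖u z.1 z.2 - g z‖ ^ 2)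
      (Ioo (0 : ℝ) 1 ×ˢ Ioo a s) := fun a ha => by
    refine integrableOn_box_of_bound (M := (MD + MD) ^ 2) ?_ ?_
    · exact (((hmu.mono_measure (Measure.restrict_mono (hS a ha) le_rfl)).sub
        hg.continuous.aestronglyMeasurable).norm.pow 2)
    · filter_upwards [ae_restrict_of_ae_restrict_of_subset (hS a ha) huD] with z hz
      rw [Real.norm_of_nonneg (sq_nonneg _)]
      exact pow_le_pow_left₀ (norm_nonneg _)
        ((norm_sub_le _ _).trans (add_le_add (hMD _ hz) (hMD _ (hgD z)))) 2
  have hr : IntegrableOn (fun z : ℝ × ℝ => ‖residual U f g z‖ ^ 2)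
      (Ioo (0 : ℝ) 1 ×ˢ Ioo 0 s) := by
    refine integrableOn_box_of_bound (M := MR ^ 2) ?_ (ae_of_all _ fun z => ?_)
    · exact ((stronglyMeasurable_residual hsys hDU hg.continuous
        hgD).aestronglyMeasurable.norm.pow 2)
    · rw [Real.norm_of_nonneg (sq_nonneg _)]
      exact pow_le_pow_left₀ (norm_nonneg _) (hMR z) 2
  have hsε : 0 ≤ s - ε := by linarith
  obtain ⟨hint, hmain⟩ := relative_entropy_inequality hsys hu hDU hD hDc huD hu₀D hg hgper hgD
    (lipschitzWith_ramp s hε) (ramp_nonneg s ε) (ramp_le_one s ε) (fun t ht => ramp_eq_zero hε ht)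
  -- Integrable majorants: on `(s-ε, s)` the slope `-1/ε` turns the lower bound for the relative
  -- entropy into an upper bound for the integrand, and on `(0, s)` the production is bounded with
  -- `0 ≤ χ ≤ 1`.
  have i1 : Integrable (fun z => -(Clo / 2 * (1 / ε)) * indicator (Ioo (0 : ℝ) 1 ×ˢ Ioo (s - ε) s)
      (fun z : ℝ × ℝ => ‖u z.1 z.2 - g z‖ ^ 2) z) strip :=
    (integrable_strip_indicator (hSm _) (hS _ hsε) (hw _ hsε)).const_mul _
  have i2 : Integrable (fun z => 1 / 2 * indicator (Ioo (0 : ℝ) 1 ×ˢ Ioo 0 s)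
      (fun z : ℝ × ℝ => (Cf * Chi * N + Chi ^ 2) * ‖u z.1 z.2 - g z‖ ^ 2
        + ‖residual U f g z‖ ^ 2) z) strip :=
    (integrable_strip_indicator (hSm _) (hS _ le_rfl)
      (((hw 0 le_rfl).const_mul _).add hr)).const_mul _
  have hN' : ∀ᵐ z ∂strip, z ∈ Ioo (0 : ℝ) 1 ×ˢ Ioo 0 s → ‖partialX g z‖ ≤ N :=
    ae_restrict_of_ae ((ae_restrict_iff' (hSm 0)).1 hN)
  have hle := integral_mono_ae hint (i1.add i2) (by
    filter_upwards [huD, ae_strip_of_ae_time (ae_deriv_ramp (s := s) hε), hN',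
      ae_restrict_mem (measurableSet_Ioo.prod measurableSet_Ioi)] with z hz hd hNz hmem
    simp only [Pi.add_apply]
    have hP0 : z.2 < s → -(ramp s ε z.2 * relProduction U f η g u z)
        ≤ 1 / 2 * indicator (Ioo (0 : ℝ) 1 ×ˢ Ioo 0 s)
      (fun z : ℝ × ℝ => (Cf * Chi * N + Chi ^ 2) * ‖u z.1 z.2 - g z‖ ^ 2
        + ‖residual U f g z‖ ^ 2) z := by
      intro hzs
      have hz0 : z ∈ Ioo (0 : ℝ) 1 ×ˢ Ioo 0 s := ⟨hmem.1, hmem.2, hzs⟩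
      rw [indicator_of_mem hz0]
      have hP := abs_relProduction_le hsys hb hDU hDc hClo hChi (hgD z) hz (hNz hz0)
      refine le_trans ?_ hP
      rw [← mul_neg]
      refine (mul_le_mul_of_nonneg_left (neg_le_abs _) (ramp_nonneg s ε z.2)).trans ?_
      exact mul_le_of_le_one_left (abs_nonneg _) (ramp_le_one s ε z.2)
    rw [hd]
    by_cases h1 : z.2 ∈ Ioo (s - ε) s
    · rw [indicator_of_mem h1, indicator_of_mem (show z ∈ Ioo (0 : ℝ) 1 ×ˢ Ioo (s - ε) s from
        ⟨hmem.1, h1⟩)]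
      have hE : Clo / 2 * ‖u z.1 z.2 - g z‖ ^ 2 ≤ relEntropy U η (u z.1 z.2) (g z) :=
        le_relative_entropy hsys hb hDU hDc (hgD z) hz
      have := mul_le_mul_of_nonneg_left hE (one_div_pos.2 hε).le
      have := hP0 h1.2
      linarith
    · rw [indicator_of_notMem h1, indicator_of_notMem (fun h => h1 h.2)]
      by_cases h2 : z.2 < s
      · have := hP0 h2
        linarith
      · rw [ramp_eq_zero hε (not_lt.1 h2), indicator_of_notMem (fun h => h2 h.2.2)]
        simp)
  -- Since `ε ≤ s`, the cutoff equals 1 at time zero. The quadratic upper bound on the relative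
  -- entropy requires `u₀` to lie in `D`.
  have hinit : ∫ x in Ioo (0 : ℝ) 1, ramp s ε 0 * relEntropy U η (u₀ x) (g (x, 0))
      ≤ ∫ x in Ioo (0 : ℝ) 1, Chi / 2 * ‖u₀ x - g (x, 0)‖ ^ 2 := by
    rw [ramp_eq_one hε hsε]
    refine integral_mono_of_nonneg ?_ ?_ ?_
    · filter_upwards [hu₀D] with x hx
      rw [one_mul]
      exact (mul_nonneg (by linarith) (sq_nonneg _)).trans
        (le_relative_entropy hsys hb hDU hDc (hgD (x, 0)) hx)
    · refine Integrable.const_mul (Integrable.of_bound (C := (MD + MD) ^ 2)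
        ((hu.init_measurable.sub (hg.continuous.comp
          (continuous_id.prodMk continuous_const)).aestronglyMeasurable).norm.pow 2) ?_) _
      filter_upwards [hu₀D] with x hx
      simp only [Pi.pow_apply, Pi.sub_apply]
      rw [Real.norm_of_nonneg (sq_nonneg _)]
      exact pow_le_pow_left₀ (norm_nonneg _)
        ((norm_sub_le _ _).trans (add_le_add (hMD _ hx) (hMD _ (hgD _)))) 2
    · filter_upwards [hu₀D] with x hx
      rw [one_mul]
      exact relative_entropy_le hsys hb hDU hDc (hgD (x, 0)) hx
  have hsum := integral_add i1 i2
  simp only [Pi.add_apply] at hle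
  rw [hsum, integral_const_mul, integral_const_mul, integral_strip_indicator (hSm _) (hS _ hsε),
    integral_strip_indicator (hSm _) (hS _ le_rfl),
    integral_add ((hw 0 le_rfl).const_mul _) hr, integral_const_mul] at hle
  rw [integral_const_mul (Chi / 2)] at hinit
  linarith

end Energy
end ConsLaw

/-! ### Mass balance on space-time boxes. -/

namespace ConsLaw

noncomputable section BoxIdentity

open Filter Topology

/-- The periodic extension of a Lipschitz function on `[0,1]` with matching end values is
Lipschitz. -/
lemma lipschitzWith_comp_fract {E : Type*} [PseudoMetricSpace E] {h : ℝ → E} {K : NNReal}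
    (hh : LipschitzOnWith K h (Icc 0 1)) (h01 : h 0 = h 1) :
    LipschitzWith K (fun x => h (Int.fract x)) := by
  have hmem : ∀ x : ℝ, Int.fract x ∈ Icc (0 : ℝ) 1 := fun x =>
    ⟨Int.fract_nonneg x, (Int.fract_lt_one x).le⟩
  have key : ∀ x y : ℝ, x ≤ y → dist (h (Int.fract x)) (h (Int.fract y)) ≤ K * dist x y := by
    intro x y hxy
    have hx := Int.floor_add_fract x
    have hy := Int.floor_add_fract y
    rw [dist_comm x y, Real.dist_eq, abs_of_nonneg (sub_nonneg.2 hxy)]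
    rcases (Int.floor_le_floor hxy).eq_or_lt with hfl | hfl
    · refine (hh.dist_le_mul _ (hmem x) _ (hmem y)).trans (le_of_eq ?_)
      have : (⌊x⌋ : ℝ) = ⌊y⌋ := by rw [hfl]
      rw [dist_comm, Real.dist_eq, abs_of_nonneg (by linarith)]
      congr 1
      linarith
    -- When the integer parts differ, pass through the common value `h 1 = h 0`; the distances to it
    -- satisfy `(1 - fract x) + fract y ≤ y - x`.
    · have h1 := hh.dist_le_mul _ (hmem x) _ (right_mem_Icc.2 zero_le_one)
      have h2 := hh.dist_le_mul _ (left_mem_Icc.2 zero_le_one) _ (hmem y)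
      rw [dist_comm (Int.fract x), Real.dist_eq, abs_of_nonneg (by linarith [(hmem x).2])] at h1
      rw [dist_comm 0, Real.dist_eq, abs_of_nonneg (by linarith [(hmem y).1])] at h2
      have h3 : (⌊x⌋ : ℝ) + 1 ≤ ⌊y⌋ := by exact_mod_cast hfl
      refine (dist_triangle _ (h 1) _).trans ?_
      rw [← h01] at h1 ⊢
      have h4 : (K : ℝ) * (1 - Int.fract x) + K * (Int.fract y - 0) ≤ K * (y - x) := by
        rw [← mul_add]
        exact mul_le_mul_of_nonneg_left (by linarith) K.2
      linarith
  refine LipschitzWith.of_dist_le_mul fun x y => ?_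
  rcases le_total x y with hxy | hxy
  · exact key x y hxy
  · rw [dist_comm, dist_comm x]
    exact key y x hxy

/-- A trapezoidal approximation of the indicator function of `(a, b)`. -/
def trapezoid (a b δ x : ℝ) : ℝ := ramp b δ x - ramp (a + δ) δ x

lemma norm_trapezoid_le (a b δ x : ℝ) : ‖trapezoid a b δ x‖ ≤ 1 := by
  rw [Real.norm_eq_abs, abs_le, trapezoid]
  have h1 := ramp_nonneg b δ x
  have h2 := ramp_le_one b δ x
  have h3 := ramp_nonneg (a + δ) δ x
  have h4 := ramp_le_one (a + δ) δ x
  exact ⟨by linarith, by linarith⟩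

lemma exists_lipschitzWith_trapezoid (a b : ℝ) {δ : ℝ} (hδ : 0 < δ) :
    ∃ K, LipschitzWith K (trapezoid a b δ) :=
  ⟨_, (lipschitzWith_ramp b hδ).sub (lipschitzWith_ramp (a + δ) hδ)⟩

/-- At each fixed `x` the values are eventually constant as `δ → 0`, equal to 0 at the end points as
well. -/
lemma tendsto_trapezoid (a b : ℝ) (hab : a < b) (x : ℝ) :
    Tendsto (fun δ => trapezoid a b δ x) (𝓝[>] 0) (𝓝 (indicator (Ioo a b) 1 x)) := by
  refine tendsto_const_nhds.congr' ?_
  have hsmall : ∀ c : ℝ, 0 < c → ∀ᶠ δ : ℝ in 𝓝[>] 0, δ < c := fun c hc =>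
    mem_nhdsWithin_of_mem_nhds (gt_mem_nhds hc)
  rcases le_or_gt b x with h1 | h1
  · rw [indicator_of_notMem (fun h => absurd h.2 (not_lt.2 h1))]
    filter_upwards [self_mem_nhdsWithin, hsmall (b - a) (by linarith)] with δ (hδ : 0 < δ) h2
    rw [trapezoid, ramp_eq_zero hδ h1, ramp_eq_zero hδ (by linarith), sub_zero]
  rcases le_or_gt x a with h2 | h2
  · rw [indicator_of_notMem (fun h => absurd h.1 (not_lt.2 h2))]
    filter_upwards [self_mem_nhdsWithin, hsmall (b - x) (by linarith)] with δ (hδ : 0 < δ) h3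
    rw [trapezoid, ramp_eq_one hδ (by linarith), ramp_eq_one hδ (by linarith), sub_self]
  · rw [indicator_of_mem (show x ∈ Ioo a b from ⟨h2, h1⟩)]
    filter_upwards [self_mem_nhdsWithin, hsmall (b - x) (by linarith), hsmall (x - a)
      (by linarith)] with δ (hδ : 0 < δ) h3 h4
    rw [trapezoid, ramp_eq_one hδ (by linarith), ramp_eq_zero hδ (by linarith), sub_zero]
    rfl

/-- The trapezoid rises and falls once, with slope `1/δ` over length `δ`. The 2 counts the end
points of the interval, through each of which flux can leave. -/
lemma integral_abs_deriv_trapezoid_le (a b : ℝ) {δ : ℝ} (hδ : 0 < δ) :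
    Integrable (fun x => |deriv (trapezoid a b δ) x|) (volume.restrict (Ioo 0 1)) ∧
    ∫ x in Ioo (0 : ℝ) 1, |deriv (trapezoid a b δ) x| ≤ 2 := by
  have hae : ∀ᵐ x, |deriv (trapezoid a b δ) x| ≤ indicator (Ioo (b - δ) b) (fun _ => 1 / δ) x
      + indicator (Ioo a (a + δ)) (fun _ => 1 / δ) x := by
    filter_upwards [ae_deriv_ramp (s := b) hδ, ae_deriv_ramp (s := a + δ) hδ,
      (lipschitzWith_ramp b hδ).ae_differentiableAt,
      (lipschitzWith_ramp (a + δ) hδ).ae_differentiableAt] with x h1 h2 h3 h4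
    have : deriv (trapezoid a b δ) x = deriv (ramp b δ) x - deriv (ramp (a + δ) δ) x :=
      deriv_fun_sub h3 h4
    rw [this]
    refine (abs_sub _ _).trans ?_
    rw [h1, h2, add_sub_cancel_right]
    refine add_le_add ?_ ?_
    · by_cases h : x ∈ Ioo (b - δ) b
      · rw [indicator_of_mem h, indicator_of_mem h, abs_neg, abs_of_pos (one_div_pos.2 hδ)]
      · rw [indicator_of_notMem h, indicator_of_notMem h, abs_zero]
    · by_cases h : x ∈ Ioo a (a + δ)
      · rw [indicator_of_mem h, indicator_of_mem h, abs_neg, abs_of_pos (one_div_pos.2 hδ)]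
      · rw [indicator_of_notMem h, indicator_of_notMem h, abs_zero]
  have hi : ∀ c, Integrable (indicator (Ioo c (c + δ)) (fun _ => 1 / δ)) := fun c => by
    rw [integrable_indicator_iff measurableSet_Ioo]
    exact integrableOn_const (by simp)
  have hv : ∀ c, ∫ x, indicator (Ioo c (c + δ)) (fun _ => 1 / δ) x = 1 := fun c => by
    rw [integral_indicator measurableSet_Ioo, setIntegral_const]
    simp [Measure.real, Real.volume_Ioo, hδ.le, hδ.ne']
  have hb : Ioo (b - δ) b = Ioo (b - δ) (b - δ + δ) := by rw [sub_add_cancel]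
  rw [hb] at hae
  have hint := (hi (b - δ)).add (hi a)
  have habs : Integrable (fun x => |deriv (trapezoid a b δ) x|) := by
    refine hint.mono' (measurable_deriv (trapezoid a b δ)).norm.aestronglyMeasurable ?_
    filter_upwards [hae] with x hx
    rw [Real.norm_of_nonneg (abs_nonneg _)]
    exact hx
  refine ⟨habs.integrableOn, ?_⟩
  refine (setIntegral_le_integral habs (ae_of_all _ fun x => abs_nonneg _)).trans ?_
  refine (integral_mono_ae habs hint hae).trans ?_
  have := integral_add (hi (b - δ)) (hi a)
  simp only [Pi.add_apply]
  rw [this, hv, hv]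
  norm_num

variable {d : ℕ} {U D : Set (Vec d)} {f : Vec d → Vec d} {η q : Vec d → ℝ} {u₀ : ℝ → Vec d}
  {u : ℝ → ℝ → Vec d}

lemma norm_le_of_forall_inner_le {V : Vec d} {C : ℝ} (hC : 0 ≤ C)
    (h : ∀ c : Vec d, inner ℝ V c ≤ C * ‖c‖) : ‖V‖ ≤ C := by
  have := h V
  rw [real_inner_self_eq_norm_sq] at this
  rcases (norm_nonneg V).eq_or_lt with h0 | h0
  · rwa [← h0]
  · nlinarith

lemma integrable_deriv_cutoff {χ : ℝ → ℝ} {K : NNReal} (hχ : LipschitzWith K χ) {T : ℝ}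
    (hχT : ∀ t, T ≤ t → χ t = 0) {M : ℝ} (hM : 0 ≤ M) :
    Integrable (fun z : ℝ × ℝ => |deriv χ z.2| * M) strip := by
  refine integrable_strip (C := K * M) (T := T + 1) ?_ (ae_of_all _ fun z => ?_)
    (ae_of_all _ fun z hz => ?_)
  · exact (((measurable_deriv χ).norm.comp measurable_snd).mul_const M).aestronglyMeasurable
  · rw [Real.norm_of_nonneg (by positivity)]
    exact mul_le_mul_of_nonneg_right (norm_deriv_le_of_lipschitz hχ) hM
  · have : χ =ᶠ[𝓝 z.2] fun _ => 0 := by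
      filter_upwards [lt_mem_nhds (show T < z.2 by linarith)] with τ hτ
      exact hχT τ hτ.le
    rw [this.deriv_eq, deriv_const, abs_zero, zero_mul]

/-- The weak formulation, tested with (approximations of) the indicator function of an interval
in space. -/
lemma inner_box_le (hu : IsEntropySolution U f η q u₀ u) (hD : IsCompact D)
    (huD : ∀ᵐ z ∂strip, u z.1 z.2 ∈ D) (hf : ContinuousOn f D) {M : ℝ}
    (hM : ∀ z ∈ D, ‖f z‖ ≤ M) (hM0 : 0 ≤ M) {χ : ℝ → ℝ} {K : NNReal} (hχ : LipschitzWith K χ)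
    {B : ℝ} (hχB : ∀ t, ‖χ t‖ ≤ B) {T : ℝ} (hχT : ∀ t, T ≤ t → χ t = 0)
    (hχi : IntegrableOn (fun t => |χ t|) (Ioi 0))
    {a b : ℝ} (ha : 0 ≤ a) (hab : a < b) (hb : b ≤ 1) (c : Vec d) :
    (∫ z, indicator (Ioo a b) 1 z.1 * (deriv χ z.2 * inner ℝ (u z.1 z.2) c) ∂strip)
      + (∫ x in Ioo (0 : ℝ) 1, indicator (Ioo a b) 1 x * (χ 0 * inner ℝ (u₀ x) c))
      ≤ 2 * M * (∫ t in Ioi (0 : ℝ), |χ t|) * ‖c‖ := by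
  obtain ⟨Mu, hMu⟩ := hD.exists_bound_of_continuousOn (f := fun v : Vec d => v) continuousOn_id
  obtain ⟨M₀, hM₀⟩ := hu.init_bounded
  have hmu : AEStronglyMeasurable (fun z : ℝ × ℝ => u z.1 z.2) strip := hu.measurable
  have hm1 : AEStronglyMeasurable (fun z : ℝ × ℝ => deriv χ z.2 * inner ℝ (u z.1 z.2) c) strip :=
    ((measurable_deriv χ).comp measurable_snd).aestronglyMeasurable.mul
      (hmu.inner aestronglyMeasurable_const)
  have hm2 : AEStronglyMeasurable (fun x : ℝ => χ 0 * inner ℝ (u₀ x) c)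
      (volume.restrict (Ioo 0 1)) :=
    (hu.init_measurable.inner aestronglyMeasurable_const).const_mul _
  have hmt : ∀ δ, 0 < δ → Continuous (trapezoid a b δ) := fun δ hδ =>
    (exists_lipschitzWith_trapezoid a b hδ).choose_spec.continuous
  have lim1 : Tendsto (fun δ => ∫ z, trapezoid a b δ z.1 *
      (deriv χ z.2 * inner ℝ (u z.1 z.2) c) ∂strip) (𝓝[>] 0)
      (𝓝 (∫ z, indicator (Ioo a b) 1 z.1 * (deriv χ z.2 * inner ℝ (u z.1 z.2) c) ∂strip)) := by
    refine tendsto_integral_filter_of_dominated_convergence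
      (fun z => |deriv χ z.2| * (|Mu| * ‖c‖)) ?_ ?_
      (integrable_deriv_cutoff hχ hχT (by positivity)) ?_
    · filter_upwards [self_mem_nhdsWithin] with δ (hδ : 0 < δ)
      exact ((hmt δ hδ).comp continuous_fst).aestronglyMeasurable.mul hm1
    · refine Eventually.of_forall fun δ => ?_
      filter_upwards [huD] with z hz
      rw [norm_mul, norm_mul, ← Real.norm_eq_abs (deriv χ z.2)]
      refine (mul_le_of_le_one_left (by positivity) (norm_trapezoid_le _ _ _ _)).trans ?_
      refine mul_le_mul_of_nonneg_left ((norm_inner_le_norm _ _).trans ?_) (norm_nonneg _)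
      exact mul_le_mul_of_nonneg_right ((hMu _ hz).trans (le_abs_self _)) (norm_nonneg _)
    · exact ae_of_all _ fun z => (tendsto_trapezoid a b hab z.1).mul_const _
  have lim2 : Tendsto (fun δ => ∫ x in Ioo (0 : ℝ) 1, trapezoid a b δ x *
      (χ 0 * inner ℝ (u₀ x) c)) (𝓝[>] 0)
      (𝓝 (∫ x in Ioo (0 : ℝ) 1, indicator (Ioo a b) 1 x * (χ 0 * inner ℝ (u₀ x) c))) := by
    refine tendsto_integral_filter_of_dominated_convergence
      (fun z => B * (M₀ * ‖c‖)) ?_ ?_ (integrable_const _) ?_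
    · filter_upwards [self_mem_nhdsWithin] with δ (hδ : 0 < δ)
      exact (hmt δ hδ).aestronglyMeasurable.mul hm2
    · refine Eventually.of_forall fun δ => ?_
      filter_upwards [hM₀] with x hx
      rw [norm_mul, norm_mul]
      refine (mul_le_of_le_one_left (by positivity) (norm_trapezoid_le _ _ _ _)).trans ?_
      refine mul_le_mul (hχB 0) ((norm_inner_le_norm _ _).trans ?_) (norm_nonneg _)
        ((norm_nonneg _).trans (hχB 0))
      exact mul_le_mul_of_nonneg_right hx (norm_nonneg _)
    · exact ae_of_all _ fun z => (tendsto_trapezoid a b hab z).mul_const _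
  refine le_of_tendsto (lim1.add lim2) ?_
  have hsmall : ∀ c : ℝ, 0 < c → ∀ᶠ δ : ℝ in 𝓝[>] 0, δ < c := fun c hc =>
    mem_nhdsWithin_of_mem_nhds (gt_mem_nhds hc)
  filter_upwards [self_mem_nhdsWithin, hsmall (b - a) (by linarith)] with δ (hδ : 0 < δ) hδ1
  obtain ⟨L, hL⟩ := exists_lipschitzWith_trapezoid a b hδ
  -- The trapezoid vanishes at 0 and 1, even when `a = 0` or `b = 1`, so its periodic extension is
  -- Lipschitz.
  have hends : trapezoid a b δ 0 = trapezoid a b δ 1 := by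
    rw [trapezoid, trapezoid, ramp_eq_one hδ (by linarith), ramp_eq_one hδ (by linarith),
      ramp_eq_zero hδ hb, ramp_eq_zero hδ (by linarith)]
    norm_num
  have hψ := lipschitzWith_comp_fract (hL.lipschitzOnWith (s := Icc 0 1)) hends
  have hχψ := lipschitzWith_smul_of_bounded (A := B.toNNReal) (B := 1)
    (hχ.comp LipschitzWith.prod_snd) (hψ.comp LipschitzWith.prod_fst)
    (fun z : ℝ × ℝ => (hχB z.2).trans (Real.le_coe_toNNReal B))
    (fun z : ℝ × ℝ => by simpa using norm_trapezoid_le a b δ (Int.fract z.1))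
  obtain ⟨K₁, hΦ⟩ : ∃ K₁, LipschitzWith K₁
      (fun z : ℝ × ℝ => (χ z.2 * trapezoid a b δ (Int.fract z.1)) • c) := by
    refine ⟨_, LipschitzWith.of_dist_le_mul (K := ‖c‖₊ * (B.toNNReal * (L * 1) + K * 1 * 1))
      fun z z' => ?_⟩
    rw [dist_eq_norm, ← sub_smul, norm_smul, mul_comm, ← dist_eq_norm]
    push_cast
    rw [mul_assoc]
    exact mul_le_mul_of_nonneg_left (by simpa using hχψ.dist_le_mul z z') (norm_nonneg _)
  have hweak := hu.weakForm_eq_zero hD huD hf hΦ (fun x t => by simp [Int.fract_add_one])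
    (T := T) (fun z hz => by simp [hχT z.2 hz])
  have hT' : ∀ z : ℝ × ℝ, T ≤ z.2 → (χ z.2 * trapezoid a b δ (Int.fract z.1)) • c = 0 :=
    fun z hz => by simp [hχT z.2 hz]
  have hfract : ∀ x ∈ Ioo (0 : ℝ) 1, Int.fract x = x := fun x hx =>
    Int.fract_eq_self.2 ⟨hx.1.le, hx.2⟩
  have hmf := aestronglyMeasurable_comp_of_continuousOn hD.isClosed hf hmu huD
  have i1 : Integrable (fun z : ℝ × ℝ => trapezoid a b δ z.1 *
      (deriv χ z.2 * inner ℝ (u z.1 z.2) c)) strip := by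
    refine (integrable_deriv_cutoff hχ hχT (M := |Mu| * ‖c‖) (by positivity)).mono'
      (((hmt δ hδ).comp continuous_fst).aestronglyMeasurable.mul hm1) ?_
    filter_upwards [huD] with z hz
    rw [norm_mul, norm_mul, ← Real.norm_eq_abs (deriv χ z.2)]
    refine (mul_le_of_le_one_left (by positivity) (norm_trapezoid_le _ _ _ _)).trans ?_
    refine mul_le_mul_of_nonneg_left ((norm_inner_le_norm _ _).trans ?_) (norm_nonneg _)
    exact mul_le_mul_of_nonneg_right ((hMu _ hz).trans (le_abs_self _)) (norm_nonneg _)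
  obtain ⟨htrap, htrap2⟩ := integral_abs_deriv_trapezoid_le a b hδ
  have hprod : Integrable (fun z : ℝ × ℝ => |deriv (trapezoid a b δ) z.1| * |χ z.2|) strip := by
    rw [strip_eq_prod]
    exact htrap.mul_prod hχi
  have hbound : ∀ᵐ z ∂strip, ‖χ z.2 * deriv (trapezoid a b δ) z.1 * inner ℝ (f (u z.1 z.2)) c‖
      ≤ |deriv (trapezoid a b δ) z.1| * |χ z.2| * (M * ‖c‖) := by
    filter_upwards [huD] with z hz
    rw [norm_mul, norm_mul, Real.norm_eq_abs, Real.norm_eq_abs, mul_comm |χ z.2|]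
    refine mul_le_mul_of_nonneg_left ((norm_inner_le_norm _ _).trans ?_) (by positivity)
    exact mul_le_mul_of_nonneg_right (hM _ hz) (norm_nonneg _)
  have i2 : Integrable (fun z : ℝ × ℝ => χ z.2 * deriv (trapezoid a b δ) z.1 *
      inner ℝ (f (u z.1 z.2)) c) strip := by
    refine (hprod.mul_const (M * ‖c‖)).mono' ?_ hbound
    exact ((((hχ.continuous.comp continuous_snd).aestronglyMeasurable)).mul
      ((measurable_deriv (trapezoid a b δ)).comp measurable_fst).aestronglyMeasurable).mul
        (hmf.inner aestronglyMeasurable_const)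
  have hw1 : ∫ z, weakIntegrand (fun z => u z.1 z.2) (fun z => f (u z.1 z.2))
      (fun z : ℝ × ℝ => (χ z.2 * trapezoid a b δ (Int.fract z.1)) • c) z ∂strip
      = (∫ z, trapezoid a b δ z.1 * (deriv χ z.2 * inner ℝ (u z.1 z.2) c) ∂strip)
        + ∫ z, χ z.2 * deriv (trapezoid a b δ) z.1 * inner ℝ (f (u z.1 z.2)) c ∂strip := by
    rw [← integral_add i1 i2]
    refine integral_congr_ae ?_
    filter_upwards [ae_restrict_mem (measurableSet_Ioo.prod measurableSet_Ioi),
      ae_strip_of_ae_time hχ.ae_differentiableAt, ae_restrict_of_ae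
        ((Measure.quasiMeasurePreserving_fst (μ := volume) (ν := volume)).ae
          hL.ae_differentiableAt)] with z hz h1 h2
    have e1 : partialT (fun z : ℝ × ℝ => (χ z.2 * trapezoid a b δ (Int.fract z.1)) • c) z
        = (deriv χ z.2 * trapezoid a b δ z.1) • c := by
      have := (h1.hasDerivAt.mul_const (trapezoid a b δ (Int.fract z.1))).smul_const c
      rw [hfract z.1 hz.1] at this
      simp only [partialT, hfract z.1 hz.1]
      exact this.deriv
    have e2 : partialX (fun z : ℝ × ℝ => (χ z.2 * trapezoid a b δ (Int.fract z.1)) • c) z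
        = (χ z.2 * deriv (trapezoid a b δ) z.1) • c := by
      have := (h2.hasDerivAt.const_mul (χ z.2)).smul_const c
      have hev : (fun y : ℝ => (χ z.2 * trapezoid a b δ (Int.fract y)) • c) =ᶠ[𝓝 z.1]
          fun y => (χ z.2 * trapezoid a b δ y) • c := by
        filter_upwards [Ioo_mem_nhds hz.1.1 hz.1.2] with y hy
        rw [hfract y hy]
      exact hev.deriv_eq.trans this.deriv
    rw [weakIntegrand, e1, e2, inner_smul_right, inner_smul_right]
    ring
  have hw2 : ∫ x in Ioo (0 : ℝ) 1, inner ℝ (u₀ x)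
        ((χ (x, (0 : ℝ)).2 * trapezoid a b δ (Int.fract (x, (0 : ℝ)).1)) • c)
      = ∫ x in Ioo (0 : ℝ) 1, trapezoid a b δ x * (χ 0 * inner ℝ (u₀ x) c) := by
    refine setIntegral_congr_fun measurableSet_Ioo fun x hx => ?_
    simp only [hfract x hx, inner_smul_right]
    ring
  rw [weakForm, hw1, hw2] at hweak
  -- The flux contribution stays bounded as `δ → 0`: `|f| ≤ M`, and the spatial derivative of the
  -- trapezoid has `L¹` norm at most 2 for every `δ`.
  have hfinal : -(∫ z, χ z.2 * deriv (trapezoid a b δ) z.1 * inner ℝ (f (u z.1 z.2)) c ∂strip)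
      ≤ 2 * M * (∫ t in Ioi (0 : ℝ), |χ t|) * ‖c‖ := by
    refine (neg_le_abs _).trans ?_
    rw [← Real.norm_eq_abs]
    refine (norm_integral_le_of_norm_le (hprod.mul_const (M * ‖c‖)) hbound).trans ?_
    rw [integral_mul_const, strip_eq_prod]
    rw [integral_prod_mul (fun x => |deriv (trapezoid a b δ) x|) (fun t => |χ t|)]
    have hpos : 0 ≤ ∫ t in Ioi (0 : ℝ), |χ t| := integral_nonneg fun t => abs_nonneg _
    have := mul_le_mul_of_nonneg_right htrap2 (mul_nonneg hpos (mul_nonneg hM0 (norm_nonneg c)))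
    linarith
  linarith

end BoxIdentity
end ConsLaw

/-! ### The initial data take values in `D`. -/

namespace ConsLaw

noncomputable section InitialData

open Filter Topology

variable {d : ℕ} {U D : Set (Vec d)} {f : Vec d → Vec d} {η q : Vec d → ℝ} {u₀ : ℝ → Vec d}
  {u : ℝ → ℝ → Vec d}

lemma integral_abs_le_of_le_indicator {χ : ℝ → ℝ} (hχ : Continuous χ) {p r : ℝ} (hpr : p ≤ r)
    (h : ∀ t, 0 < t → |χ t| ≤ indicator (Icc p r) (fun _ => 1) t) :
    IntegrableOn (fun t => |χ t|) (Ioi 0) ∧ ∫ t in Ioi (0 : ℝ), |χ t| ≤ r - p := by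
  have hi : Integrable (indicator (Icc p r) (fun _ => (1 : ℝ))) := by
    rw [integrable_indicator_iff measurableSet_Icc]
    exact integrableOn_const (by simp)
  have hae : ∀ᵐ t ∂(volume.restrict (Ioi (0 : ℝ))), |χ t| ≤ indicator (Icc p r) (fun _ => 1) t :=
    (ae_restrict_mem measurableSet_Ioi).mono h
  have hχi : IntegrableOn (fun t => |χ t|) (Ioi 0) :=
    hi.integrableOn.mono' hχ.abs.aestronglyMeasurable (hae.mono fun t ht => by
      rw [Real.norm_of_nonneg (abs_nonneg _)]; exact ht)
  refine ⟨hχi, ?_⟩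
  refine (integral_mono_ae hχi hi.integrableOn hae).trans ?_
  refine (setIntegral_le_integral hi (ae_of_all _ fun x =>
    indicator_nonneg (fun _ _ => zero_le_one) _)).trans ?_
  rw [integral_indicator measurableSet_Icc, setIntegral_const]
  simp [Measure.real, Real.volume_Icc, hpr]

/-- Mass in `(a,b)` changes only through the two end points, at rate at most `M` through each,
during the times `[p,r]` where the cutoff lives. Testing against all directions `c` turns the scalar
inequalities into a norm bound. -/
lemma norm_box_le (hu : IsEntropySolution U f η q u₀ u) (hD : IsCompact D)
    (huD : ∀ᵐ z ∂strip, u z.1 z.2 ∈ D) (hf : ContinuousOn f D) {M : ℝ}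
    (hM : ∀ z ∈ D, ‖f z‖ ≤ M) (hM0 : 0 ≤ M) {χ : ℝ → ℝ} {K : NNReal} (hχ : LipschitzWith K χ)
    (hχB : ∀ t, ‖χ t‖ ≤ 1) {p r : ℝ} (hp : 0 ≤ p) (hpr : p ≤ r)
    (h : ∀ t, 0 < t → |χ t| ≤ indicator (Icc p r) (fun _ => 1) t)
    {a b : ℝ} (ha : 0 ≤ a) (hab : a < b) (hb : b ≤ 1) :
    ‖(∫ z, (indicator (Ioo a b) 1 z.1 * deriv χ z.2) • u z.1 z.2 ∂strip)
      + χ 0 • ∫ x in Ioo a b, u₀ x‖ ≤ 2 * M * (r - p) := by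
  obtain ⟨hχi, hχI⟩ := integral_abs_le_of_le_indicator hχ.continuous hpr h
  obtain ⟨Mu, hMu⟩ := hD.exists_bound_of_continuousOn (f := fun v : Vec d => v) continuousOn_id
  have hmu : AEStronglyMeasurable (fun z : ℝ × ℝ => u z.1 z.2) strip := hu.measurable
  have hχT : ∀ t, r + 1 ≤ t → χ t = 0 := fun t ht => by
    have := h t (by linarith)
    rw [indicator_of_notMem (fun hm => by linarith [hm.2])] at this
    exact abs_nonpos_iff.1 this
  have hind : ∀ x : ℝ, ‖indicator (Ioo a b) (1 : ℝ → ℝ) x‖ ≤ 1 := fun x => by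
    by_cases hx : x ∈ Ioo a b <;> simp [hx]
  have hmi : Measurable (indicator (Ioo a b) (1 : ℝ → ℝ)) :=
    measurable_one.indicator measurableSet_Ioo
  refine norm_le_of_forall_inner_le (by nlinarith) fun c => ?_
  refine le_trans (le_of_eq ?_) ((inner_box_le hu hD huD hf hM hM0 hχ hχB hχT hχi ha hab hb c).trans
    (mul_le_mul_of_nonneg_right (mul_le_mul_of_nonneg_left hχI (by positivity)) (norm_nonneg c)))
  have i1 : Integrable (fun z : ℝ × ℝ =>
      (indicator (Ioo a b) 1 z.1 * deriv χ z.2) • u z.1 z.2) strip := by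
    refine (integrable_deriv_cutoff hχ hχT (abs_nonneg Mu)).mono' ?_ ?_
    · exact ((hmi.comp measurable_fst).mul
        ((measurable_deriv χ).comp measurable_snd)).aestronglyMeasurable.smul hmu
    · filter_upwards [huD] with z hz
      rw [norm_smul, norm_mul, ← Real.norm_eq_abs (deriv χ z.2)]
      exact mul_le_mul (mul_le_of_le_one_left (norm_nonneg _) (hind _))
        ((hMu _ hz).trans (le_abs_self _)) (norm_nonneg _) (norm_nonneg _)
  have i2 : IntegrableOn u₀ (Ioo a b) := by
    obtain ⟨M₀, hM₀⟩ := hu.init_bounded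
    exact (show IntegrableOn u₀ (Ioo 0 1) from
      Integrable.of_bound hu.init_measurable M₀ hM₀).mono_set (Ioo_subset_Ioo ha hb)
  rw [inner_add_left, inner_smul_left, real_inner_comm, ← integral_inner i1, real_inner_comm c,
    ← integral_inner i2]
  congr 1
  · refine integral_congr_ae (ae_of_all _ fun z => ?_)
    simp only [inner_smul_right, real_inner_comm]
    ring
  · rw [conj_trivial, ← integral_const_mul, ← integral_indicator measurableSet_Ioo,
      ← integral_indicator measurableSet_Ioo]
    refine integral_congr_ae (ae_of_all _ fun x => ?_)
    by_cases hx : x ∈ Ioo a b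
    · simp [hx, show x ∈ Ioo (0 : ℝ) 1 from ⟨ha.trans_lt hx.1, hx.2.trans_le hb⟩, real_inner_comm]
    · by_cases hx' : x ∈ Ioo (0 : ℝ) 1 <;> simp [hx, hx']

lemma box_subset {a b p r : ℝ} (ha : 0 ≤ a) (hb : b ≤ 1) (hp : 0 ≤ p) :
    Ioo a b ×ˢ Ioo p r ⊆ Ioo (0 : ℝ) 1 ×ˢ Ioi (0 : ℝ) :=
  prod_mono (Ioo_subset_Ioo ha hb) fun _ ht => hp.trans_lt ht.1

lemma measurableSet_box {a b p r : ℝ} : MeasurableSet (Ioo a b ×ˢ Ioo p r) :=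
  measurableSet_Ioo.prod measurableSet_Ioo

lemma ae_deriv_ramp_smul (s : ℝ) {ε : ℝ} (hε : 0 < ε) (a b : ℝ) (v : ℝ × ℝ → Vec d) :
    ∀ᵐ z ∂strip, (indicator (Ioo a b) 1 z.1 * deriv (ramp s ε) z.2) • v z
      = indicator (Ioo a b ×ˢ Ioo (s - ε) s) (fun z => -(1 / ε) • v z) z := by
  filter_upwards [ae_strip_of_ae_time (ae_deriv_ramp (s := s) hε)] with z hz
  rw [hz]
  by_cases h1 : z.1 ∈ Ioo a b
  · by_cases h2 : z.2 ∈ Ioo (s - ε) s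
    · rw [indicator_of_mem h1, indicator_of_mem h2,
        indicator_of_mem (show z ∈ Ioo a b ×ˢ Ioo (s - ε) s from ⟨h1, h2⟩), Pi.one_apply, one_mul]
    · rw [indicator_of_notMem h2, mul_zero, zero_smul,
        indicator_of_notMem (fun h => h2 h.2)]
  · rw [indicator_of_notMem h1, zero_mul, zero_smul, indicator_of_notMem (fun h => h1 h.1)]

lemma integrableOn_box_solution (hu : IsEntropySolution U f η q u₀ u)
    {a b p r : ℝ} (ha : 0 ≤ a) (hb : b ≤ 1) (hp : 0 ≤ p) :
    IntegrableOn (fun z : ℝ × ℝ => u z.1 z.2) (Ioo a b ×ˢ Ioo p r) := by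
  obtain ⟨M, hM⟩ := hu.bounded
  have hsub : Ioo a b ×ˢ Ioo p r ⊆ Ioo (0 : ℝ) 1 ×ˢ Ioo p r :=
    prod_mono (Ioo_subset_Ioo ha hb) le_rfl
  have hsub' : Ioo (0 : ℝ) 1 ×ˢ Ioo p r ⊆ Ioo (0 : ℝ) 1 ×ˢ Ioi (0 : ℝ) :=
    box_subset le_rfl le_rfl hp
  exact (integrableOn_box_of_bound (M := M)
    (hu.measurable.mono_measure (Measure.restrict_mono hsub' le_rfl))
    (ae_restrict_of_ae_restrict_of_subset hsub' hM)).mono_set hsub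

/-- The cutoff starts at 1 and falls with slope `-1/ε` on `(0, ε)`, so it compares the initial mass
with the time average of the mass just after. -/
lemma norm_initial_sub_average_le (hu : IsEntropySolution U f η q u₀ u) (hD : IsCompact D)
    (huD : ∀ᵐ z ∂strip, u z.1 z.2 ∈ D) (hf : ContinuousOn f D) {M : ℝ}
    (hM : ∀ z ∈ D, ‖f z‖ ≤ M) (hM0 : 0 ≤ M) {ε : ℝ} (hε : 0 < ε)
    {a b : ℝ} (ha : 0 ≤ a) (hab : a < b) (hb : b ≤ 1) :
    ‖(∫ x in Ioo a b, u₀ x) - (1 / ε) • ∫ z in Ioo a b ×ˢ Ioo 0 ε, u z.1 z.2‖ ≤ 2 * M * ε := by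
  have h := norm_box_le hu hD huD hf hM hM0 (lipschitzWith_ramp ε hε)
    (fun t => by rw [Real.norm_of_nonneg (ramp_nonneg _ _ _)]; exact ramp_le_one _ _ _)
    (p := 0) (r := ε) le_rfl hε.le ?_ ha hab hb
  · have hae := ae_deriv_ramp_smul ε hε a b (fun z => u z.1 z.2)
    rw [sub_self] at hae
    rw [integral_congr_ae hae, integral_strip_indicator measurableSet_box
      (box_subset ha hb le_rfl), integral_smul, ramp_eq_one hε (by simp), one_smul] at h
    rw [sub_eq_neg_add, ← neg_smul]
    simpa using h
  · intro t ht
    rw [abs_of_nonneg (ramp_nonneg _ _ _)]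
    by_cases h1 : t ≤ ε
    · rw [indicator_of_mem (show t ∈ Icc 0 ε from ⟨ht.le, h1⟩)]
      exact ramp_le_one _ _ _
    · rw [ramp_eq_zero hε (le_of_lt (not_le.1 h1))]
      exact indicator_nonneg (fun _ _ => zero_le_one) _

/-- The cutoff is a difference of two ramps: it vanishes at time zero, rises on `(t, t+ε)` and falls
on `(t', t'+ε)`, so the initial data drop out. With `t' - t` in place of `t`, the right side becomes
a Lipschitz bound as `ε → 0`. -/
lemma norm_average_sub_average_le (hu : IsEntropySolution U f η q u₀ u) (hD : IsCompact D)
    (huD : ∀ᵐ z ∂strip, u z.1 z.2 ∈ D) (hf : ContinuousOn f D) {M : ℝ}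
    (hM : ∀ z ∈ D, ‖f z‖ ≤ M) (hM0 : 0 ≤ M) {ε : ℝ} (hε : 0 < ε)
    {a b : ℝ} (ha : 0 ≤ a) (hab : a < b) (hb : b ≤ 1) {t t' : ℝ} (ht : 0 < t) (htt' : t ≤ t') :
    ‖(1 / ε) • (∫ z in Ioo a b ×ˢ Ioo t (t + ε), u z.1 z.2)
      - (1 / ε) • ∫ z in Ioo a b ×ˢ Ioo t' (t' + ε), u z.1 z.2‖ ≤ 2 * M * (t' + ε - t) := by
  have h := norm_box_le hu hD huD hf hM hM0
    ((lipschitzWith_ramp (t' + ε) hε).sub (lipschitzWith_ramp (t + ε) hε))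
    (fun τ => by
      rw [Real.norm_eq_abs, abs_le]
      constructor <;> linarith [ramp_nonneg (t' + ε) ε τ, ramp_le_one (t' + ε) ε τ,
        ramp_nonneg (t + ε) ε τ, ramp_le_one (t + ε) ε τ])
    (p := t) (r := t' + ε) ht.le (by linarith) ?_ ha hab hb
  · have hae : ∀ᵐ z ∂strip, (indicator (Ioo a b) 1 z.1 *
        deriv (fun τ => ramp (t' + ε) ε τ - ramp (t + ε) ε τ) z.2) • u z.1 z.2
        = indicator (Ioo a b ×ˢ Ioo t' (t' + ε)) (fun z => -(1 / ε) • u z.1 z.2) z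
          - indicator (Ioo a b ×ˢ Ioo t (t + ε)) (fun z => -(1 / ε) • u z.1 z.2) z := by
      have h1 := ae_deriv_ramp_smul (t' + ε) hε a b (fun z => u z.1 z.2)
      have h2 := ae_deriv_ramp_smul (t + ε) hε a b (fun z => u z.1 z.2)
      rw [add_sub_cancel_right] at h1 h2
      filter_upwards [h1, h2,
        ae_strip_of_ae_time (lipschitzWith_ramp (t' + ε) hε).ae_differentiableAt,
        ae_strip_of_ae_time (lipschitzWith_ramp (t + ε) hε).ae_differentiableAt] with z h1 h2 h3 h4
      rw [← h1, ← h2, ← sub_smul, ← mul_sub, deriv_fun_sub h3 h4]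
    have i1 := integrable_strip_indicator measurableSet_box (box_subset (r := t' + ε) ha hb
      (ht.le.trans htt'))
      ((integrableOn_box_solution hu (r := t' + ε) ha hb (ht.le.trans htt')).smul (-(1 / ε)))
    have i2 := integrable_strip_indicator measurableSet_box (box_subset (r := t + ε) ha hb ht.le)
      ((integrableOn_box_solution hu (r := t + ε) ha hb ht.le).smul (-(1 / ε)))
    have hsub := integral_sub i1 i2
    simp only [Pi.smul_def] at hsub
    rw [integral_congr_ae hae, hsub, integral_strip_indicator measurableSet_box
      (box_subset ha hb (ht.le.trans htt')), integral_strip_indicator measurableSet_box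
      (box_subset ha hb ht.le), integral_smul, integral_smul, ramp_eq_one hε (by linarith),
      ramp_eq_one hε (by linarith), sub_self, zero_smul, add_zero, neg_smul, neg_smul,
      neg_sub_neg] at h
    exact h
  · intro τ _
    by_cases hτ : τ ∈ Icc t (t' + ε)
    · rw [indicator_of_mem hτ, abs_le]
      constructor <;> linarith [ramp_nonneg (t' + ε) ε τ, ramp_le_one (t' + ε) ε τ,
        ramp_nonneg (t + ε) ε τ, ramp_le_one (t + ε) ε τ]
    · rw [indicator_of_notMem hτ]
      rcases lt_or_ge τ t with h1 | h1
      · rw [ramp_eq_one hε (by linarith), ramp_eq_one hε (by linarith), sub_self, abs_zero]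
      · have h2 : t' + ε < τ := not_le.1 fun h => hτ ⟨h1, h⟩
        rw [ramp_eq_zero hε h2.le, ramp_eq_zero hε (by linarith), sub_self, abs_zero]

/-- Averages of `u` over boxes lie in the closed convex set `D`, and they converge to the average of
`u₀` as the height of the box shrinks. -/
lemma average_initial_mem (hu : IsEntropySolution U f η q u₀ u) (hD : IsCompact D)
    (hDc : Convex ℝ D) (huD : ∀ᵐ z ∂strip, u z.1 z.2 ∈ D) (hf : ContinuousOn f D)
    {a b : ℝ} (ha : 0 ≤ a) (hab : a < b) (hb : b ≤ 1) :
    (b - a)⁻¹ • ∫ x in Ioo a b, u₀ x ∈ D := by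
  obtain ⟨M, hM⟩ := hD.exists_bound_of_continuousOn hf
  have hba : 0 < b - a := sub_pos.2 hab
  have hlim : Tendsto (fun ε : ℝ => (b - a)⁻¹ • (1 / ε) • ∫ z in Ioo a b ×ˢ Ioo 0 ε, u z.1 z.2)
      (𝓝[>] 0) (𝓝 ((b - a)⁻¹ • ∫ x in Ioo a b, u₀ x)) := by
    refine Tendsto.const_smul ?_ _
    rw [tendsto_iff_norm_sub_tendsto_zero]
    have h0 : Tendsto (fun ε : ℝ => 2 * |M| * ε) (𝓝[>] 0) (𝓝 0) := by
      have : Tendsto (fun ε : ℝ => 2 * |M| * ε) (𝓝 0) (𝓝 (2 * |M| * 0)) :=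
        (continuous_const.mul continuous_id).tendsto 0
      rw [mul_zero] at this
      exact this.mono_left nhdsWithin_le_nhds
    refine squeeze_zero' (Eventually.of_forall fun _ => norm_nonneg _) ?_ h0
    filter_upwards [self_mem_nhdsWithin] with ε (hε : 0 < ε)
    rw [norm_sub_rev]
    exact norm_initial_sub_average_le hu hD huD hf (fun z hz => (hM z hz).trans (le_abs_self M))
      (abs_nonneg M) hε ha hab hb
  refine hD.isClosed.mem_of_tendsto hlim ?_
  filter_upwards [self_mem_nhdsWithin] with ε (hε : 0 < ε)
  have hvol : volume (Ioo a b ×ˢ Ioo 0 ε) = ENNReal.ofReal ((b - a) * ε) := by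
    rw [Measure.volume_eq_prod, Measure.prod_prod, Real.volume_Ioo, Real.volume_Ioo, sub_zero,
      ENNReal.ofReal_mul hba.le]
  have hpos : 0 < (b - a) * ε := mul_pos hba hε
  have := hDc.set_average_mem (μ := volume) (t := Ioo a b ×ˢ Ioo 0 ε)
    (f := fun z : ℝ × ℝ => u z.1 z.2) hD.isClosed (by rw [hvol]; simpa using hpos)
    (by rw [hvol]; exact ENNReal.ofReal_ne_top)
    (ae_restrict_of_ae_restrict_of_subset (box_subset ha hb le_rfl) huD)
    (integrableOn_box_solution hu ha hb le_rfl)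
  rw [setAverage_eq, Measure.real, hvol, ENNReal.toReal_ofReal hpos.le] at this
  rw [smul_smul, one_div, ← mul_inv]
  exact this

/-- The initial data inherit the bounds of the solution. -/
theorem initial_mem (hu : IsEntropySolution U f η q u₀ u) (hD : IsCompact D)
    (hDc : Convex ℝ D) (huD : ∀ᵐ z ∂strip, u z.1 z.2 ∈ D) (hf : ContinuousOn f D) :
    ∀ᵐ x ∂(volume.restrict (Ioo (0 : ℝ) 1)), u₀ x ∈ D := by
  have hint : IntervalIntegrable u₀ volume 0 1 := by
    obtain ⟨M₀, hM₀⟩ := hu.init_bounded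
    rw [intervalIntegrable_iff_integrableOn_Ioo_of_le zero_le_one]
    exact Integrable.of_bound hu.init_measurable M₀ hM₀
  rw [ae_restrict_iff' measurableSet_Ioo]
  -- Lebesgue differentiation: at almost every `x`, `u₀ x` is the limit of its averages over `(x,
  -- x+h)`, and `D` is closed.
  filter_upwards [hint.ae_hasDerivAt_integral] with x hx hx01
  have hmem : x ∈ uIcc (0 : ℝ) 1 := by
    rw [uIcc_of_le zero_le_one]; exact ⟨hx01.1.le, hx01.2.le⟩
  have hlim := (hx hmem 0 left_mem_uIcc).tendsto_slope_zero_right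
  refine hD.isClosed.mem_of_tendsto hlim ?_
  filter_upwards [self_mem_nhdsWithin, mem_nhdsWithin_of_mem_nhds
    (gt_mem_nhds (show 0 < 1 - x by linarith [hx01.2]))] with h (hh : 0 < h) hh1
  have hsub : ∀ {p r : ℝ}, 0 ≤ p → p ≤ r → r ≤ 1 → IntervalIntegrable u₀ volume p r :=
    fun hp hpr hr => hint.mono_set (by
      rw [uIcc_of_le zero_le_one, uIcc_of_le hpr]; exact Icc_subset_Icc hp hr)
  rw [intervalIntegral.integral_interval_sub_left (hsub le_rfl (by linarith [hx01.1])
    (by linarith)) (hsub le_rfl hx01.1.le hx01.2.le)]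
  rw [intervalIntegral.integral_of_le (by linarith), integral_Ioc_eq_integral_Ioo]
  have := average_initial_mem hu hD hDc huD hf (a := x) (b := x + h) hx01.1.le (by linarith)
    (by linarith)
  rwa [add_sub_cancel_left] at this

end InitialData
end ConsLaw

/-! ### A Lipschitz potential for the solution. -/

namespace ConsLaw

noncomputable section Representative

open Filter Topology

variable {d : ℕ} {U D : Set (Vec d)} {f : Vec d → Vec d} {η q : Vec d → ℝ} {u₀ : ℝ → Vec d}
  {u : ℝ → ℝ → Vec d}

/-- Bounds and measurability everywhere, rather than almost everywhere, make every time slice and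
its primitive well behaved. -/
lemma exists_bounded_modification (hu : IsEntropySolution U f η q u₀ u) :
    ∃ (u' : ℝ × ℝ → Vec d) (M : ℝ), 0 ≤ M ∧ StronglyMeasurable u' ∧ (∀ z, ‖u' z‖ ≤ M) ∧
      ∀ᵐ z ∂strip, u' z = u z.1 z.2 := by
  obtain ⟨M, hM⟩ := hu.bounded
  have hm : AEStronglyMeasurable (fun z : ℝ × ℝ => u z.1 z.2) strip := hu.measurable
  have hS : MeasurableSet {z | ‖hm.mk _ z‖ ≤ |M|} :=
    measurableSet_le hm.stronglyMeasurable_mk.norm.measurable measurable_const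
  refine ⟨indicator {z | ‖hm.mk _ z‖ ≤ |M|} (hm.mk _), |M|, abs_nonneg M,
    hm.stronglyMeasurable_mk.indicator hS, fun z => ?_, ?_⟩
  · by_cases hz : z ∈ {z | ‖hm.mk _ z‖ ≤ |M|}
    · rw [indicator_of_mem hz]; exact hz
    · rw [indicator_of_notMem hz, norm_zero]; exact abs_nonneg M
  · filter_upwards [hm.ae_eq_mk, hM] with z h1 h2
    rw [indicator_of_mem, ← h1]
    change ‖hm.mk _ z‖ ≤ |M|
    rw [← h1]
    exact h2.trans (le_abs_self M)

/-- The primitive in space of a function of `(x, t)`. -/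
def primitiveX (v : ℝ × ℝ → Vec d) (x t : ℝ) : Vec d := ∫ y in (0 : ℝ)..x, v (y, t)

lemma integral_primitiveX {v : ℝ × ℝ → Vec d} {M : ℝ} (hv : StronglyMeasurable v)
    (hM : ∀ z, ‖v z‖ ≤ M) {b t r : ℝ} (hb : 0 ≤ b) (htr : t ≤ r) :
    ∫ τ in t..r, primitiveX v b τ = ∫ z in Ioo 0 b ×ˢ Ioo t r, v z := by
  have hfin : volume (Ioo 0 b ×ˢ Ioo t r) < ⊤ := by
    rw [Measure.volume_eq_prod, Measure.prod_prod]
    exact ENNReal.mul_lt_top (by simp) (by simp)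
  have hi : IntegrableOn v (Ioo 0 b ×ˢ Ioo t r) := by
    have : IsFiniteMeasure (volume.restrict (Ioo 0 b ×ˢ Ioo t r)) :=
      ⟨by rwa [Measure.restrict_apply_univ]⟩
    exact Integrable.of_bound hv.aestronglyMeasurable M (ae_of_all _ hM)
  rw [IntegrableOn, Measure.volume_eq_prod, ← Measure.prod_restrict] at hi
  rw [Measure.volume_eq_prod, ← Measure.prod_restrict, integral_prod_symm _ hi,
    intervalIntegral.integral_of_le htr, integral_Ioc_eq_integral_Ioo]
  refine setIntegral_congr_fun measurableSet_Ioo fun τ _ => ?_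
  simp only [primitiveX]
  rw [intervalIntegral.integral_of_le hb, integral_Ioc_eq_integral_Ioo]

lemma intervalIntegrable_slice {v : ℝ × ℝ → Vec d} {M : ℝ} (hv : StronglyMeasurable v)
    (hM : ∀ z, ‖v z‖ ≤ M) (t a b : ℝ) : IntervalIntegrable (fun y => v (y, t)) volume a b := by
  rw [intervalIntegrable_iff]
  have : IsFiniteMeasure (volume.restrict (uIoc a b)) :=
    ⟨by rw [Measure.restrict_apply_univ]; exact measure_Ioc_lt_top⟩
  exact Integrable.of_bound (hv.comp_measurable measurable_prodMk_right).aestronglyMeasurable M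
    (ae_of_all _ fun y => hM _)

lemma norm_primitiveX_sub_le {v : ℝ × ℝ → Vec d} {M : ℝ} (hv : StronglyMeasurable v)
    (hM : ∀ z, ‖v z‖ ≤ M) (x y t : ℝ) :
    ‖primitiveX v x t - primitiveX v y t‖ ≤ M * |x - y| := by
  rw [primitiveX, primitiveX, intervalIntegral.integral_interval_sub_left
    (intervalIntegrable_slice hv hM t _ _) (intervalIntegrable_slice hv hM t _ _)]
  exact intervalIntegral.norm_integral_le_of_norm_le_const fun z _ => hM _

lemma locallyIntegrable_primitiveX {v : ℝ × ℝ → Vec d} {M : ℝ} (hv : StronglyMeasurable v)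
    (hM : ∀ z, ‖v z‖ ≤ M) (b : ℝ) : LocallyIntegrable (primitiveX v b) := by
  have hm : StronglyMeasurable (primitiveX v b) := by
    have : primitiveX v b = fun t => (∫ y in Ioc 0 b, v (y, t)) - ∫ y in Ioc b 0, v (y, t) := rfl
    rw [this]
    exact (hv.integral_prod_left' (μ := volume.restrict (Ioc 0 b))).sub
      (hv.integral_prod_left' (μ := volume.restrict (Ioc b 0)))
  refine MemLp.locallyIntegrable (p := ⊤) (memLp_top_of_bound hm.aestronglyMeasurable (M * |b - 0|)
    (ae_of_all _ fun t => ?_)) le_top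
  have := norm_primitiveX_sub_le hv hM b 0 t
  simpa [primitiveX] using this

/-- The primitive at `b` is the mass in `(0,b)`, whose rate of change is bounded by the flux through
the two ends. At times where the time integral of the primitive has the expected derivative, the
averages over `(t, t+ε)` converge to the value at `t`. -/
lemma norm_primitiveX_sub_time_le (hu : IsEntropySolution U f η q u₀ u) (hD : IsCompact D)
    (huD : ∀ᵐ z ∂strip, u z.1 z.2 ∈ D) (hf : ContinuousOn f D) {M : ℝ}
    (hM : ∀ z ∈ D, ‖f z‖ ≤ M) (hM0 : 0 ≤ M) {v : ℝ × ℝ → Vec d} {M' : ℝ}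
    (hv : StronglyMeasurable v) (hvM : ∀ z, ‖v z‖ ≤ M') (hvu : ∀ᵐ z ∂strip, v z = u z.1 z.2)
    {b : ℝ} (hb0 : 0 ≤ b) (hb1 : b ≤ 1) {t t' : ℝ} (ht : 0 < t) (htt' : t ≤ t')
    (hd : HasDerivAt (fun r => ∫ τ in (0 : ℝ)..r, primitiveX v b τ) (primitiveX v b t) t)
    (hd' : HasDerivAt (fun r => ∫ τ in (0 : ℝ)..r, primitiveX v b τ) (primitiveX v b t') t') :
    ‖primitiveX v b t - primitiveX v b t'‖ ≤ 2 * M * (t' - t) := by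
  rcases hb0.eq_or_lt with rfl | hb
  · simp only [primitiveX, intervalIntegral.integral_same, sub_self, norm_zero]
    have : 0 ≤ t' - t := sub_nonneg.2 htt'
    positivity
  have hrw : ∀ t, 0 < t → ∀ ε : ℝ, 0 < ε → ε⁻¹ • ((∫ τ in (0 : ℝ)..(t + ε), primitiveX v b τ)
      - ∫ τ in (0 : ℝ)..t, primitiveX v b τ)
      = (1 / ε) • ∫ z in Ioo 0 b ×ˢ Ioo t (t + ε), u z.1 z.2 := by
    intro t ht ε hε
    have hi : ∀ p r, IntervalIntegrable (primitiveX v b) volume p r := fun p r =>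
      intervalIntegrable_iff.2
        (((locallyIntegrable_primitiveX hv hvM b).integrableOn_isCompact
          isCompact_uIcc).mono_set uIoc_subset_uIcc)
    rw [intervalIntegral.integral_interval_sub_left (hi _ _) (hi _ _),
      integral_primitiveX hv hvM hb.le (by linarith), one_div]
    congr 1
    exact integral_congr_ae (ae_restrict_of_ae_restrict_of_subset
      (box_subset le_rfl hb1 ht.le) hvu)
  have hlim := (hd.tendsto_slope_zero_right.sub hd'.tendsto_slope_zero_right).norm
  have hlim2 : Tendsto (fun ε : ℝ => 2 * M * (t' + ε - t)) (𝓝[>] 0) (𝓝 (2 * M * (t' - t))) := by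
    have : Tendsto (fun ε : ℝ => 2 * M * (t' + ε - t)) (𝓝 0) (𝓝 (2 * M * (t' + 0 - t))) :=
      Continuous.tendsto (by fun_prop) 0
    rw [add_zero] at this
    exact this.mono_left nhdsWithin_le_nhds
  refine le_of_tendsto_of_tendsto hlim hlim2 ?_
  filter_upwards [self_mem_nhdsWithin] with ε (hε : 0 < ε)
  rw [hrw t ht ε hε, hrw t' (ht.trans_le htt') ε hε]
  exact norm_average_sub_average_le hu hD huD hf hM hM0 hε le_rfl hb hb1 ht htt'

/-- There is a Lipschitz function whose derivative in space is the solution. -/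
lemma exists_lipschitz_potential (hu : IsEntropySolution U f η q u₀ u) (hD : IsCompact D)
    (huD : ∀ᵐ z ∂strip, u z.1 z.2 ∈ D) (hf : ContinuousOn f D) {v : ℝ × ℝ → Vec d} {M' : ℝ}
    (hM'0 : 0 ≤ M')
    (hv : StronglyMeasurable v) (hvM : ∀ z, ‖v z‖ ≤ M') (hvu : ∀ᵐ z ∂strip, v z = u z.1 z.2) :
    ∃ (W : ℝ × ℝ → Vec d) (K : NNReal), LipschitzWith K W ∧
      ∀ᵐ t ∂(volume.restrict (Ioi (0 : ℝ))), ∀ x ∈ Ioo (0 : ℝ) 1, W (x, t) = primitiveX v x t := by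
  obtain ⟨M, hM⟩ := hD.exists_bound_of_continuousOn hf
  -- Countably many `x` keep the exceptional set of times null, while rationals are dense enough to
  -- determine the primitive, which is Lipschitz in `x` at every time.
  set good : Set ℝ := {t | 0 < t ∧ ∀ r : ℚ,
    HasDerivAt (fun s => ∫ τ in (0 : ℝ)..s, primitiveX v r τ) (primitiveX v r t) t} with hgood
  set S : Set (ℝ × ℝ) := {z | (∃ r : ℚ, (r : ℝ) = z.1 ∧ z.1 ∈ Icc (0 : ℝ) 1) ∧ z.2 ∈ good} with hS
  have hfM : ∀ z ∈ D, ‖f z‖ ≤ |M| := fun z hz => (hM z hz).trans (le_abs_self M)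
  have htime : ∀ r : ℚ, (r : ℝ) ∈ Icc (0 : ℝ) 1 → ∀ t ∈ good, ∀ t' ∈ good,
      ‖primitiveX v r t - primitiveX v r t'‖ ≤ 2 * |M| * |t - t'| := by
    intro r hr t ht t' ht'
    rcases le_total t t' with h | h
    · rw [abs_sub_comm, abs_of_nonneg (sub_nonneg.2 h)]
      exact norm_primitiveX_sub_time_le hu hD huD hf hfM (abs_nonneg M) hv hvM hvu hr.1 hr.2 ht.1 h
        (ht.2 r) (ht'.2 r)
    · rw [norm_sub_rev, abs_of_nonneg (sub_nonneg.2 h)]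
      exact norm_primitiveX_sub_time_le hu hD huD hf hfM (abs_nonneg M) hv hvM hvu hr.1 hr.2 ht'.1 h
        (ht'.2 r) (ht.2 r)
  have hL : LipschitzOnWith (M' + 2 * |M|).toNNReal (fun z => primitiveX v z.1 z.2) S := by
    refine LipschitzOnWith.of_dist_le_mul fun z hz z' hz' => ?_
    obtain ⟨⟨r, hr, hr01⟩, hzt⟩ := hz
    obtain ⟨⟨r', hr', hr01'⟩, hzt'⟩ := hz'
    rw [Real.coe_toNNReal _ (by positivity), dist_eq_norm, add_mul]
    have h1 := norm_primitiveX_sub_le hv hvM z.1 z'.1 z.2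
    have h2 := htime r' (by rw [hr']; exact hr01') z.2 hzt z'.2 hzt'
    rw [hr'] at h2
    have h3 : |z.1 - z'.1| ≤ dist z z' := le_max_left _ _
    have h4 : |z.2 - z'.2| ≤ dist z z' := le_max_right _ _
    have h5 : primitiveX v z.1 z.2 - primitiveX v z'.1 z'.2
        = (primitiveX v z.1 z.2 - primitiveX v z'.1 z.2)
          + (primitiveX v z'.1 z.2 - primitiveX v z'.1 z'.2) := by abel
    rw [h5]
    exact (norm_add_le _ _).trans (add_le_add
      (h1.trans (mul_le_mul_of_nonneg_left h3 hM'0))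
      (h2.trans (mul_le_mul_of_nonneg_left h4 (by positivity))))
  -- Lipschitz in `x` at all times and Lipschitz in `t` at good times, uniformly, gives a jointly
  -- Lipschitz function on the good set, which extends to the whole plane.
  obtain ⟨W, hW, hWS⟩ := hL.extend_finite_dimension
  refine ⟨W, _, hW, ?_⟩
  have hae : ∀ᵐ t : ℝ, ∀ r : ℚ, HasDerivAt (fun s => ∫ τ in (0 : ℝ)..s, primitiveX v r τ)
      (primitiveX v r t) t := by
    rw [ae_all_iff]
    intro r
    filter_upwards [LocallyIntegrable.ae_hasDerivAt_integral (locallyIntegrable_primitiveX hv hvM r)] with t ht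
    exact ht 0
  filter_upwards [ae_restrict_of_ae hae, ae_restrict_mem measurableSet_Ioi] with t h1 h2 x hx
  have hclosed : IsClosed {x : ℝ | W (x, t) = primitiveX v x t} := by
    refine isClosed_eq (lipschitzWith_slice_right hW t).continuous ?_
    have : LipschitzWith M'.toNNReal (fun x => primitiveX v x t) :=
      LipschitzWith.of_dist_le_mul fun x y => by
        rw [dist_eq_norm, Real.coe_toNNReal _ hM'0, Real.dist_eq]
        exact norm_primitiveX_sub_le hv hvM x y t
    exact this.continuous
  have hsub : Ioo (0 : ℝ) 1 ∩ range ((↑) : ℚ → ℝ) ⊆ {x : ℝ | W (x, t) = primitiveX v x t} := by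
    rintro y ⟨hy, r, hr⟩
    exact (hWS (show (y, t) ∈ S from ⟨⟨r, hr, hy.1.le, hy.2.le⟩, h2, h1⟩)).symm
  exact hclosed.closure_subset_iff.2 hsub
    (Rat.denseRange_cast.open_subset_closure_inter isOpen_Ioo hx)

lemma ae_prod_of_ae_ae {P : ℝ × ℝ → Prop} (hP : MeasurableSet {z | P z}) {B : Set ℝ}
    (h : ∀ᵐ t ∂(volume.restrict B), ∀ᵐ x ∂(volume.restrict (Ioo (0 : ℝ) 1)), P (x, t)) :
    ∀ᵐ z ∂(volume.restrict (Ioo (0 : ℝ) 1 ×ˢ B)), P z := by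
  rw [Measure.volume_eq_prod, ← Measure.prod_restrict, ← Measure.prod_swap,
    ae_map_iff measurable_swap.aemeasurable hP]
  have hm : MeasurableSet {p : ℝ × ℝ | P p.swap} := measurable_swap hP
  exact (Measure.ae_prod_iff_ae_ae hm).2 h

/-- Lebesgue differentiation of the primitive at almost every time; measurability of both sides
allows slicewise null sets to be assembled into one in space-time. -/
lemma partialX_potential_ae (hu : IsEntropySolution U f η q u₀ u) (hD : IsCompact D)
    (huD : ∀ᵐ z ∂strip, u z.1 z.2 ∈ D) (hf : ContinuousOn f D) :
    ∃ (W : ℝ × ℝ → Vec d) (K : NNReal), LipschitzWith K W ∧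
      ∀ᵐ z ∂strip, partialX W z = u z.1 z.2 := by
  obtain ⟨v, M', hM'0, hv, hvM, hvu⟩ := exists_bounded_modification hu
  obtain ⟨W, K, hW, hWv⟩ := exists_lipschitz_potential hu hD huD hf hM'0 hv hvM hvu
  refine ⟨W, K, hW, ?_⟩
  have : ∀ᵐ z ∂strip, partialX W z = v z := by
    refine ae_prod_of_ae_ae (measurableSet_eq_fun
      (stronglyMeasurable_partialX hW.continuous).measurable hv.measurable) ?_
    filter_upwards [hWv] with t ht
    have hloc : LocallyIntegrable (fun y => v (y, t)) :=
      MemLp.locallyIntegrable (p := ⊤) (memLp_top_of_bound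
        (hv.comp_measurable measurable_prodMk_right).aestronglyMeasurable M'
        (ae_of_all _ fun y => hvM _)) le_top
    filter_upwards [ae_restrict_of_ae (LocallyIntegrable.ae_hasDerivAt_integral hloc),
      ae_restrict_mem measurableSet_Ioo] with x h1 h2
    have hev : (fun y => W (y, t)) =ᶠ[𝓝 x] fun y => primitiveX v y t := by
      filter_upwards [Ioo_mem_nhds h2.1 h2.2] with y hy using ht y hy
    exact hev.deriv_eq.trans (h1 0).deriv
  filter_upwards [this, hvu] with z h1 h2
  rw [h1, h2]

end Representative
end ConsLaw

/-! ### Weak-* continuity in time. -/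

namespace ConsLaw

noncomputable section WeakStar

open Filter Topology

variable {d : ℕ} {U D : Set (Vec d)} {f : Vec d → Vec d} {η q : Vec d → ℝ} {u₀ : ℝ → Vec d}
  {u : ℝ → ℝ → Vec d}

/-- Integration by parts removes the derivative from `w`, which is itself continuous in time; only
values of `w` remain. -/
lemma continuous_integral_partialX_mul {K : NNReal} {w : ℝ × ℝ → ℝ} (hw : LipschitzWith K w)
    {γ : ℝ → ℝ} (hγ : ContDiff ℝ 1 γ) (hγc : HasCompactSupport γ) :
    Continuous fun t : ℝ => ∫ x in (0 : ℝ)..1, partialX w (x, t) * γ x := by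
  obtain ⟨C, hC⟩ := hγ.lipschitzWith_of_hasCompactSupport hγc one_ne_zero
  have hrw : (fun t : ℝ => ∫ x in (0 : ℝ)..1, partialX w (x, t) * γ x)
      = fun t => γ 1 * w (1, t) - γ 0 * w (0, t) - ∫ x in (0 : ℝ)..1, deriv γ x * w (x, t) := by
    ext t
    have h1 := (hC.lipschitzOnWith
      (s := uIcc (0 : ℝ) 1)).absolutelyContinuousOnInterval.integral_mul_deriv_eq_deriv_mul
      ((lipschitzWith_slice_right hw t).lipschitzOnWith
        (s := uIcc (0 : ℝ) 1)).absolutelyContinuousOnInterval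
    rw [← h1]
    exact intervalIntegral.integral_congr fun x _ => mul_comm _ _
  rw [hrw]
  have hwc := hw.continuous
  refine ((by fun_prop : Continuous fun t : ℝ => γ 1 * w (1, t) - γ 0 * w (0, t))).sub ?_
  refine intervalIntegral.continuous_parametric_intervalIntegral_of_continuous' ?_ 0 1
  have := hγ.continuous_deriv le_rfl
  fun_prop

lemma ae_differentiableAt_slice {F : Type*} [NormedAddCommGroup F] [NormedSpace ℝ F]
    [FiniteDimensional ℝ F] {K : NNReal} {W : ℝ × ℝ → F}
    (hW : LipschitzWith K W) (t : ℝ) : ∀ᵐ x : ℝ, DifferentiableAt ℝ (fun y => W (y, t)) x :=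
  (lipschitzWith_slice_right hW t).ae_differentiableAt

lemma integrable_partialX_slice_mul {K : NNReal} {w : ℝ × ℝ → ℝ} (hw : LipschitzWith K w)
    {γ : ℝ → ℝ} (hγ : Integrable γ (volume.restrict (Ioo (0 : ℝ) 1))) (t : ℝ) :
    Integrable (fun x => partialX w (x, t) * γ x) (volume.restrict (Ioo (0 : ℝ) 1)) :=
  hγ.bdd_mul ((stronglyMeasurable_partialX hw.continuous).comp_measurable
    measurable_prodMk_right).aestronglyMeasurable (ae_of_all _ fun _ => norm_partialX_le hw _)

lemma continuous_integral_inner_partialX {K : NNReal} {W : ℝ × ℝ → Vec d}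
    (hW : LipschitzWith K W) {g : ℝ → Vec d} (hg : ContDiff ℝ 1 g) (hgc : HasCompactSupport g) :
    Continuous fun t : ℝ => ∫ x in Ioo (0 : ℝ) 1, inner ℝ (partialX W (x, t)) (g x) := by
  let π : Fin d → (Vec d →L[ℝ] ℝ) := fun i => EuclideanSpace.proj i
  have hγ : ∀ i, ContDiff ℝ 1 fun x => g x i := fun i => (π i).contDiff.comp hg
  have hγc : ∀ i, HasCompactSupport fun x => g x i := fun i =>
    hgc.comp_left (g := fun v : Vec d => v i) rfl
  have hw : ∀ i, LipschitzWith (‖π i‖₊ * K) fun z => W z i := fun i => (π i).lipschitz.comp hW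
  have hrw : (fun t : ℝ => ∫ x in Ioo (0 : ℝ) 1, inner ℝ (partialX W (x, t)) (g x))
      = fun t => ∑ i, ∫ x in (0 : ℝ)..1, partialX (fun z => W z i) (x, t) * g x i := by
    ext t
    simp only [intervalIntegral.integral_of_le zero_le_one, integral_Ioc_eq_integral_Ioo]
    rw [← integral_finsetSum _ fun i _ => integrable_partialX_slice_mul (hw i)
      (((hγ i).continuous.integrable_of_hasCompactSupport (hγc i)).restrict) t]
    refine integral_congr_ae ?_
    filter_upwards [ae_restrict_of_ae (ae_differentiableAt_slice hW t)] with x hx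
    rw [PiLp.inner_apply]
    refine Finset.sum_congr rfl fun i _ => ?_
    have : partialX (fun z => W z i) (x, t) = partialX W (x, t) i :=
      ((π i).hasFDerivAt.comp_hasDerivAt x hx.hasDerivAt).deriv
    rw [this, RCLike.inner_apply, conj_trivial, mul_comm]
  rw [hrw]
  exact continuous_finsetSum _ fun i _ => continuous_integral_partialX_mul (hw i) (hγ i) (hγc i)

/-- Smooth compactly supported functions are dense in `L¹`, and `|∂ₓW| ≤ K` at every time makes the
approximation uniform in `t`, so continuity survives the limit. -/
lemma continuous_integral_inner_partialX_of_integrable {K : NNReal} {W : ℝ × ℝ → Vec d}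
    (hW : LipschitzWith K W) {ψ : ℝ → Vec d} (hψ : IntegrableOn ψ (Ioo 0 1)) :
    Continuous fun t : ℝ => ∫ x in Ioo (0 : ℝ) 1, inner ℝ (partialX W (x, t)) (ψ x) := by
  have hinner : ∀ {g : ℝ → Vec d} (t : ℝ), IntegrableOn g (Ioo 0 1) →
      Integrable (fun x => inner ℝ (partialX W (x, t)) (g x)) (volume.restrict (Ioo 0 1)) := by
    intro g t hg
    refine (hg.norm.const_mul (K : ℝ)).mono'
      (((stronglyMeasurable_partialX hW.continuous).comp_measurable
        measurable_prodMk_right).aestronglyMeasurable.inner hg.aestronglyMeasurable) ?_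
    exact ae_of_all _ fun x => (norm_inner_le_norm _ _).trans
      (mul_le_mul_of_nonneg_right (norm_partialX_le hW _) (norm_nonneg _))
  refine continuous_of_uniform_approx_of_continuous fun s hs => ?_
  obtain ⟨ε, hε, hεs⟩ := Metric.mem_uniformity_dist.1 hs
  -- Dividing by `K + 1` allows `K = 0`, and the extra half yields a strict inequality after
  -- multiplication by `K`.
  obtain ⟨g, hgc, hgs, hgε⟩ := MemLp.exist_eLpNorm_sub_le ENNReal.one_ne_top le_rfl
    (memLp_one_iff_integrable.2 hψ) (show 0 < ε / (K + 1) / 2 by positivity)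
  have hgi : IntegrableOn g (Ioo 0 1) :=
    (hgs.continuous.integrable_of_hasCompactSupport hgc).integrableOn
  refine ⟨_, continuous_integral_inner_partialX hW (hgs.of_le (by simp)) hgc, fun t => hεs ?_⟩
  rw [dist_eq_norm, ← integral_sub (hinner t hψ) (hinner t hgi)]
  have hsub : ∫ x in Ioo (0 : ℝ) 1, ‖ψ x - g x‖ ≤ ε / (K + 1) / 2 := by
    change ∫ x in Ioo (0 : ℝ) 1, ‖(ψ - g) x‖ ≤ _
    rw [integral_norm_eq_lintegral_enorm (hψ.sub hgi).aestronglyMeasurable]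
    rw [eLpNorm_one_eq_lintegral_enorm] at hgε
    exact ENNReal.toReal_le_of_le_ofReal (by positivity) hgε
  calc _ ≤ ∫ x in Ioo (0 : ℝ) 1, K * ‖ψ x - g x‖ := by
        refine norm_integral_le_of_norm_le ((hψ.sub hgi).norm.const_mul _) (ae_of_all _ fun x => ?_)
        rw [← inner_sub_right]
        exact (norm_inner_le_norm _ _).trans
          (mul_le_mul_of_nonneg_right (norm_partialX_le hW _) (norm_nonneg _))
    _ ≤ K * (ε / (K + 1) / 2) := by
        rw [integral_const_mul]
        exact mul_le_mul_of_nonneg_left hsub K.coe_nonneg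
    _ < ε := by
        have hK : (0 : ℝ) < K + 1 := by positivity
        have : (K : ℝ) * (ε / (K + 1) / 2) = (K / (K + 1)) * (ε / 2) := by ring
        rw [this]
        have h1 : (K : ℝ) / (K + 1) ≤ 1 := (div_le_one hK).2 (by linarith)
        nlinarith

/-- An entropy solution with values in a compact set has a weak-* continuous representative. -/
lemma exists_isTimeContinuousRep (hu : IsEntropySolution U f η q u₀ u) (hD : IsCompact D)
    (huD : ∀ᵐ z ∂strip, u z.1 z.2 ∈ D) (hf : ContinuousOn f D) :
    ∃ v, IsTimeContinuousRep u v := by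
  obtain ⟨W, K, hW, hWu⟩ := partialX_potential_ae hu hD huD hf
  exact ⟨fun x t => partialX W (x, t), hWu,
    fun t _ => ((stronglyMeasurable_partialX hW.continuous).comp_measurable
      measurable_prodMk_right).aestronglyMeasurable,
    ⟨K, fun t _ => ae_of_all _ fun x => norm_partialX_le hW _⟩,
    fun ψ hψ => (continuous_integral_inner_partialX_of_integrable hW hψ).continuousOn⟩

end WeakStar
end ConsLaw

/-! ### Extension of the Lipschitz function to the plane. -/

namespace ConsLaw

noncomputable section PeriodicExtension

open Filter Topology

variable {d : ℕ} {U D : Set (Vec d)} {f : Vec d → Vec d} {η q : Vec d → ℝ}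

/-- The extension of a function on `[0,1] × [0,s]`, periodic in `x` and constant in `t` outside
`[0,s]`. -/
def periodicExtension (s : ℝ) (g : ℝ → ℝ → Vec d) (z : ℝ × ℝ) : Vec d :=
  g (Int.fract z.1) (max 0 (min z.2 s))

lemma fract_mem_Icc (x : ℝ) : Int.fract x ∈ Icc (0 : ℝ) 1 :=
  ⟨Int.fract_nonneg x, (Int.fract_lt_one x).le⟩

lemma clamp_mem_Icc {s : ℝ} (hs : 0 ≤ s) (t : ℝ) : max 0 (min t s) ∈ Icc (0 : ℝ) s :=
  ⟨le_max_left _ _, max_le hs (min_le_right _ _)⟩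

lemma lipschitzWith_periodicExtension {s : ℝ} (hs : 0 ≤ s) {g : ℝ → ℝ → Vec d} {K : NNReal}
    (hg : LipschitzOnWith K (Function.uncurry g) (Icc 0 1 ×ˢ Icc 0 s))
    (hper : ∀ t ∈ Icc 0 s, g 0 t = g 1 t) : LipschitzWith (K + K) (periodicExtension s g) := by
  refine LipschitzWith.of_dist_le_mul fun z z' => ?_
  have h1 : dist (g (Int.fract z.1) (max 0 (min z.2 s)))
      (g (Int.fract z'.1) (max 0 (min z.2 s))) ≤ K * dist z.1 z'.1 := by
    have hτ := clamp_mem_Icc hs z.2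
    have : LipschitzOnWith K (fun x => g x (max 0 (min z.2 s))) (Icc 0 1) :=
      LipschitzOnWith.of_dist_le_mul fun x hx y hy => by
        simpa [Prod.dist_eq] using hg.dist_le_mul (x, _) ⟨hx, hτ⟩ (y, _) ⟨hy, hτ⟩
    exact (lipschitzWith_comp_fract this (hper _ hτ)).dist_le_mul _ _
  have h2 : dist (g (Int.fract z'.1) (max 0 (min z.2 s)))
      (g (Int.fract z'.1) (max 0 (min z'.2 s))) ≤ K * dist z.2 z'.2 := by
    have h3 := hg.dist_le_mul (Int.fract z'.1, max 0 (min z.2 s))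
      ⟨fract_mem_Icc _, clamp_mem_Icc hs _⟩ (Int.fract z'.1, max 0 (min z'.2 s))
      ⟨fract_mem_Icc _, clamp_mem_Icc hs _⟩
    refine h3.trans (mul_le_mul_of_nonneg_left ?_ K.coe_nonneg)
    have h4 : LipschitzWith 1 fun t : ℝ => max 0 (min t s) :=
      (LipschitzWith.id.min_const s).const_max 0
    simpa [Prod.dist_eq] using h4.dist_le_mul z.2 z'.2
  refine (dist_triangle _ _ _).trans ((add_le_add h1 h2).trans ?_)
  push_cast
  rw [add_mul, Prod.dist_eq]
  gcongr
  · exact le_max_left _ _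
  · exact le_max_right _ _

lemma periodicExtension_add_one (s : ℝ) (g : ℝ → ℝ → Vec d) (x t : ℝ) :
    periodicExtension s g (x + 1, t) = periodicExtension s g (x, t) := by
  simp [periodicExtension]

lemma periodicExtension_mem {s : ℝ} (hs : 0 ≤ s) {g : ℝ → ℝ → Vec d}
    (hgD : ∀ t ∈ Icc 0 s, ∀ x ∈ Icc (0 : ℝ) 1, g x t ∈ D) (z : ℝ × ℝ) :
    periodicExtension s g z ∈ D :=
  hgD _ (clamp_mem_Icc hs _) _ (fract_mem_Icc _)

lemma periodicExtension_eq {s : ℝ} (g : ℝ → ℝ → Vec d) {x t : ℝ} (hx : x ∈ Ioo (0 : ℝ) 1)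
    (ht : t ∈ Icc 0 s) : periodicExtension s g (x, t) = g x t := by
  simp only [periodicExtension]
  rw [Int.fract_eq_self.2 ⟨hx.1.le, hx.2⟩, min_eq_left ht.2, max_eq_right ht.1]

lemma partialX_periodicExtension {s : ℝ} (g : ℝ → ℝ → Vec d) {x t : ℝ} (hx : x ∈ Ioo (0 : ℝ) 1)
    (ht : t ∈ Icc 0 s) : partialX (periodicExtension s g) (x, t) = deriv (fun y => g y t) x := by
  refine EventuallyEq.deriv_eq ?_
  filter_upwards [Ioo_mem_nhds hx.1 hx.2] with y hy using periodicExtension_eq g hy ht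

lemma partialT_periodicExtension {s : ℝ} (g : ℝ → ℝ → Vec d) {x t : ℝ} (hx : x ∈ Ioo (0 : ℝ) 1)
    (ht : t ∈ Ioo 0 s) : partialT (periodicExtension s g) (x, t) = deriv (fun τ => g x τ) t := by
  refine EventuallyEq.deriv_eq ?_
  filter_upwards [Ioo_mem_nhds ht.1 ht.2] with y hy
    using periodicExtension_eq g hx ⟨hy.1.le, hy.2.le⟩

lemma residual_eq_of_differentiableAt (hf : ContDiffOn ℝ 1 f U) {g : ℝ × ℝ → Vec d}
    (hgU : ∀ z, g z ∈ U) {z : ℝ × ℝ} (hz : DifferentiableAt ℝ g z) :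
    residual U f g z = partialT g z + deriv (fun y => f (g (y, z.2))) z.1 := by
  have h1 := (hasFDerivWithinAt_of_contDiffOn hf (hgU z)).comp_hasDerivWithinAt z.1
    (s := univ) (hasDerivAt_partialX hz).hasDerivWithinAt fun y _ => hgU _
  rw [hasDerivWithinAt_univ] at h1
  rw [residual, ← h1.deriv]
  rfl

/-- The extension coincides with `g` on the open box, where derivatives are local. Rademacher's
theorem supplies the chain rule linking `Df(g)∂ₓg` to `∂ₓf(g)`. -/
lemma residual_periodicExtension_ae (hf : ContDiffOn ℝ 1 f U) (hDU : D ⊆ U) {T : EReal} {s : ℝ}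
    (hs : 0 ≤ s) (hsT : (s : EReal) ≤ T) {g R : ℝ → ℝ → Vec d} {K : NNReal}
    (hg : LipschitzWith K (periodicExtension s g))
    (hgD : ∀ t ∈ Icc 0 s, ∀ x ∈ Icc (0 : ℝ) 1, g x t ∈ D) (hR : SolvesPerturbed f T g R) :
    ∀ᵐ z ∂(volume.restrict (Ioo (0 : ℝ) 1 ×ˢ Ioo 0 s)),
      residual U f (periodicExtension s g) z = R z.1 z.2 := by
  have hsub : Ioo (0 : ℝ) 1 ×ˢ Ioo 0 s ⊆ Ioo (0 : ℝ) 1 ×ˢ {t : ℝ | 0 < t ∧ (t : EReal) < T} :=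
    prod_mono le_rfl fun t ht => ⟨ht.1, (EReal.coe_lt_coe_iff.2 ht.2).trans_le hsT⟩
  have hd : ∀ᵐ z : ℝ × ℝ, DifferentiableAt ℝ (periodicExtension s g) z := hg.ae_differentiableAt
  filter_upwards [ae_restrict_of_ae_restrict_of_subset hsub hR, ae_restrict_of_ae hd,
    ae_restrict_mem (measurableSet_Ioo.prod measurableSet_Ioo)] with z h1 h2 h3
  rw [residual_eq_of_differentiableAt hf (fun z => hDU (periodicExtension_mem hs hgD z)) h2, ← h1,
    ← partialT_periodicExtension g h3.1 h3.2]
  congr 1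
  refine EventuallyEq.deriv_eq ?_
  filter_upwards [Ioo_mem_nhds h3.1.1 h3.1.2] with y hy
  rw [periodicExtension_eq g hy ⟨h3.2.1.le, h3.2.2.le⟩]

lemma norm_partialX_periodicExtension_le (hD : IsCompact D) {s : ℝ}
    {g : ℝ → ℝ → Vec d} {K : NNReal} (hg : LipschitzWith K (periodicExtension s g))
    (hgD : ∀ t ∈ Icc 0 s, ∀ x ∈ Icc (0 : ℝ) 1, g x t ∈ D) :
    ∀ᵐ z ∂(volume.restrict (Ioo (0 : ℝ) 1 ×ˢ Ioo 0 s)),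
      ‖partialX (periodicExtension s g) z‖ ≤ normW1Inf g s := by
  obtain ⟨M, hM⟩ := hD.exists_bound_of_continuousOn (f := fun v : Vec d => v) continuousOn_id
  -- Finiteness has to be established first: `toReal` sends `⊤` to 0, and the bound by `normW1Inf`
  -- would then be lost.
  have hle : (⨆ t ∈ Ioo (0 : ℝ) s,
      (eLpNorm (fun x => g x t) ⊤ (volume.restrict (Ioo (0 : ℝ) 1))
        + eLpNorm (fun x => deriv (fun y => g y t) x) ⊤ (volume.restrict (Ioo (0 : ℝ) 1))))
      ≤ ENNReal.ofReal M + ENNReal.ofReal K := by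
    refine iSup₂_le fun t ht => add_le_add ?_ ?_
    · rw [eLpNorm_exponent_top]
      refine eLpNormEssSup_le_of_ae_bound ?_
      filter_upwards [ae_restrict_mem measurableSet_Ioo] with x hx
      exact hM _ (hgD t ⟨ht.1.le, ht.2.le⟩ x ⟨hx.1.le, hx.2.le⟩)
    · rw [eLpNorm_exponent_top]
      refine eLpNormEssSup_le_of_ae_bound ?_
      filter_upwards [ae_restrict_mem measurableSet_Ioo] with x hx
      rw [← partialX_periodicExtension g hx ⟨ht.1.le, ht.2.le⟩]
      exact norm_partialX_le hg _
  have hfin := ne_top_of_le_ne_top (ENNReal.add_ne_top.2 ⟨ENNReal.ofReal_ne_top,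
    ENNReal.ofReal_ne_top⟩) hle
  refine ae_prod_of_ae_ae (measurableSet_le
    (stronglyMeasurable_partialX hg.continuous).norm.measurable measurable_const) ?_
  filter_upwards [ae_restrict_mem measurableSet_Ioo] with t ht
  filter_upwards [ae_restrict_mem measurableSet_Ioo, ae_le_eLpNormEssSup
    (f := fun x => deriv (fun y => g y t) x) (μ := volume.restrict (Ioo (0 : ℝ) 1))] with x hx h1
  rw [partialX_periodicExtension g hx ⟨ht.1.le, ht.2.le⟩, ← toReal_enorm]
  refine ENNReal.toReal_mono hfin (h1.trans ?_)
  rw [← eLpNorm_exponent_top]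
  exact le_add_self.trans (le_iSup₂ (f := fun t (_ : t ∈ Ioo (0 : ℝ) s) =>
    eLpNorm (fun x => g x t) ⊤ (volume.restrict (Ioo (0 : ℝ) 1))
      + eLpNorm (fun x => deriv (fun y => g y t) x) ⊤ (volume.restrict (Ioo (0 : ℝ) 1))) t ht)

end PeriodicExtension
end ConsLaw

/-! ### From averaged errors to the error at a fixed time. -/

namespace ConsLaw

noncomputable section ErrorBounds

open Filter Topology

variable {d : ℕ} {U D : Set (Vec d)} {f : Vec d → Vec d} {η q : Vec d → ℝ} {u₀ : ℝ → Vec d}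
  {u v : ℝ → ℝ → Vec d}

instance isFiniteMeasure_restrict_unitInterval :
    IsFiniteMeasure (volume.restrict (Ioo (0 : ℝ) 1)) :=
  ⟨by rw [Measure.restrict_apply_univ]; exact measure_Ioo_lt_top⟩

lemma integrable_inner_of_bounded {a b : ℝ → Vec d} {A B : ℝ}
    (ha : AEStronglyMeasurable a (volume.restrict (Ioo (0 : ℝ) 1)))
    (hb : AEStronglyMeasurable b (volume.restrict (Ioo (0 : ℝ) 1)))
    (hA : ∀ᵐ x ∂(volume.restrict (Ioo (0 : ℝ) 1)), ‖a x‖ ≤ A)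
    (hB : ∀ᵐ x ∂(volume.restrict (Ioo (0 : ℝ) 1)), ‖b x‖ ≤ B) :
    IntegrableOn (fun x => inner ℝ (a x) (b x)) (Ioo (0 : ℝ) 1) := by
  refine Integrable.of_bound (ha.inner hb) (A * B) ?_
  filter_upwards [hA, hB] with x h1 h2
  exact (norm_inner_le_norm _ _).trans
    (mul_le_mul h1 h2 (norm_nonneg _) ((norm_nonneg _).trans h1))

lemma integrable_norm_sq_of_bounded {a : ℝ → Vec d} {A : ℝ}
    (ha : AEStronglyMeasurable a (volume.restrict (Ioo (0 : ℝ) 1)))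
    (hA : ∀ᵐ x ∂(volume.restrict (Ioo (0 : ℝ) 1)), ‖a x‖ ≤ A) :
    IntegrableOn (fun x => ‖a x‖ ^ 2) (Ioo (0 : ℝ) 1) := by
  simpa only [real_inner_self_eq_norm_sq] using integrable_inner_of_bounded ha ha hA hA

/-- The squared norm lies above its tangent planes. -/
lemma two_mul_inner_sub_le (a b : Vec d) : 2 * inner ℝ a b - ‖b‖ ^ 2 ≤ ‖a‖ ^ 2 := by
  have := norm_sub_sq_real a b
  nlinarith [sq_nonneg ‖a - b‖]

lemma IsTimeContinuousRep.integrable_norm_sub_sq (hv : IsTimeContinuousRep u v)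
    (hu : IsEntropySolution U f η q u₀ u) {g : ℝ × ℝ → Vec d} (hg : Continuous g) {B : ℝ}
    (hgB : ∀ z, ‖g z‖ ≤ B) {a s : ℝ} (ha : 0 ≤ a) :
    IntegrableOn (fun z : ℝ × ℝ => ‖v z.1 z.2 - g z‖ ^ 2) (Ioo 0 1 ×ˢ Ioo a s) := by
  obtain ⟨M, hM⟩ := hu.bounded
  have hS : Ioo (0 : ℝ) 1 ×ˢ Ioo a s ⊆ Ioo (0 : ℝ) 1 ×ˢ Ioi (0 : ℝ) :=
    prod_mono le_rfl fun t ht => ha.trans_lt ht.1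
  have hvu := ae_restrict_of_ae_restrict_of_subset hS hv.ae_eq
  have hmu : AEStronglyMeasurable (fun z : ℝ × ℝ => u z.1 z.2)
    (volume.restrict (Ioo (0 : ℝ) 1 ×ˢ Ioo a s)) :=
    AEStronglyMeasurable.mono_measure hu.measurable (Measure.restrict_mono hS le_rfl)
  refine integrableOn_box_of_bound (M := (M + B) ^ 2)
    (((hmu.congr (hvu.mono fun z h => h.symm)).sub hg.aestronglyMeasurable).norm.pow 2) ?_
  filter_upwards [hvu, ae_restrict_of_ae_restrict_of_subset hS hM] with z h1 h2
  rw [Real.norm_of_nonneg (sq_nonneg _), h1]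
  exact pow_le_pow_left₀ (norm_nonneg _) ((norm_sub_le _ _).trans (add_le_add h2 (hgB z))) 2

lemma integral_box_eq {F : ℝ × ℝ → ℝ} {a s : ℝ} (hF : IntegrableOn F (Ioo 0 1 ×ˢ Ioo a s)) :
    ∫ z in Ioo (0 : ℝ) 1 ×ˢ Ioo a s, F z = ∫ t in Ioo a s, ∫ x in Ioo (0 : ℝ) 1, F (x, t) := by
  rw [IntegrableOn, Measure.volume_eq_prod, ← Measure.prod_restrict] at hF
  rw [Measure.volume_eq_prod, ← Measure.prod_restrict, integral_prod_symm _ hF]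

/-- The part with `v` is continuous by weak-* continuity and the part with `g` by dominated
convergence. The moving function `g` is thereby absorbed before passing to the limit. -/
lemma IsTimeContinuousRep.continuousOn_integral_inner_sub (hv : IsTimeContinuousRep u v)
    {g : ℝ × ℝ → Vec d} (hg : Continuous g) {B : ℝ} (hgB : ∀ z, ‖g z‖ ≤ B) {ψ : ℝ → Vec d} {A : ℝ}
    (hψ : AEStronglyMeasurable ψ (volume.restrict (Ioo (0 : ℝ) 1)))
    (hA : ∀ᵐ x ∂(volume.restrict (Ioo (0 : ℝ) 1)), ‖ψ x‖ ≤ A) :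
    ContinuousOn (fun t : ℝ => ∫ x in Ioo (0 : ℝ) 1, inner ℝ (v x t - g (x, t)) (ψ x)) (Ioi 0) := by
  obtain ⟨M, hM⟩ := hv.bounded
  have hgm : ∀ t, AEStronglyMeasurable (fun x => g (x, t)) (volume.restrict (Ioo (0 : ℝ) 1)) :=
    fun t => (hg.comp (by fun_prop)).aestronglyMeasurable
  have hgc : Continuous fun t : ℝ => ∫ x in Ioo (0 : ℝ) 1, inner ℝ (g (x, t)) (ψ x) := by
    refine continuous_of_dominated (bound := fun _ => B * A)
      (fun t => (hgm t).inner hψ) (fun t => ?_) (integrable_const _) (ae_of_all _ fun x => ?_)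
    · filter_upwards [hA] with x hx
      exact (norm_inner_le_norm _ _).trans
        (mul_le_mul (hgB _) hx (norm_nonneg _) ((norm_nonneg _).trans (hgB 0)))
    · fun_prop
  refine ((hv.weakStar_continuous ψ (Integrable.of_bound hψ A hA)).sub
    hgc.continuousOn).congr fun t ht => ?_
  simp only [inner_sub_left, Pi.sub_apply]
  exact integral_sub (integrable_inner_of_bounded (hv.measurable t ht) hψ (hM t ht) hA)
    (integrable_inner_of_bounded (hgm t) hψ (ae_of_all _ fun x => hgB _) hA)

/-- A bound for averages of the squared error over short time intervals ending at `s` carries over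
to the error at time `s`, by weak lower semicontinuity of the norm. -/
lemma IsTimeContinuousRep.integral_norm_sub_sq_le (hv : IsTimeContinuousRep u v)
    (hu : IsEntropySolution U f η q u₀ u) {g : ℝ × ℝ → Vec d} (hg : Continuous g) {B : ℝ}
    (hgB : ∀ z, ‖g z‖ ≤ B) {s C : ℝ} (hs : 0 < s)
    (hC : ∀ ε, 0 < ε → ε ≤ s →
      1 / ε * (∫ z in Ioo (0 : ℝ) 1 ×ˢ Ioo (s - ε) s, ‖v z.1 z.2 - g z‖ ^ 2) ≤ C) :
    ∫ x in Ioo (0 : ℝ) 1, ‖v x s - g (x, s)‖ ^ 2 ≤ C := by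
  obtain ⟨M, hM⟩ := hv.bounded
  set P := ∫ x in Ioo (0 : ℝ) 1, ‖v x s - g (x, s)‖ ^ 2 with hP
  have hm : ∀ t, 0 < t → AEStronglyMeasurable (fun x => v x t - g (x, t))
      (volume.restrict (Ioo (0 : ℝ) 1)) := fun t ht =>
    (hv.measurable t ht).sub (hg.comp (by fun_prop)).aestronglyMeasurable
  have hbd : ∀ t, 0 < t → ∀ᵐ x ∂(volume.restrict (Ioo (0 : ℝ) 1)), ‖v x t - g (x, t)‖ ≤ M + B :=
    fun t ht => (hM t ht).mono fun x hx => (norm_sub_le _ _).trans (add_le_add hx (hgB _))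
  by_contra! hlt
  have hcont := (hv.continuousOn_integral_inner_sub hg hgB (hm s hs) (hbd s hs)).continuousAt
    (Ioi_mem_nhds hs)
  have hms : ∫ x in Ioo (0 : ℝ) 1, inner ℝ (v x s - g (x, s)) (v x s - g (x, s)) = P := by
    simp only [real_inner_self_eq_norm_sq, hP]
  -- Here `C < P`, so the threshold lies below `P`, the value of the pairing at `s`. It is chosen so
  -- that the tangent inequality gives `2 (3P + C)/4 - P = (P + C)/2`, still above `C`.
  have hev : ∀ᶠ t in 𝓝 s, (3 * P + C) / 4
      < ∫ x in Ioo (0 : ℝ) 1, inner ℝ (v x t - g (x, t)) (v x s - g (x, s)) := by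
    refine hcont.eventually (lt_mem_nhds ?_)
    beta_reduce
    rw [hms]
    linarith
  obtain ⟨δ, hδ, hball⟩ := Metric.eventually_nhds_iff.1 hev
  set ε := min δ s with hεdef
  have hε : 0 < ε := lt_min hδ hs
  have hεs : ε ≤ s := min_le_right _ _
  have hlow : ∀ t ∈ Ioo (s - ε) s, (P + C) / 2 ≤ ∫ x in Ioo (0 : ℝ) 1, ‖v x t - g (x, t)‖ ^ 2 := by
    intro t ht
    have ht0 : 0 < t := by linarith [ht.1]
    have h1 := hball (y := t) (by
      rw [Real.dist_eq, abs_sub_comm, abs_of_pos (sub_pos.2 ht.2)]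
      linarith [ht.1, min_le_left δ s])
    have hi := integrable_inner_of_bounded (hm t ht0) (hm s hs) (hbd t ht0) (hbd s hs)
    have hi2 := integrable_norm_sq_of_bounded (hm s hs) (hbd s hs)
    have h2 : ∫ x in Ioo (0 : ℝ) 1, (2 * inner ℝ (v x t - g (x, t)) (v x s - g (x, s))
        - ‖v x s - g (x, s)‖ ^ 2) ≤ ∫ x in Ioo (0 : ℝ) 1, ‖v x t - g (x, t)‖ ^ 2 :=
      integral_mono ((hi.const_mul 2).sub hi2)
        (integrable_norm_sq_of_bounded (hm t ht0) (hbd t ht0)) fun x => two_mul_inner_sub_le _ _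
    rw [integral_sub (hi.const_mul 2) hi2, integral_const_mul, ← hP] at h2
    linarith
  have hint := hv.integrable_norm_sub_sq hu hg hgB (s := s) (sub_nonneg.2 hεs)
  have h3 := hC ε hε hεs
  rw [integral_box_eq hint] at h3
  have hint' : IntegrableOn (fun t => ∫ x in Ioo (0 : ℝ) 1, ‖v x t - g (x, t)‖ ^ 2)
      (Ioo (s - ε) s) := by
    rw [IntegrableOn, Measure.volume_eq_prod, ← Measure.prod_restrict] at hint
    exact hint.integral_prod_right
  -- Averaging the lower bound over `(s-ε, s)` contradicts the assumed upper bound `C`.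
  have h4 : ∫ t in Ioo (s - ε) s, (P + C) / 2
      ≤ ∫ t in Ioo (s - ε) s, ∫ x in Ioo (0 : ℝ) 1, ‖v x t - g (x, t)‖ ^ 2 :=
    setIntegral_mono_on (integrableOn_const (by simp)) hint' measurableSet_Ioo hlow
  rw [setIntegral_const, measureReal_def, Real.volume_Ioo, sub_sub_cancel,
    ENNReal.toReal_ofReal hε.le, smul_eq_mul] at h4
  have h5 : (P + C) / 2 ≤ C := by
    refine le_trans ?_ h3
    rw [one_div, ← div_eq_inv_mul, le_div_iff₀ hε]
    linarith
  linarith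

/-- The error bound for a Lipschitz periodic solution of the perturbed equation. -/
theorem errorBound_of_solvesPerturbed (hsys : IsEntropySystem U f η q) {Cf Clo Chi : ℝ}
    (hb : HessianBounds U D f η Cf Clo Chi) (hDU : D ⊆ U) (hD : IsCompact D) (hDc : Convex ℝ D)
    (hClo : 0 < Clo) (hChi : Clo ≤ Chi) (hu : IsEntropySolution U f η q u₀ u)
    (huD : ∀ᵐ z ∂strip, u z.1 z.2 ∈ D) (hv : IsTimeContinuousRep u v) {T : EReal}
    {g R : ℝ → ℝ → Vec d} (hg : IsLipschitz T g) (hper : ∀ t ∈ timeInterval T, g 0 t = g 1 t)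
    (hgD : ∀ t ∈ timeInterval T, ∀ x ∈ Icc (0 : ℝ) 1, g x t ∈ D) (hR : SolvesPerturbed f T g R)
    {s : ℝ} (hsT : s ∈ timeInterval T) (hs : 0 < s) : ErrorBound Cf Clo Chi u₀ v g R s := by
  have hsub : Icc 0 s ⊆ timeInterval T := fun t ht =>
    ⟨ht.1, (EReal.coe_le_coe_iff.2 ht.2).trans hsT.2⟩
  have hf1 : ContDiffOn ℝ 1 f U := hsys.flux_smooth.of_le (by norm_num)
  obtain ⟨K, hK⟩ := hg s hsT
  set G := periodicExtension s g with hG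
  have hgD' : ∀ t ∈ Icc 0 s, ∀ x ∈ Icc (0 : ℝ) 1, g x t ∈ D := fun t ht => hgD t (hsub ht)
  have hGL := lipschitzWith_periodicExtension hs.le hK fun t ht => hper t (hsub ht)
  have hGD := periodicExtension_mem hs.le hgD'
  have hu₀D := initial_mem hu hD hDc huD (hf1.continuousOn.mono hDU)
  obtain ⟨B, hB⟩ := hD.exists_bound_of_continuousOn (f := fun v : Vec d => v) continuousOn_id
  have hGB : ∀ z, ‖G z‖ ≤ B := fun z => hB _ (hGD z)
  have hvu : ∀ a, 0 ≤ a → ∫ z in Ioo (0 : ℝ) 1 ×ˢ Ioo a s, ‖u z.1 z.2 - G z‖ ^ 2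
      = ∫ z in Ioo (0 : ℝ) 1 ×ˢ Ioo a s, ‖v z.1 z.2 - G z‖ ^ 2 := by
    intro a ha
    refine integral_congr_ae ?_
    filter_upwards [ae_restrict_of_ae_restrict_of_subset (prod_mono le_rfl
      fun t ht => ha.trans_lt ht.1 : Ioo (0 : ℝ) 1 ×ˢ Ioo a s ⊆ Ioo (0 : ℝ) 1 ×ˢ Ioi (0 : ℝ))
      hv.ae_eq] with z hz
    rw [hz]
  have hslice : ∀ (w : ℝ → Vec d) (t : ℝ), t ∈ Icc 0 s →
      ∫ x in Ioo (0 : ℝ) 1, ‖w x - G (x, t)‖ ^ 2 = ∫ x in Ioo (0 : ℝ) 1, ‖w x - g x t‖ ^ 2 :=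
    fun w t ht => setIntegral_congr_fun measurableSet_Ioo fun x hx => by
      simp only [hG, periodicExtension_eq g hx ht]
  have hbox : ∫ z in Ioo (0 : ℝ) 1 ×ˢ Ioo 0 s, ‖u z.1 z.2 - G z‖ ^ 2
      = ∫ σ in Ioo (0 : ℝ) s, ∫ x in Ioo (0 : ℝ) 1, ‖v x σ - g x σ‖ ^ 2 := by
    rw [hvu 0 le_rfl, integral_box_eq (hv.integrable_norm_sub_sq hu hGL.continuous hGB le_rfl)]
    exact setIntegral_congr_fun measurableSet_Ioo fun t ht => hslice _ t ⟨ht.1.le, ht.2.le⟩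
  have hres : ∫ z in Ioo (0 : ℝ) 1 ×ˢ Ioo 0 s, ‖residual U f G z‖ ^ 2
      = ∫ z in Ioo (0 : ℝ) 1 ×ˢ Ioo 0 s, ‖R z.1 z.2‖ ^ 2 := by
    refine integral_congr_ae ?_
    filter_upwards [residual_periodicExtension_ae hf1 hDU hs.le hsT.2 hGL hgD' hR] with z hz
    rw [hz]
  -- Dividing by `Clo > 0` yields a bound on the averages independent of `ε`, as weak lower
  -- semicontinuity requires.
  have key := hv.integral_norm_sub_sq_le hu hGL.continuous hGB hs fun ε hε hεs => by
    have := averaged_error_le hsys hb hDU hD hDc hClo.le (hClo.le.trans hChi) hu huD hu₀D hGL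
      (periodicExtension_add_one s g) hGD hε hεs (norm_partialX_periodicExtension_le hD hGL hgD')
    rw [hvu _ (sub_nonneg.2 hεs), ← le_div_iff₀' hClo] at this
    exact this
  rw [hslice _ s ⟨hs.le, le_rfl⟩, hslice _ 0 ⟨le_rfl, hs.le⟩, hbox, hres, le_div_iff₀' hClo,
    ← add_assoc] at key
  exact key

end ErrorBounds
end ConsLaw

/-! ### The discontinuous Galerkin reconstruction as a perturbed solution. -/

namespace ConsLaw

noncomputable section Reconstruction

open Filter Topology

variable {d N p : ℕ} {m : Mesh N} {U D : Set (Vec d)} {f : Vec d → Vec d} {η q : Vec d → ℝ}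
  {u₀ : ℝ → Vec d} {u v : ℝ → ℝ → Vec d} {T : EReal}

namespace Mesh

lemma left_lt_right (m : Mesh N) (n : Fin N) : m.left n < m.right n :=
  m.strictMono Fin.castSucc_lt_succ

lemma left_mem (m : Mesh N) (n : Fin N) : m.left n ∈ Icc (m.left n) (m.right n) :=
  ⟨le_rfl, (m.left_lt_right n).le⟩

lemma right_mem (m : Mesh N) (n : Fin N) : m.right n ∈ Icc (m.left n) (m.right n) :=
  ⟨(m.left_lt_right n).le, le_rfl⟩

lemma exists_mem_cell (m : Mesh N) {x : ℝ} (hx : x ∈ Ioo (0 : ℝ) 1) (hxm : x ∉ range m.node) :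
    ∃ n, x ∈ Ioo (m.left n) (m.right n) := by
  have key : ∀ k : Fin (N + 1), x < m.node k → ∃ n, x ∈ Ioo (m.left n) (m.right n) := by
    intro k
    induction k using Fin.induction with
    | zero => intro h; rw [m.first] at h; exact absurd h hx.1.not_gt
    | succ k ih =>
      intro h
      rcases lt_or_ge x (m.node k.castSucc) with h' | h'
      · exact ih h'
      · exact ⟨k, h'.lt_of_ne fun e => hxm ⟨_, e⟩, h⟩
  exact key (Fin.last N) (by rw [m.last]; exact hx.2)

end Mesh

lemma hasDerivWithinAt_toLp {φ : ℝ → Fin d → ℝ} {φ' : Fin d → ℝ} {s : Set ℝ} {x : ℝ}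
    (h : ∀ i, HasDerivWithinAt (fun y => φ y i) (φ' i) s x) :
    HasDerivWithinAt (fun y => (WithLp.toLp 2 (φ y) : Vec d)) (WithLp.toLp 2 φ') s x :=
  ((PiLp.continuousLinearEquiv 2 ℝ fun _ : Fin d => ℝ).symm.hasFDerivAt).comp_hasDerivWithinAt x
    (hasDerivWithinAt_pi.2 h)

namespace PwPoly

/-- The cellwise derivative. -/
def derivative (g : PwPoly N d) : PwPoly N d := fun n i => (g n i).derivative

lemma deriv_val (g : PwPoly N d) (n : Fin N) (x : ℝ) :
    deriv (g.val n) x = g.derivative.val n x := by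
  have := hasDerivWithinAt_toLp (s := univ) fun i => ((g n i).hasDerivAt x).hasDerivWithinAt
  rw [hasDerivWithinAt_univ] at this
  exact this.deriv

lemma DegLT.derivative {k : ℕ} {g : PwPoly N d} (hg : g.DegLT (k + 1)) : g.derivative.DegLT k := by
  intro n i
  rw [Polynomial.degree_lt_iff_coeff_zero]
  intro l hl
  rw [PwPoly.derivative, Polynomial.coeff_derivative,
    (Polynomial.degree_lt_iff_coeff_zero _ _).1 (hg n i) _ (by omega), zero_mul]

lemma continuous_val (g : PwPoly N d) (n : Fin N) : Continuous (g.val n) :=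
  (PiLp.continuous_toLp 2 _).comp (continuous_pi fun i => (g n i).continuous)

lemma val_add (g h : PwPoly N d) (n : Fin N) (x : ℝ) : (g + h).val n x = g.val n x + h.val n x := by
  ext i
  simp [val]

lemma DegLT.add {k : ℕ} {g h : PwPoly N d} (hg : g.DegLT k) (hh : h.DegLT k) :
    (g + h).DegLT k := fun n i =>
  (Polynomial.degree_add_le _ _).trans_lt (max_lt (hg n i) (hh n i))

lemma integrable_inner_val (m : Mesh N) (g h : PwPoly N d) (n : Fin N) :
    IntegrableOn (fun x => inner ℝ (g.val n x) (h.val n x)) (Ioo (m.left n) (m.right n)) :=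
  ((((g.continuous_val n).inner (h.continuous_val n)).continuousOn
    (s := Icc (m.left n) (m.right n))).integrableOn_Icc).mono_set Ioo_subset_Icc_self

/-- A piecewise polynomial that is orthogonal to itself vanishes. -/
lemma val_eq_zero_of_integral_eq_zero (m : Mesh N) {g : PwPoly N d}
    (hg : ∑ n, ∫ x in Ioo (m.left n) (m.right n), inner ℝ (g.val n x) (g.val n x) = 0) (n : Fin N)
    {x : ℝ} (hx : x ∈ Ioo (m.left n) (m.right n)) : g.val n x = 0 := by
  have hnn : ∀ k, 0 ≤ ∫ x in Ioo (m.left k) (m.right k), inner ℝ (g.val k x) (g.val k x) :=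
    fun k => integral_nonneg fun x => real_inner_self_nonneg
  have h1 := (Finset.sum_eq_zero_iff_of_nonneg fun k _ => hnn k).1 hg n (Finset.mem_univ n)
  rw [setIntegral_eq_zero_iff_of_nonneg_ae (ae_of_all _ fun x => real_inner_self_nonneg)
    (integrable_inner_val m g g n)] at h1
  have h2 := Measure.eqOn_open_of_ae_eq h1 isOpen_Ioo
    ((g.continuous_val n).inner (g.continuous_val n)).continuousOn continuousOn_const hx
  exact inner_self_eq_zero.1 h2

/-- The piecewise polynomial whose coefficients are the time derivatives of those of `g`. -/
def timeDerivative (T : EReal) (k : ℕ) (g : ℝ → PwPoly N d) (t : ℝ) : PwPoly N d := fun n i =>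
  ∑ j : Fin k, Polynomial.C (derivWithin (fun τ => (g τ n i).coeff j) (timeInterval T) t)
    * Polynomial.X ^ (j : ℕ)

lemma timeDerivative_degLT (T : EReal) (k : ℕ) (g : ℝ → PwPoly N d) (t : ℝ) :
    (timeDerivative T k g t).DegLT k := fun _ _ => Polynomial.degree_sum_fin_lt _

lemma eval_eq_sum_of_degree_lt {k : ℕ} {P : Polynomial ℝ} (hP : P.degree < (k : WithBot ℕ))
    (x : ℝ) : P.eval x = ∑ j : Fin k, P.coeff j * x ^ (j : ℕ) := by
  rcases eq_or_ne P 0 with rfl | h0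
  · simp
  · rw [Fin.sum_univ_eq_sum_range fun j => P.coeff j * x ^ j]
    exact Polynomial.eval_eq_sum_range' ((Polynomial.natDegree_lt_iff_degree_lt h0).2 hP) x

/-- The time derivative of the discrete solution is again a cellwise polynomial of degree below `k`,
so it can serve as a test function in the scheme. -/
lemma timeDeriv_eq_val {k : ℕ} {g : ℝ → PwPoly N d} (hdeg : ∀ t ∈ timeInterval T, (g t).DegLT k)
    (hg : ∀ n i j, ContDiffOn ℝ 1 (fun t => (g t n i).coeff j) (timeInterval T)) {t : ℝ}
    (ht : timeInterval T ∈ 𝓝 t) (n : Fin N) (x : ℝ) :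
    timeDeriv T g n x t = (timeDerivative T k g t).val n x := by
  have htm := mem_of_mem_nhds ht
  refine HasDerivWithinAt.derivWithin (hasDerivWithinAt_toLp fun i => ?_)
    (uniqueDiffWithinAt_of_mem_nhds ht)
  have h1 : HasDerivWithinAt (fun τ => ∑ j : Fin k, (g τ n i).coeff j * x ^ (j : ℕ))
      (∑ j : Fin k, derivWithin (fun τ => (g τ n i).coeff j) (timeInterval T) t * x ^ (j : ℕ))
      (timeInterval T) t :=
    HasDerivWithinAt.fun_sum fun j _ =>
      (((hg n i j).differentiableOn one_ne_zero t htm).hasDerivWithinAt).mul_const _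
  have h2 : (timeDerivative T k g t n i).eval x = ∑ j : Fin k,
      derivWithin (fun τ => (g τ n i).coeff j) (timeInterval T) t * x ^ (j : ℕ) := by
    simp [timeDerivative, Polynomial.eval_finsetSum]
  rw [h2]
  exact h1.congr (fun τ hτ => eval_eq_sum_of_degree_lt (hdeg τ hτ n i) x)
    (eval_eq_sum_of_degree_lt (hdeg t htm n i) x)

end PwPoly

lemma timeInterval_mem_nhds {t : ℝ} (ht : 0 < t) (htT : (t : EReal) < T) :
    timeInterval T ∈ 𝓝 t := by
  have h1 : ∀ᶠ τ : ℝ in 𝓝 t, (τ : EReal) < T :=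
    continuous_coe_real_ereal.continuousAt.eventually (gt_mem_nhds htT)
  filter_upwards [lt_mem_nhds ht, h1] with τ h2 h3 using ⟨h2.le, h3.le⟩

variable {F w : Vec d → Vec d → Vec d} {L : ℝ} {uh : ℝ → PwPoly N d} {g R : ℝ → ℝ → Vec d}

/-- The reconstruction of the flux turns the scheme into an identity that holds pointwise. -/
lemma timeDeriv_add_deriv_fluxReconstruction (hF : IsNumericalFlux U f F w L)
    (hdg : IsDGSolution m p U f F T uh) {t : ℝ} (ht : 0 < t) (htT : (t : EReal) < T)
    {fh : PwPoly N d} (hfh : IsFluxReconstruction m p f w (uh t) fh) (n : Fin N) {x : ℝ}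
    (hx : x ∈ Ioo (m.left n) (m.right n)) :
    timeDeriv T uh n x t + deriv (fh.val n) x = 0 := by
  have hnhds := timeInterval_mem_nhds ht htT
  have htm := mem_of_mem_nhds hnhds
  have htd := PwPoly.timeDeriv_eq_val hdg.degree hdg.smooth hnhds
  set a := PwPoly.timeDerivative T (p + 1) uh t
  have hval : ∀ n x, timeDeriv T uh n x t + deriv (fh.val n) x = (a + fh.derivative).val n x :=
    fun n x => by rw [PwPoly.val_add, htd, PwPoly.deriv_val]
  rw [hval]
  refine PwPoly.val_eq_zero_of_integral_eq_zero m ?_ n hx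
  -- Differentiating the flux reconstruction lowers its degree to at most `p`, so `∂ₜu_h + ∂ₓf̂` may
  -- be tested against itself. The scheme and the flux moments then make its squared norm zero.
  set φ := a + fh.derivative
  have hφ : φ.DegLT (p + 1) := (PwPoly.timeDerivative_degLT T _ uh t).add hfh.degree.derivative
  have h1 := hdg.scheme t htm φ hφ
  have h2 := hfh.moments φ hφ
  have hflux : dgFluxForm m f F (uh t) φ = dgFluxForm m f (fun a b => f (w a b)) (uh t) φ := by
    have : ∀ n, F ((uh t).traceMinus m n) ((uh t).tracePlus m n)
        = f (w ((uh t).traceMinus m n) ((uh t).tracePlus m n)) := fun n =>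
      hF.flux_eq _ (hdg.mem t htm _ _ (m.right_mem _)) _ (hdg.mem t htm _ _ (m.left_mem _))
    simp only [dgFluxForm, this]
  rw [hflux, ← h2, ← Finset.sum_add_distrib] at h1
  rw [← h1]
  refine Finset.sum_congr rfl fun k _ => ?_
  simp only [htd, PwPoly.deriv_val]
  rw [← integral_add (PwPoly.integrable_inner_val m _ _ k) (PwPoly.integrable_inner_val m _ _ k)]
  simp only [← inner_add_left, ← PwPoly.val_add]
  rfl

/-- The traces at the first node from both sides equal the same value of `w`, and the cell preceding
the first one is the last. -/
lemma IsReconstructionWithResidual.periodic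
    (h : IsReconstructionWithResidual m p f w T uh g R) {t : ℝ} (ht : t ∈ timeInterval T) :
    g 0 t = g 1 t := by
  obtain ⟨rp, hrp, hval⟩ := h.reconstruction t ht
  cases N with
  -- Without cells the first and last nodes coincide, contradicting `0 ≠ 1`.
  | zero =>
    have h1 := m.last
    have h0 : m.node (Fin.last 0) = 0 := m.first
    rw [h0] at h1
    exact absurd h1 zero_ne_one
  | succ k =>
    have hl : m.left 0 = 0 := m.first
    have hr : m.right (Fin.last k) = 1 := m.last
    have hrot : (finRotate (k + 1)).symm 0 = Fin.last k := by
      rw [Equiv.symm_apply_eq, finRotate_last]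
    have h1 := hval 0 (m.left 0) (m.left_mem 0)
    have h2 := hval (Fin.last k) (m.right (Fin.last k)) (m.right_mem _)
    have h3 := (hrp.trace_plus 0).trans (hrp.trace_minus 0).symm
    rw [PwPoly.tracePlus, PwPoly.traceMinus, hrot, ← h1, ← h2, hl, hr] at h3
    exact h3

/-- In the open cells `∂ₜu_h + ∂ₓf̂ = 0`, so these terms cancel from `R` and leave `∂ₜû + ∂ₓf(û)`.
The nodes are finite in number and hence form a null set in space-time. -/
lemma IsReconstructionWithResidual.solvesPerturbed
    (h : IsReconstructionWithResidual m p f w T uh g R) (hF : IsNumericalFlux U f F w L)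
    (hdg : IsDGSolution m p U f F T uh) : SolvesPerturbed f T g R := by
  have hopen : IsOpen {t : ℝ | 0 < t ∧ (t : EReal) < T} :=
    (isOpen_lt continuous_const continuous_id).inter
      (isOpen_lt continuous_coe_real_ereal continuous_const)
  have hnode : ∀ᵐ z : ℝ × ℝ, z.1 ∉ range m.node :=
    Measure.quasiMeasurePreserving_fst.ae ((finite_range m.node).countable.ae_notMem volume)
  filter_upwards [ae_restrict_of_ae hnode,
    ae_restrict_mem (measurableSet_Ioo.prod hopen.measurableSet)] with z h1 h2
  obtain ⟨n, hn⟩ := m.exists_mem_cell h2.1 h1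
  obtain ⟨fh, hfh, hR⟩ := h.residual z.2 h2.2.1 h2.2.2
  rw [hR n z.1 hn, add_comm, eq_comm, ← sub_eq_zero]
  have h0 := timeDeriv_add_deriv_fluxReconstruction hF hdg h2.2.1 h2.2.2 hfh n hn
  rw [add_eq_zero_iff_eq_neg] at h0
  rw [h0]
  abel

end Reconstruction
end ConsLaw

theorem lemma5p1 {d : ℕ} (U D : Set (ConsLaw.Vec d))
    (f : ConsLaw.Vec d → ConsLaw.Vec d) (η q : ConsLaw.Vec d → ℝ)
    (hsys : ConsLaw.IsEntropySystem U f η q)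
    (hDU : D ⊆ U) (hDcompact : IsCompact D) (hDconvex : Convex ℝ D)
    (Cf Clo Chi : ℝ) (hCf : 0 ≤ Cf) (hClo : 0 < Clo) (hChi : Clo ≤ Chi)
    (hbounds : ConsLaw.HessianBounds U D f η Cf Clo Chi)
    (u₀ : ℝ → ConsLaw.Vec d) (u : ℝ → ℝ → ConsLaw.Vec d)
    (hu : ConsLaw.IsEntropySolution U f η q u₀ u)
    (huD : ∀ᵐ z ∂(volume.restrict (Ioo (0 : ℝ) 1 ×ˢ Ioi (0 : ℝ))), u z.1 z.2 ∈ D) :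
    -- `u(·, s)` is meaningful for every `s > 0`
    (∃ v, ConsLaw.IsTimeContinuousRep u v) ∧
    ∀ v, ConsLaw.IsTimeContinuousRep u v →
      -- the bound for every Lipschitz periodic solution of the perturbed equation
      (∀ (T : EReal) (uhat R : ℝ → ℝ → ConsLaw.Vec d), 0 < T →
        ConsLaw.IsLipschitz T uhat →
        (∀ t ∈ ConsLaw.timeInterval T, uhat 0 t = uhat 1 t) →
        (∀ t ∈ ConsLaw.timeInterval T, ∀ x ∈ Icc (0 : ℝ) 1, uhat x t ∈ D) →
        ConsLaw.SolvesPerturbed f T uhat R →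
        ∀ s ∈ ConsLaw.timeInterval T, 0 < s →
          ConsLaw.ErrorBound Cf Clo Chi u₀ v uhat R s) ∧
      -- the bound for the reconstruction of the discontinuous Galerkin solution
      (∀ (T : EReal) (N p : ℕ) (m : ConsLaw.Mesh N)
        (F w : ConsLaw.Vec d → ConsLaw.Vec d → ConsLaw.Vec d) (L : ℝ)
        (uh : ℝ → ConsLaw.PwPoly N d) (uhat R : ℝ → ℝ → ConsLaw.Vec d), 0 < T →
        ConsLaw.IsNumericalFlux U f F w L →
        ConsLaw.IsDGSolution m p U f F T uh →
        ConsLaw.IsReconstructionWithResidual m p f w T uh uhat R →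
        ConsLaw.IsLipschitz T uhat →
        (∀ t ∈ ConsLaw.timeInterval T, ∀ x ∈ Icc (0 : ℝ) 1, uhat x t ∈ D) →
        ∀ s ∈ ConsLaw.timeInterval T, 0 < s →
          ConsLaw.ErrorBound Cf Clo Chi u₀ v uhat R s) := by
  have hf : ContinuousOn f D := hsys.flux_smooth.continuousOn.mono hDU
  refine ⟨ConsLaw.exists_isTimeContinuousRep hu hDcompact huD hf, fun v hv => ⟨?_, ?_⟩⟩
  · intro T uhat R _ hLip hper hval hR s hsT hs
    exact ConsLaw.errorBound_of_solvesPerturbed hsys hbounds hDU hDcompact hDconvex hClo hChi hu huD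
      hv hLip hper hval hR hsT hs
  · intro T N p m F w L uh uhat R _ hF hdg hrec hLip hval s hsT hs
    exact ConsLaw.errorBound_of_solvesPerturbed hsys hbounds hDU hDcompact hDconvex hClo hChi hu huD
      hv hLip (fun t ht => hrec.periodic ht) hval (hrec.solvesPerturbed hF hdg) hsT hs
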